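/- Theorem 1. Let $\mathcal P$ be a Beurling generalized prime system, that is, an unbounded sequence of real numbers $1<p_1\le p_2\le p_3\le\cdots$, and let $\mathcal N$ be the multiset of all products $p_1^{a_1}\cdots p_k^{a_k}$ with $k\ge 0$ and $a_1,\dots,a_k\in\mathbb N_0$ (one element of $\mathcal N$ for each finitely supported exponent sequence $(a_i)$). Put $\mu_{\mathcal P}(n)=(-1)^k$ if $n$ is a product of $k\ge 0$ generalized primes with distinct indices, and $\mu_{\mathcal P}(n)=0$ for every other element of $\mathcal N$, and let $$\psi_{\mathcal P}(x)=\sum_{i,k\ge 1,\ p_i^k\le x}\log p_i,\qquad N_{\mathcal P}(x)=\sum_{n\in\mathcal N,\ n\le x}1,\qquad M_{\mathcal P}(x)=\sum_{n\in\mathcal N,\ n\le x}\mu_{\mathcal P}(n).$$ Suppose that the Dirichlet series $\zeta_{\mathcal P}(s)=\sum_{n\in\mathcal N}n^{-s}$ has abscissa of convergence $1$. Let $\alpha$ be the infimum of the real $\theta$ for which $\psi_{\mathcal P}(x)=x+O(x^{\theta})$ as $x\to\infty$, let $\beta$ be the infimum of the real $\theta$ for which $N_{\mathcal P}(x)=\rho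 x+O(x^{\theta})$ for some $\rho>0$, and let $\gamma$ be the infimum of the real $\theta$ for which $M_{\mathcal P}(x)=O(x^{\theta})$ (infima in $[-\infty,\infty]$; $\gamma=-\infty$ if $M_{\mathcal P}(x)=0$ for all large $x$). Then the two largest of $\alpha,\beta,\gamma$ are equal, and their common value is at least $\frac12$. -/

import Mathlib

open Filter Asymptotics

/-- A Beurling generalized prime system: an unbounded nondecreasing sequence of real numbers
`1 < p 0 ≤ p 1 ≤ p 2 ≤ ⋯` (repetitions are allowed). -/
structure BeurlingSystem where
  p : ℕ → ℝ
  one_lt : 1 < p 0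
  mono : Monotone p
  unbounded : ¬ BddAbove (Set.range p)

namespace BeurlingSystem

/-- The value `∏ p_i ^ e_i` of the generalized integer with exponent vector `e`. The multiset of
generalized integers is the family `P.val e`, indexed by all finitely supported `e : ℕ →₀ ℕ`. -/
noncomputable def val (P : BeurlingSystem) (e : ℕ →₀ ℕ) : ℝ :=
  e.prod fun i k => P.p i ^ k

theorem one_lt_p (P : BeurlingSystem) (i : ℕ) : 1 < P.p i :=
  P.one_lt.trans_le (P.mono (Nat.zero_le i))

theorem pow_le_val (P : BeurlingSystem) (e : ℕ →₀ ℕ) (i : ℕ) : P.p i ^ e i ≤ P.val e := by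
  have h1 : ∀ j, 1 ≤ P.p j ^ e j := fun j => one_le_pow₀ (P.one_lt_p j).le
  by_cases hi : i ∈ e.support
  · unfold val Finsupp.prod
    rw [← Finset.mul_prod_erase _ _ hi]
    have h2 : 1 ≤ ∏ j ∈ e.support.erase i, P.p j ^ e j :=
      Finset.prod_induction _ (1 ≤ ·) (fun _ _ => one_le_mul_of_one_le_of_one_le) le_rfl fun j _ => h1 j
    nlinarith [h1 i]
  · rw [Finsupp.notMem_support_iff.mp hi, pow_zero]
    exact Finset.prod_induction _ (1 ≤ ·) (fun _ _ => one_le_mul_of_one_le_of_one_le) le_rfl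
      fun j _ => h1 j

/-- If `p i ^ k ≤ x` with `k ≠ 0`, then both `i` and `k` are bounded in terms of `x`. -/
theorem exists_bound (P : BeurlingSystem) (x : ℝ) :
    ∃ n : ℕ, ∀ i k : ℕ, k ≠ 0 → P.p i ^ k ≤ x → i < n ∧ k < n := by
  obtain ⟨K, hK⟩ := pow_unbounded_of_one_lt x P.one_lt
  obtain ⟨_, ⟨m, rfl⟩, hm⟩ := not_bddAbove_iff.mp P.unbounded x
  refine ⟨max m K, fun i k hk h => ⟨?_, ?_⟩⟩
  · by_contra hc
    have h1 : P.p m ≤ P.p i := P.mono ((le_max_left m K).trans (not_lt.mp hc))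
    have h2 : P.p i ≤ P.p i ^ k := le_self_pow₀ (P.one_lt_p i).le hk
    linarith
  · by_contra hc
    have h1 : P.p 0 ^ K ≤ P.p 0 ^ k :=
      pow_le_pow_right₀ P.one_lt.le ((le_max_right m K).trans (not_lt.mp hc))
    have h2 : P.p 0 ^ k ≤ P.p i ^ k :=
      pow_le_pow_left₀ (zero_le_one.trans P.one_lt.le) (P.mono (Nat.zero_le i)) k
    linarith

theorem finite_integers (P : BeurlingSystem) (x : ℝ) : {e : ℕ →₀ ℕ | P.val e ≤ x}.Finite := by
  obtain ⟨n, hn⟩ := P.exists_bound x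
  refine (Set.finite_Iic (Finsupp.indicator (Finset.range n) fun _ _ => n)).subset ?_
  intro e he i
  by_cases h0 : e i = 0
  · simp [h0]
  · obtain ⟨h1, h2⟩ := hn i (e i) h0 ((P.pow_le_val e i).trans he)
    simpa [Finsupp.indicator_apply, h1] using h2.le

theorem finite_primePowers (P : BeurlingSystem) (x : ℝ) :
    {q : ℕ × ℕ | 1 ≤ q.2 ∧ P.p q.1 ^ q.2 ≤ x}.Finite := by
  obtain ⟨n, hn⟩ := P.exists_bound x
  refine ((Set.finite_Iio n).prod (Set.finite_Iio n)).subset ?_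
  rintro ⟨i, k⟩ ⟨h1, h2⟩
  exact hn i k (by simp only at h1; omega) h2

/-- The generalized integers not exceeding `x` (as exponent vectors). -/
noncomputable def integersLE (P : BeurlingSystem) (x : ℝ) : Finset (ℕ →₀ ℕ) :=
  (P.finite_integers x).toFinset

/-- The pairs `(i, k)` with `k ≥ 1` and `p_i ^ k ≤ x`. -/
noncomputable def primePowersLE (P : BeurlingSystem) (x : ℝ) : Finset (ℕ × ℕ) :=
  (P.finite_primePowers x).toFinset

/-- The counting function `N_P(x)` of the generalized integers. -/
noncomputable def N (P : BeurlingSystem) (x : ℝ) : ℝ :=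
  ∑ _e ∈ P.integersLE x, 1

/-- The Chebyshev function `ψ_P(x)`. -/
noncomputable def psi (P : BeurlingSystem) (x : ℝ) : ℝ :=
  ∑ q ∈ P.primePowersLE x, Real.log (P.p q.1)

/-- The Möbius function on generalized integers: `(-1) ^ k` on a product of `k` generalized primes
with distinct indices, and `0` on all other generalized integers. -/
def moebius (e : ℕ →₀ ℕ) : ℤ :=
  if ∀ i ∈ e.support, e i = 1 then (-1) ^ e.support.card else 0

/-- The summatory function `M_P(x)` of the Möbius function. -/
noncomputable def M (P : BeurlingSystem) (x : ℝ) : ℝ :=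
  ∑ e ∈ P.integersLE x, (moebius e : ℝ)

/-- The abscissa of convergence of the generalized Dirichlet series `ζ_P(s) = ∑ n ^ (-s)` over all
generalized integers `n`. As the coefficients are nonnegative, it is the infimum of the real `σ`
at which the series converges. -/
noncomputable def abscissa (P : BeurlingSystem) : EReal :=
  sInf ((fun σ : ℝ => (σ : EReal)) '' {σ : ℝ | Summable fun e : ℕ →₀ ℕ => P.val e ^ (-σ)})

/-- The exponents `θ` for which `ψ_P(x) = x + O(x ^ θ)` as `x → ∞`. -/
def psiExponents (P : BeurlingSystem) : Set ℝ :=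
  {θ : ℝ | (fun x : ℝ => P.psi x - x) =O[atTop] fun x : ℝ => x ^ θ}

/-- The exponents `θ` for which `N_P(x) = ρ x + O(x ^ θ)` as `x → ∞`, for some `ρ > 0`. -/
def NExponents (P : BeurlingSystem) : Set ℝ :=
  {θ : ℝ | ∃ ρ : ℝ, 0 < ρ ∧ (fun x : ℝ => P.N x - ρ * x) =O[atTop] fun x : ℝ => x ^ θ}

/-- The exponents `θ` for which `M_P(x) = O(x ^ θ)` as `x → ∞`. -/
def MExponents (P : BeurlingSystem) : Set ℝ :=
  {θ : ℝ | (fun x : ℝ => P.M x) =O[atTop] fun x : ℝ => x ^ θ}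

theorem rpow_isBigO {a b : ℝ} (h : a ≤ b) :
    (fun x : ℝ => x ^ a) =O[atTop] fun x : ℝ => x ^ b := by
  refine IsBigO.of_bound 1 ?_
  filter_upwards [eventually_ge_atTop 1] with x hx
  have h0 : 0 ≤ x := zero_le_one.trans hx
  rw [Real.norm_of_nonneg (Real.rpow_nonneg h0 a), Real.norm_of_nonneg (Real.rpow_nonneg h0 b),
    one_mul]
  exact Real.rpow_le_rpow_of_exponent_le hx h

theorem isUpperSet_psiExponents (P : BeurlingSystem) : IsUpperSet P.psiExponents :=
  fun _ _ h ha => IsBigO.trans ha (rpow_isBigO h)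

theorem isUpperSet_NExponents (P : BeurlingSystem) : IsUpperSet P.NExponents :=
  fun _ _ h ⟨ρ, hρ, ha⟩ => ⟨ρ, hρ, IsBigO.trans ha (rpow_isBigO h)⟩

theorem isUpperSet_MExponents (P : BeurlingSystem) : IsUpperSet P.MExponents :=
  fun _ _ h ha => IsBigO.trans ha (rpow_isBigO h)

/-- The optimal exponent of a set of admissible exponents, as an extended real number. -/
noncomputable def optimal (S : Set ℝ) : EReal :=
  sInf ((fun θ : ℝ => (θ : EReal)) '' S)

/-- A real number `a` is the optimal exponent of an upward closed set `S` iff `a + ε` is admissible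
for all `ε > 0` but for no `ε < 0`. -/
theorem optimal_eq_coe_iff {S : Set ℝ} (hS : IsUpperSet S) (a : ℝ) :
    optimal S = (a : EReal) ↔ (∀ ε > 0, a + ε ∈ S) ∧ ∀ ε < 0, a + ε ∉ S := by
  unfold optimal
  constructor
  · intro h
    refine ⟨fun ε hε => ?_, fun ε hε hm => ?_⟩
    · have h1 : sInf ((fun θ : ℝ => (θ : EReal)) '' S) < ((a + ε : ℝ) : EReal) := by
        rw [h]; exact_mod_cast (by linarith : a < a + ε)
      obtain ⟨_, ⟨θ, hθ, rfl⟩, hlt⟩ := sInf_lt_iff.mp h1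
      exact hS (EReal.coe_lt_coe_iff.mp hlt).le hθ
    · have h1 : (a : EReal) ≤ ((a + ε : ℝ) : EReal) := h.symm.le.trans (sInf_le (Set.mem_image_of_mem _ hm))
      have h2 := EReal.coe_le_coe_iff.mp h1
      linarith
  · rintro ⟨h1, h2⟩
    refine le_antisymm (le_of_forall_gt fun c hc => ?_) (le_sInf ?_)
    · obtain ⟨b, hb1, hb2⟩ := EReal.lt_iff_exists_real_btwn.mp hc
      have hb := h1 (b - a) (sub_pos.mpr (EReal.coe_lt_coe_iff.mp hb1))
      rw [add_sub_cancel] at hb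
      exact (sInf_le (Set.mem_image_of_mem _ hb)).trans_lt hb2
    · rintro _ ⟨θ, hθ, rfl⟩
      refine EReal.coe_le_coe_iff.mpr (not_lt.mp fun hlt => h2 (θ - a) (by linarith) ?_)
      rwa [add_sub_cancel]

/-- `α`: the optimal exponent in `ψ_P(x) = x + O(x ^ (α + ε))`. -/
noncomputable def alpha (P : BeurlingSystem) : EReal := optimal P.psiExponents

/-- `β`: the optimal exponent in `N_P(x) = ρ x + O(x ^ (β + ε))`. -/
noncomputable def beta (P : BeurlingSystem) : EReal := optimal P.NExponents

/-- `γ`: the optimal exponent in `M_P(x) = O(x ^ (γ + ε))`. -/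
noncomputable def gamma (P : BeurlingSystem) : EReal := optimal P.MExponents

end BeurlingSystem

/-- The two largest of `a, b, c` are equal, and their common value is at least `m`. -/
def TwoLargestEqualAndGe (a b c m : EReal) : Prop :=
  (a = b ∧ c ≤ a ∧ m ≤ a) ∨ (a = c ∧ b ≤ a ∧ m ≤ a) ∨ (b = c ∧ a ≤ b ∧ m ≤ b)

/-! With `u = log x`, the Laplace transforms of `N`, `M` and `psi` are `ζ/s`, `1/(sζ)` and
`-ζ'/(sζ)`. An error term `O(x ^ θ)` in one of the three laws therefore continues the corresponding
function (up to its pole at `1`) to `re s > θ`, with at most linear growth in `|im s|` inside that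
half-plane. The core of the theorem is that any two error terms with a common exponent `0 < θ < 1`
imply the third with exponent `θ + ε`.

Two error terms together continue `K = (s - 1) ζ(s)` to `re s > θ` without zeros. For `N` and `M`
this is the identity `ζ · (1/ζ) = 1`. For pairs involving `psi`, the function `K` or its reciprocal
solves a linear equation `L' = Q L` with holomorphic `Q`, so a single zero would force `L = 0`
(`ne_zero_of_deriv_eq_mul`).

Without zeros, `log ζ` exists on discs centred at `3 + it`. Its real part is `O(log |t|)` on a disc
reaching almost to `re s = θ`, and `O(1)` on a small disc inside `re s ≥ 2`. Estimating Taylor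
coefficients on both discs by Borel–Carathéodory gives `|log ζ| ≤ ε log |t| + O(1)`, so `ζ`, `1/ζ`
and `ζ'/ζ` grow slower than every power (`subpolyGrowth_of_polynomial_growth`). The same works from
a polynomial bound on `1/ζ`.

A Tauberian theorem (`abs_sub_exp_le_of_laplace`) returns to the counting functions: average over an
interval of length `h`, invert the transform, move the line of integration to `θ + ε`, and undo the
averaging by monotonicity with `h = exp (-u)`. `M` is not monotone, but `N + M` is.

For the bound `1/2`, suppose `N` and `M` both have an exponent `θ < 1/2`. Subpolynomial growth of
`ζ` and Plancherel on a line `σ` slightly right of `θ` make the weighted mean square of differences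
of adjacent averages of `N(x) - ρx` at scale `h` as small as `h ^ (1 - 4ε)`. But `N` is
integer-valued, so jumps cannot be spread out: at `h = δ exp (-U)` the part over `[U, U + 1]` alone
is at least a constant times `exp (-2σU)`, and `2σ < 1 - 4ε` is a contradiction
(`false_of_subpolyGrowth`). Hence `max β γ ≥ 1/2`. Since each exponent is at most the maximum of the
other two and `0`, the two largest agree. -/

open MeasureTheory Topology
open scoped FourierTransform Interval

/-! ### Laplace transforms of exponentially bounded functions -/

/-- The two-sided Laplace transform. -/
noncomputable def laplace (G : ℝ → ℂ) (s : ℂ) : ℂ :=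
  ∫ u : ℝ, Complex.exp (-s * u) * G u

/-- `G` is measurable, vanishes on the negative axis and is bounded by `C * exp (θ * u)`. -/
structure ExpBound (G : ℝ → ℂ) (θ C : ℝ) : Prop where
  measurable : Measurable G
  eq_zero : ∀ u < 0, G u = 0
  bound : ∀ u, 0 ≤ u → ‖G u‖ ≤ C * Real.exp (θ * u)

namespace ExpBound

variable {G : ℝ → ℂ} {θ C : ℝ}

theorem const_nonneg (h : ExpBound G θ C) : 0 ≤ C := by
  simpa using (norm_nonneg _).trans (h.bound 0 le_rfl)

theorem norm_exp_mul_le (h : ExpBound G θ C) {s : ℂ} {a : ℝ} (ha : a ≤ s.re) (u : ℝ) :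
    ‖Complex.exp (-s * u) * G u‖ ≤
      (Set.Ici (0 : ℝ)).indicator (fun u => C * Real.exp (-(a - θ) * u)) u := by
  by_cases hu : 0 ≤ u
  · rw [Set.indicator_of_mem (Set.mem_Ici.mpr hu), norm_mul, Complex.norm_exp]
    have h1 : (-s * (u : ℂ)).re = -(s.re * u) := by simp
    rw [h1]
    calc Real.exp (-(s.re * u)) * ‖G u‖ ≤ Real.exp (-(a * u)) * (C * Real.exp (θ * u)) := by
          have := h.bound u hu
          gcongr
      _ = C * Real.exp (-(a - θ) * u) := by
          rw [mul_left_comm, ← Real.exp_add]; ring_nf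
  · rw [Set.indicator_of_notMem (by simpa using hu), h.eq_zero u (not_le.mp hu)]
    simp

theorem integrable_indicator {a : ℝ} (ha : θ < a) :
    Integrable ((Set.Ici (0 : ℝ)).indicator (fun u => C * Real.exp (-(a - θ) * u))) := by
  rw [integrable_indicator_iff measurableSet_Ici, integrableOn_Ici_iff_integrableOn_Ioi]
  exact (exp_neg_integrableOn_Ioi 0 (by linarith : 0 < a - θ)).const_mul C

theorem integral_indicator {a : ℝ} (ha : θ < a) :
    ∫ u, (Set.Ici (0 : ℝ)).indicator (fun u => C * Real.exp (-(a - θ) * u)) u = C / (a - θ) := by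
  rw [MeasureTheory.integral_indicator measurableSet_Ici, integral_Ici_eq_integral_Ioi,
    integral_const_mul, integral_exp_mul_Ioi (by linarith : -(a - θ) < 0)]
  simp
  field_simp
  rw [← neg_sub a θ, div_neg, neg_neg]

theorem measurable_exp_mul (h : ExpBound G θ C) (s : ℂ) :
    Measurable fun u : ℝ => Complex.exp (-s * u) * G u := by
  have := h.measurable
  fun_prop

theorem integrable (h : ExpBound G θ C) {s : ℂ} (hs : θ < s.re) :
    Integrable fun u : ℝ => Complex.exp (-s * u) * G u :=
  (integrable_indicator (C := C) hs).mono' (h.measurable_exp_mul s).aestronglyMeasurable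
    (.of_forall fun u => h.norm_exp_mul_le le_rfl u)

theorem norm_laplace_le (h : ExpBound G θ C) {s : ℂ} {a : ℝ} (ha : θ < a) (hs : a ≤ s.re) :
    ‖laplace G s‖ ≤ C / (a - θ) := by
  rw [← integral_indicator (C := C) ha]
  exact norm_integral_le_of_norm_le (integrable_indicator ha)
    (.of_forall fun u => h.norm_exp_mul_le hs u)

theorem mono (h : ExpBound G θ C) {θ' : ℝ} (hθ : θ ≤ θ') : ExpBound G θ' C where
  measurable := h.measurable
  eq_zero := h.eq_zero
  bound u hu := (h.bound u hu).trans <| by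
    have := h.const_nonneg
    gcongr

theorem differentiableAt_laplace (h : ExpBound G θ C) {s : ℂ} (hs : θ < s.re) :
    DifferentiableAt ℂ (laplace G) s := by
  obtain ⟨a, ha1, ha2⟩ := exists_between hs
  -- The gap `a - b` pays for the factor `u` of the differentiated integrand, since `u ≤ (a - b)⁻¹ *
  -- exp ((a - b) * u)`.
  obtain ⟨b, hb1, hb2⟩ := exists_between ha1
  have key := hasDerivAt_integral_of_dominated_loc_of_deriv_le (μ := volume)
    (F := fun (s : ℂ) (u : ℝ) => Complex.exp (-s * u) * G u)
    (F' := fun (s : ℂ) (u : ℝ) => -u * (Complex.exp (-s * u) * G u))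
    (x₀ := s) (s := Metric.ball s (s.re - a))
    (bound := (Set.Ici (0 : ℝ)).indicator
      (fun u => ((a - b)⁻¹ * C) * Real.exp (-(b - θ) * u)))
    (Metric.ball_mem_nhds _ (by linarith))
    (.of_forall fun z => (h.measurable_exp_mul z).aestronglyMeasurable)
    (h.integrable hs)
    (by have := h.measurable_exp_mul s; fun_prop) (.of_forall fun u z hz => ?_)
    (integrable_indicator hb1) (.of_forall fun u z _ => ?_)
  · exact key.2.differentiableAt
  · have hza : a ≤ z.re := by
      have h1 := (Complex.abs_re_le_norm (z - s)).trans (mem_ball_iff_norm.mp hz).le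
      have := abs_le.mp h1
      simp at this; linarith
    rw [norm_mul]
    refine (mul_le_mul_of_nonneg_left (h.norm_exp_mul_le hza u) (norm_nonneg _)).trans ?_
    by_cases hu : 0 ≤ u
    · simp only [Set.indicator_of_mem (Set.mem_Ici.mpr hu)]
      have h2 : ‖-(u : ℂ)‖ = u := by simp [abs_of_nonneg hu]
      rw [h2]
      have h3 : u ≤ (a - b)⁻¹ * Real.exp ((a - b) * u) := by
        rw [inv_mul_eq_div, le_div_iff₀ (by linarith)]
        have := Real.add_one_le_exp ((a - b) * u)
        linarith
      have hC := h.const_nonneg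
      calc u * (C * Real.exp (-(a - θ) * u))
          ≤ ((a - b)⁻¹ * Real.exp ((a - b) * u)) * (C * Real.exp (-(a - θ) * u)) := by gcongr
        _ = (a - b)⁻¹ * C * (Real.exp ((a - b) * u) * Real.exp (-(a - θ) * u)) := by ring
        _ = _ := by rw [← Real.exp_add]; ring_nf
    · simp [Set.indicator_of_notMem, hu]
  · have h1 : HasDerivAt (fun z : ℂ => Complex.exp (-z * u)) (Complex.exp (-z * u) * (-1 * u)) z :=
      ((hasDerivAt_neg z).mul_const (u : ℂ)).cexp
    convert! h1.mul_const (G u) using 1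
    ring

theorem differentiableOn_laplace (h : ExpBound G θ C) :
    DifferentiableOn ℂ (laplace G) {s | θ < s.re} :=
  fun _ hs => (h.differentiableAt_laplace hs).differentiableWithinAt

theorem add {G' : ℝ → ℂ} {C' : ℝ} (h : ExpBound G θ C) (h' : ExpBound G' θ C') :
    ExpBound (fun u => G u + G' u) θ (C + C') where
  measurable := h.measurable.add h'.measurable
  eq_zero u hu := by simp [h.eq_zero u hu, h'.eq_zero u hu]
  bound u hu := (norm_add_le _ _).trans <| by
    rw [add_mul]; exact add_le_add (h.bound u hu) (h'.bound u hu)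

theorem laplace_add {G' : ℝ → ℂ} {θ' C' : ℝ} (h : ExpBound G θ C) (h' : ExpBound G' θ' C') {s : ℂ}
    (hs : θ < s.re) (hs' : θ' < s.re) :
    laplace (fun u => G u + G' u) s = laplace G s + laplace G' s := by
  unfold laplace
  rw [← integral_add (h.integrable hs) (h'.integrable hs')]
  simp only [mul_add]

end ExpBound

theorem laplace_const_mul (c : ℂ) (G : ℝ → ℂ) (s : ℂ) :
    laplace (fun u => c * G u) s = c * laplace G s := by
  unfold laplace
  rw [← integral_const_mul]
  congr 1; ext u; ring

/-- The step function at `l`. -/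
noncomputable def stepAt (l u : ℝ) : ℂ := (Set.Ici l).indicator (fun _ => 1) u

theorem expBound_stepAt {l : ℝ} (hl : 0 ≤ l) : ExpBound (stepAt l) 0 1 where
  measurable := measurable_const.indicator measurableSet_Ici
  eq_zero u hu := Set.indicator_of_notMem (by simp; linarith) _
  bound u _ := by
    by_cases h : u ∈ Set.Ici l <;> simp [stepAt, h]

theorem laplace_exp_stepAt (l : ℝ) {s z : ℂ} (hs : z.re < s.re) :
    laplace (fun u => Complex.exp (z * u) * stepAt l u) s
      = Complex.exp (-(s - z) * l) / (s - z) := by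
  have h0 : s - z ≠ 0 := fun h => by
    have := congrArg Complex.re h
    simp at this; linarith
  have h1 : ∀ u : ℝ, Complex.exp (-s * u) * (Complex.exp (z * u) * stepAt l u)
      = (Set.Ici l).indicator (fun u : ℝ => Complex.exp (-(s - z) * u)) u := fun u => by
    by_cases h : u ∈ Set.Ici l
    · simp only [stepAt, Set.indicator_of_mem h, mul_one, ← Complex.exp_add]; ring_nf
    · simp [stepAt, Set.indicator_of_notMem h]
  unfold laplace
  simp_rw [h1]
  rw [integral_indicator measurableSet_Ici, integral_Ici_eq_integral_Ioi,
    integral_exp_mul_complex_Ioi (by simp; linarith)]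
  field_simp

theorem laplace_stepAt (l : ℝ) {s : ℂ} (hs : 0 < s.re) :
    laplace (stepAt l) s = Complex.exp (-s * l) / s := by
  simpa using laplace_exp_stepAt l (z := 0) (s := s) (by simpa using hs)

/-- The truncated exponential `exp u` on `u ≥ 0`. -/
noncomputable def truncExp (u : ℝ) : ℂ := Complex.exp u * stepAt 0 u

theorem truncExp_of_nonneg {u : ℝ} (hu : 0 ≤ u) : truncExp u = Real.exp u := by
  simp [truncExp, stepAt, hu]

theorem truncExp_of_neg {u : ℝ} (hu : u < 0) : truncExp u = 0 := by
  simp [truncExp, stepAt, hu]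

theorem expBound_truncExp (c : ℂ) : ExpBound (fun u => c * truncExp u) 1 ‖c‖ where
  measurable := by
    have : Measurable (stepAt 0) := (expBound_stepAt le_rfl).measurable
    unfold truncExp
    fun_prop
  eq_zero u hu := by simp [truncExp_of_neg hu]
  bound u hu := by
    rw [truncExp_of_nonneg hu, norm_mul, Complex.norm_real, Real.norm_of_nonneg (Real.exp_nonneg u),
      one_mul]

theorem laplace_truncExp {s : ℂ} (hs : 1 < s.re) : laplace truncExp s = 1 / (s - 1) := by
  have := laplace_exp_stepAt 0 (z := 1) (s := s) (by simpa using hs)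
  simpa [truncExp, laplace] using this

/-- The summatory function of a family `a i` placed at the abscissas `l i ≥ 0` has as Laplace
transform the Dirichlet series `∑ a i exp (-s l i)` divided by `s`. -/
theorem laplace_tsum_stepAt {ι : Type*} [Countable ι] (a : ι → ℂ) (l : ι → ℝ) {s : ℂ}
    (hl : ∀ i, 0 ≤ l i) (hs : 0 < s.re) (hsum : Summable fun i => ‖a i‖ * Real.exp (-s.re * l i)) :
    laplace (fun u => ∑' i, a i * stepAt (l i) u) s
      = (∑' i, a i * Complex.exp (-s * l i)) / s := by
  have hint : ∀ i, Integrable fun u : ℝ => Complex.exp (-s * u) * (a i * stepAt (l i) u) := by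
    intro i
    have := ((expBound_stepAt (hl i)).integrable hs).const_mul (a i)
    refine this.congr (.of_forall fun u => ?_)
    simp only; ring
  have hnorm : ∀ i, ∫ u : ℝ, ‖Complex.exp (-s * u) * (a i * stepAt (l i) u)‖
      = ‖a i‖ * Real.exp (-s.re * l i) / s.re := by
    intro i
    have h1 : ∀ u : ℝ, ‖Complex.exp (-s * u) * (a i * stepAt (l i) u)‖
        = ‖a i‖ * (Set.Ici (l i)).indicator (fun u : ℝ => Real.exp (-s.re * u)) u := fun u => by
      by_cases h : u ∈ Set.Ici (l i)
      · simp only [stepAt, Set.indicator_of_mem h, mul_one, norm_mul, Complex.norm_exp]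
        simp; ring
      · simp [stepAt, Set.indicator_of_notMem h]
    simp_rw [h1]
    rw [integral_const_mul, integral_indicator measurableSet_Ici, integral_Ici_eq_integral_Ioi,
      integral_exp_mul_Ioi (by linarith)]
    field_simp
  have := integral_tsum_of_summable_integral_norm hint (by
    simp_rw [hnorm]
    exact hsum.div_const _)
  unfold laplace
  simp_rw [← tsum_mul_left]
  rw [← this, ← tsum_div_const]
  congr 1; ext i
  have h2 := laplace_const_mul (a i) (stepAt (l i)) s
  rw [laplace_stepAt (l i) hs] at h2
  rw [mul_div_assoc, ← h2]
  rfl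

/-! ### Fourier inversion and Plancherel on vertical lines -/

theorem fourier_exp_mul (G : ℝ → ℂ) (σ y : ℝ) :
    𝓕 (fun u : ℝ => Complex.exp (-σ * u) * G u) y
      = laplace G (σ + ((2 * Real.pi * y : ℝ) : ℂ) * Complex.I) := by
  rw [Real.fourier_real_eq_integral_exp_smul, laplace]
  congr 1; ext u
  rw [smul_eq_mul, ← mul_assoc, ← Complex.exp_add]
  congr 2
  push_cast; ring

/-- Fourier inversion for the Laplace transform. -/
theorem laplace_inversion {G : ℝ → ℂ} {σ : ℝ} (hG : Continuous G)
    (hint : Integrable fun u : ℝ => Complex.exp (-σ * u) * G u)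
    (hL : Integrable fun t : ℝ => laplace G (σ + (t : ℂ) * Complex.I)) (u : ℝ) :
    G u = (2 * Real.pi)⁻¹ * ∫ t : ℝ, Complex.exp (u * (σ + (t : ℂ) * Complex.I)) *
      laplace G (σ + (t : ℂ) * Complex.I) := by
  set φ : ℝ → ℂ := fun u => Complex.exp (-σ * u) * G u with hφ
  have hF : 𝓕 φ = fun y : ℝ => laplace G (σ + ((2 * Real.pi * y : ℝ) : ℂ) * Complex.I) :=
    funext fun y => fourier_exp_mul G σ y
  have hFi : Integrable (𝓕 φ) := by
    rw [hF]
    exact hL.comp_mul_left' (R := 2 * Real.pi) (by positivity)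
  have hc : Continuous φ := by fun_prop
  have key := congrFun (hc.fourierInv_fourier_eq hint hFi) u
  rw [Real.fourierInv_eq', hF] at key
  have h1 : G u = Complex.exp (σ * u) * φ u := by
    simp only [hφ, ← mul_assoc, ← Complex.exp_add]; simp
  rw [h1, ← key]
  have h2 := Measure.integral_comp_mul_left (fun t : ℝ => Complex.exp (u * (σ + (t : ℂ) * Complex.I)) *
      laplace G (σ + (t : ℂ) * Complex.I)) (2 * Real.pi)
  rw [abs_of_nonneg (by positivity)] at h2
  rw [Complex.real_smul] at h2
  push_cast at h2 ⊢
  rw [← h2, ← integral_const_mul]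
  congr 1; ext y
  rw [smul_eq_mul, ← mul_assoc, ← Complex.exp_add]
  congr 2
  simp; ring

/-- Plancherel's identity for the Laplace transform. -/
theorem laplace_plancherel {G : ℝ → ℂ} {σ : ℝ} (hG : Continuous G)
    (hint : Integrable fun u : ℝ => Complex.exp (-σ * u) * G u)
    (hL : Integrable fun t : ℝ => laplace G (σ + (t : ℂ) * Complex.I)) :
    ∫ u : ℝ, ‖Complex.exp (-σ * u) * G u‖ ^ 2
      = (2 * Real.pi)⁻¹ * ∫ t : ℝ, ‖laplace G (σ + (t : ℂ) * Complex.I)‖ ^ 2 := by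
  set φ : ℝ → ℂ := fun u => Complex.exp (-σ * u) * G u with hφ
  have hF : 𝓕 φ = fun y : ℝ => laplace G (σ + ((2 * Real.pi * y : ℝ) : ℂ) * Complex.I) :=
    funext fun y => fourier_exp_mul G σ y
  have hFi : Integrable (𝓕 φ) := by
    rw [hF]
    exact hL.comp_mul_left' (R := 2 * Real.pi) (by positivity)
  have hc : Continuous φ := by fun_prop
  have key := VectorFourier.integral_sesq_fourierIntegral_eq_neg_flip (μ := volume) (ν := volume)
    (e := Real.fourierChar) (L := innerₗ ℝ) (innerSL ℂ) Real.continuous_fourierChar continuous_inner hint hFi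
  have e1 : VectorFourier.fourierIntegral Real.fourierChar volume (innerₗ ℝ) φ = 𝓕 φ := rfl
  -- The Fourier integral for the negated pairing is the inverse transform, so the sesquilinear
  -- duality formula in `key` becomes Plancherel's identity.
  have e2 : VectorFourier.fourierIntegral Real.fourierChar volume (-(innerₗ ℝ).flip) (𝓕 φ) = φ := by
    rw [← hc.fourierInv_fourier_eq hint hFi]
    ext w
    rw [Real.fourierInv_eq, hc.fourierInv_fourier_eq hint hFi, VectorFourier.fourierIntegral]
    simp
  rw [e1, e2] at key
  have h3 : ∀ z : ℂ, innerSL ℂ z z = ((‖z‖ ^ 2 : ℝ) : ℂ) := fun z => by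
    simp
  simp_rw [h3] at key
  rw [integral_complex_ofReal, integral_complex_ofReal, Complex.ofReal_inj] at key
  rw [← key, hF]
  have h2 := Measure.integral_comp_mul_left
    (fun t : ℝ => ‖laplace G (σ + (t : ℂ) * Complex.I)‖ ^ 2) (2 * Real.pi)
  rw [abs_of_nonneg (by positivity), smul_eq_mul] at h2
  exact h2

/-! ### Integrability and contour shifts on vertical lines -/

/-- Continuous functions on a vertical line with decay `(1 + |t|) ^ (-p)`, `p > 1`, are
integrable. -/
theorem integrable_of_decay {f : ℝ → ℂ} {B p : ℝ} (hp : 1 < p) (hf : Continuous f)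
    (hb : ∀ t, ‖f t‖ ≤ B * (1 + |t|) ^ (-p)) : Integrable f := by
  have := (integrable_one_add_norm (E := ℝ) (μ := volume) (r := p) (by simpa using hp)).const_mul B
  exact this.mono' hf.aestronglyMeasurable (.of_forall hb)

theorem continuous_vertical {Φ : ℂ → ℂ} {θ a : ℝ} (hΦ : DifferentiableOn ℂ Φ {s | θ < s.re})
    (ha : θ < a) : Continuous fun t : ℝ => Φ (a + t * Complex.I) := by
  refine hΦ.continuousOn.comp_continuous (by fun_prop) fun t => ?_
  simpa using ha

/-- Shifting a vertical line of integration in a half-plane of holomorphy. -/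
theorem integral_vertical_eq {Φ : ℂ → ℂ} {θ a b B p : ℝ}
    (hΦ : DifferentiableOn ℂ Φ {s | θ < s.re}) (ha : θ < a) (hab : a ≤ b) (hp : 1 < p)
    (hb : ∀ s : ℂ, a ≤ s.re → s.re ≤ b → ‖Φ s‖ ≤ B * (1 + |s.im|) ^ (-p)) :
    ∫ t : ℝ, Φ (a + t * Complex.I) = ∫ t : ℝ, Φ (b + t * Complex.I) := by
  have hia : Integrable fun t : ℝ => Φ (a + t * Complex.I) :=
    integrable_of_decay hp (continuous_vertical hΦ ha) fun t => by
      simpa using hb (a + t * Complex.I) (by simp) (by simpa using hab)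
  have hib : Integrable fun t : ℝ => Φ (b + t * Complex.I) :=
    integrable_of_decay hp (continuous_vertical hΦ (ha.trans_le hab)) fun t => by
      simpa using hb (b + t * Complex.I) (by simpa using hab) (by simp)
  have hrect : ∀ T : ℝ, (∫ x : ℝ in a..b, Φ (x + ((-T : ℝ) : ℂ) * Complex.I)) -
      (∫ x : ℝ in a..b, Φ (x + (T : ℂ) * Complex.I)) +
      Complex.I • (∫ y : ℝ in (-T)..T, Φ (b + y * Complex.I)) -
      Complex.I • (∫ y : ℝ in (-T)..T, Φ (a + y * Complex.I)) = 0 := by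
    intro T
    have := Complex.integral_boundary_rect_eq_zero_of_differentiableOn Φ ⟨a, -T⟩ ⟨b, T⟩
      (hΦ.mono fun s hs => ?_)
    · simpa using this
    · have h1 := hs.1
      simp only [Set.mem_preimage, Set.uIcc_of_le hab] at h1
      exact ha.trans_le h1.1
  have hdecay : Tendsto (fun T : ℝ => B * (1 + |T|) ^ (-p) * |b - a|) atTop (𝓝 0) := by
    have h1 : Tendsto (fun T : ℝ => (1 + |T|) ^ (-p)) atTop (𝓝 0) :=
      (tendsto_rpow_neg_atTop (by linarith : 0 < p)).comp
        (tendsto_atTop_add_const_left _ _ tendsto_abs_atTop_atTop)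
    simpa using (h1.const_mul B).mul_const |b - a|
  -- The sign `e = ±1` treats the upper and lower sides of the rectangle at once.
  have hhor : ∀ e : ℝ, |e| = 1 →
      Tendsto (fun T : ℝ => ∫ x : ℝ in a..b, Φ (x + ((e * T : ℝ) : ℂ) * Complex.I))
        atTop (𝓝 0) := by
    intro e he
    refine squeeze_zero_norm (fun T => ?_) hdecay
    refine intervalIntegral.norm_integral_le_of_norm_le_const fun x hx => ?_
    rw [Set.uIoc_of_le hab] at hx
    have := hb (x + ((e * T : ℝ) : ℂ) * Complex.I) (by simpa using hx.1.le) (by simpa using hx.2)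
    have h2 : ((x : ℂ) + ((e * T : ℝ) : ℂ) * Complex.I).im = e * T := by simp
    rwa [h2, abs_mul, he, one_mul] at this
  have hva := intervalIntegral_tendsto_integral hia tendsto_neg_atTop_atBot tendsto_id
  have hvb := intervalIntegral_tendsto_integral hib tendsto_neg_atTop_atBot tendsto_id
  have h1 := hhor (-1) (by simp)
  have h2 := hhor 1 (by simp)
  have := ((h1.sub h2).add (hvb.const_smul Complex.I)).sub (hva.const_smul Complex.I)
  have h0 : Tendsto (fun _ : ℝ => (0 : ℂ)) atTop (𝓝 0) := tendsto_const_nhds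
  have := tendsto_nhds_unique this (h0.congr fun T => by
    rw [← hrect T]; simp)
  have h4 : Complex.I * (∫ t : ℝ, Φ (b + t * Complex.I))
      = Complex.I * ∫ t : ℝ, Φ (a + t * Complex.I) := by
    simpa [sub_eq_zero] using this
  exact (mul_left_cancel₀ Complex.I_ne_zero h4).symm

/-! ### Steklov averages -/

/-- The Steklov average over `[u, u + h]`. -/
noncomputable def steklov (h : ℝ) (G : ℝ → ℂ) (u : ℝ) : ℂ :=
  (h : ℂ)⁻¹ * ∫ v in (0 : ℝ)..h, G (u + v)

/-- The factor by which Steklov averaging multiplies the Laplace transform. -/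
noncomputable def steklovFactor (h : ℝ) (s : ℂ) : ℂ := (Complex.exp (h * s) - 1) / (h * s)

namespace ExpBound

variable {G : ℝ → ℂ} {θ C : ℝ}

theorem intervalIntegrable (hG : ExpBound G θ C) (a b : ℝ) : IntervalIntegrable G volume a b := by
  have h1 := (hG.integrable (s := ((θ + 1 : ℝ) : ℂ)) (by simp)).intervalIntegrable (a := a) (b := b)
  have h2 := h1.continuousOn_mul (g := fun u : ℝ => Complex.exp (((θ + 1 : ℝ) : ℂ) * u))
    (by fun_prop)
  refine h2.congr fun u _ => ?_
  simp only [← mul_assoc, ← Complex.exp_add, neg_mul, add_neg_cancel, Complex.exp_zero, one_mul]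

theorem continuous_steklov (hG : ExpBound G θ C) (h : ℝ) : Continuous (steklov h G) := by
  have h1 : ∀ u, steklov h G u =
      (h : ℂ)⁻¹ * ((∫ v in (0 : ℝ)..(u + h), G v) - ∫ v in (0 : ℝ)..u, G v) := fun u => by
    rw [steklov, intervalIntegral.integral_comp_add_left, add_zero,
      intervalIntegral.integral_interval_sub_left (hG.intervalIntegrable _ _)
        (hG.intervalIntegrable _ _)]
  have hc := intervalIntegral.continuous_primitive hG.intervalIntegrable 0
  rw [funext h1]
  exact continuous_const.mul ((hc.comp (continuous_id.add continuous_const)).sub hc)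

/-- Fubini's hypothesis for exchanging averaging and transform: translation by `v` multiplies the
`L¹` norm in `u` by `exp (s.re * v)`, which is bounded on `(0, h]`. -/
theorem integrable_prod (hG : ExpBound G θ C) {h : ℝ} {s : ℂ} (hs : θ < s.re) :
    Integrable (fun q : ℝ × ℝ => Complex.exp (-s * q.1) * G (q.1 + q.2))
      (volume.prod (volume.restrict (Set.Ioc 0 h))) := by
  have hsl : ∀ v : ℝ, (fun u : ℝ => Complex.exp (-s * u) * G (u + v)) =
      fun u : ℝ => Complex.exp (s * v) * (Complex.exp (-s * ((u + v : ℝ) : ℂ)) * G (u + v)) := by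
    intro v; ext u
    rw [← mul_assoc, ← Complex.exp_add]; congr 2; push_cast; ring
  have hG' := hG.measurable
  rw [integrable_prod_iff' (by fun_prop)]
  constructor
  · refine .of_forall fun v => ?_
    simp only [hsl]
    exact ((hG.integrable hs).comp_add_right v).const_mul _
  · have h1 : ∀ v : ℝ, ∫ u : ℝ, ‖Complex.exp (-s * u) * G (u + v)‖
        = Real.exp (s.re * v) * ∫ u : ℝ, ‖Complex.exp (-s * u) * G u‖ := fun v => by
      have := integral_add_right_eq_self (μ := volume)
        (fun u : ℝ => ‖Complex.exp (-s * u) * G u‖) v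
      rw [← this, ← integral_const_mul]
      congr 1; ext u
      rw [congrFun (hsl v) u, norm_mul, Complex.norm_exp]
      simp
    simp only [h1]
    refine Integrable.mul_const ?_ _
    exact (Continuous.integrableOn_Icc (by fun_prop)).mono_set Set.Ioc_subset_Icc_self

theorem integrable_steklov (hG : ExpBound G θ C) {h : ℝ} (hh : 0 < h) {s : ℂ} (hs : θ < s.re) :
    Integrable fun u : ℝ => Complex.exp (-s * u) * steklov h G u := by
  have := ((hG.integrable_prod (h := h) hs).integral_prod_left).const_mul ((h : ℂ)⁻¹)
  refine this.congr (.of_forall fun u => ?_)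
  simp only [steklov, intervalIntegral.integral_of_le hh.le, integral_const_mul]
  ring

theorem laplace_steklov (hG : ExpBound G θ C) {h : ℝ} (hh : 0 < h) {s : ℂ} (hs : θ < s.re)
    (hs0 : s ≠ 0) : laplace (steklov h G) s = steklovFactor h s * laplace G s := by
  have h1 : laplace (steklov h G) s = (h : ℂ)⁻¹ * ∫ u : ℝ, ∫ v in Set.Ioc 0 h,
      Complex.exp (-s * u) * G (u + v) := by
    rw [laplace, ← integral_const_mul]
    congr 1; ext u
    simp only [steklov, intervalIntegral.integral_of_le hh.le, integral_const_mul]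
    ring
  have h2 : ∀ v : ℝ, ∫ u : ℝ, Complex.exp (-s * u) * G (u + v)
      = Complex.exp (s * v) * laplace G s := fun v => by
    have := integral_add_right_eq_self (μ := volume)
      (fun u : ℝ => Complex.exp (-s * u) * G u) v
    rw [laplace, ← this, ← integral_const_mul]
    congr 1; ext u
    rw [← mul_assoc, ← Complex.exp_add]; congr 2; push_cast; ring
  have hne : (h : ℂ) ≠ 0 := by exact_mod_cast hh.ne'
  rw [h1, integral_integral_swap (f := fun u v : ℝ => Complex.exp (-s * u) * G (u + v))
    (hG.integrable_prod hs)]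
  simp_rw [h2]
  rw [integral_mul_const, ← intervalIntegral.integral_of_le hh.le, integral_exp_mul_complex hs0,
    steklovFactor]
  simp
  field_simp

end ExpBound

/-- Interpolation between the bound `2 * ‖h * s‖` near `0` and the bound `exp 2 + 1 ≤ 10` elsewhere.
The exponent `η` is chosen later to balance decay in `s` against powers of `h`. -/
theorem norm_exp_sub_one_le_rpow {h η : ℝ} {s : ℂ} (hh0 : 0 ≤ h) (hh : h ≤ 1) (hs : s.re ≤ 2) (hη0 : 0 ≤ η) (hη : η ≤ 1) :
    ‖Complex.exp (h * s) - 1‖ ≤ 10 * (h * ‖s‖) ^ η := by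
  have hn : ‖(h : ℂ) * s‖ = h * ‖s‖ := by rw [norm_mul, Complex.norm_of_nonneg hh0]
  have hp : 0 ≤ h * ‖s‖ := by positivity
  rcases le_total (h * ‖s‖) 1 with h1 | h1
  · have := Complex.norm_exp_sub_one_le (x := h * s) (by rwa [hn])
    rw [hn] at this
    have h2 : h * ‖s‖ ≤ (h * ‖s‖) ^ η := by
      conv_lhs => rw [← Real.rpow_one (h * ‖s‖)]
      exact Real.rpow_le_rpow_of_exponent_ge' hp h1 hη0 hη
    linarith
  · have h2 : 1 ≤ (h * ‖s‖) ^ η := Real.one_le_rpow h1 hη0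
    have h3 : ‖Complex.exp (h * s)‖ ≤ Real.exp 2 := by
      rw [Complex.norm_exp]
      refine Real.exp_le_exp.mpr ?_
      simp; nlinarith
    have h4 : Real.exp 2 ≤ 9 := by
      have : Real.exp 2 = Real.exp 1 * Real.exp 1 := by rw [← Real.exp_add]; norm_num
      rw [this]
      nlinarith [Real.exp_one_lt_d9, Real.exp_pos 1]
    calc ‖Complex.exp (h * s) - 1‖ ≤ ‖Complex.exp (h * s)‖ + ‖(1 : ℂ)‖ := norm_sub_le _ _
      _ ≤ 10 := by rw [norm_one]; linarith
      _ ≤ _ := by linarith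

/-! ### Subpolynomial growth and bounds for Steklov averages -/

/-- The growth of `H` on vertical lines of `θ < re s ≤ 2` is slower than any power. -/
def SubpolyGrowth (H : ℂ → ℂ) (θ : ℝ) : Prop :=
  ∀ ε > 0, ∃ C T : ℝ, ∀ s : ℂ, θ + ε ≤ s.re → s.re ≤ 2 → T ≤ |s.im| → ‖H s‖ ≤ C * |s.im| ^ ε

theorem SubpolyGrowth.uniform {H : ℂ → ℂ} {θ : ℝ} (hg : SubpolyGrowth H θ)
    (hH : DifferentiableOn ℂ H {s | θ < s.re}) {ε : ℝ} (hε : 0 < ε) :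
    ∃ C, 0 ≤ C ∧ ∀ s : ℂ, θ + ε ≤ s.re → s.re ≤ 2 → ‖H s‖ ≤ C * (1 + |s.im|) ^ ε := by
  obtain ⟨C, T, hCT⟩ := hg ε hε
  have hK : IsCompact (Set.Icc (θ + ε) 2 ×ℂ Set.Icc (-|T|) |T|) :=
    isCompact_Icc.reProdIm isCompact_Icc
  obtain ⟨B, hB⟩ := hK.exists_bound_of_continuousOn (f := H) (hH.continuousOn.mono fun s hs => by
    have := hs.1.1
    simp only [Set.mem_ofPred_eq]; linarith)
  refine ⟨max (max B C) 0, le_max_right _ _, fun s h1 h2 => ?_⟩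
  have h3 : 1 ≤ (1 + |s.im|) ^ ε := Real.one_le_rpow (by simp) hε.le
  rcases le_total |s.im| |T| with h | h
  · have h4 := hB s ⟨⟨h1, h2⟩, abs_le.mp h⟩
    calc ‖H s‖ ≤ max (max B C) 0 * 1 := by rw [mul_one]; exact h4.trans (by simp)
      _ ≤ _ := by gcongr
  · refine (hCT s h1 h2 ((le_abs_self T).trans h)).trans ?_
    calc C * |s.im| ^ ε ≤ max (max B C) 0 * |s.im| ^ ε := by gcongr; simp
      _ ≤ _ := by gcongr; simp

theorem one_add_abs_im_le {a : ℝ} (ha : 0 < a) (ha1 : a ≤ 1) {s : ℂ} (hs : a ≤ s.re) :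
    a / 2 * (1 + |s.im|) ≤ ‖s‖ := by
  have h1 := Complex.abs_re_le_norm s
  have h2 := Complex.abs_im_le_norm s
  have h3 := le_abs_self s.re
  nlinarith [abs_nonneg s.im]

/-- The decay on vertical lines of the Laplace transform of a Steklov average. -/
theorem norm_steklovFactor_mul_le {H : ℂ → ℂ} {θ ε : ℝ} (hθ : 0 < θ) (hε : 0 < ε) (hε1 : ε ≤ 1 / 2)
    (hg : SubpolyGrowth H θ) (hH : DifferentiableOn ℂ H {s | θ < s.re}) :
    ∃ C, 0 ≤ C ∧ ∀ h : ℝ, 0 < h → h ≤ 1 → ∀ s : ℂ, θ + ε ≤ s.re → s.re ≤ 2 →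
      ‖steklovFactor h s * (H s / s)‖ ≤ C * h ^ (-2 * ε) * (1 + |s.im|) ^ (-(1 + ε)) := by
  obtain ⟨C, hC, hCb⟩ := hg.uniform hH hε
  set a := min θ 1 / 2 with ha
  have ha0 : 0 < a := by positivity
  refine ⟨C * 10 * a ^ (-(1 + 2 * ε)), by positivity, fun h h0 h1 s hs hs2 => ?_⟩
  have hsre : min θ 1 ≤ s.re := (min_le_left _ _).trans (by linarith)
  have hs0 : 0 < s.re := lt_of_lt_of_le (by positivity) hsre
  have hT : a * (1 + |s.im|) ≤ ‖s‖ := one_add_abs_im_le (by positivity) (min_le_right _ _) hsre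
  have hT0 : 0 < 1 + |s.im| := by positivity
  have hsn : 0 < ‖s‖ := lt_of_lt_of_le (by positivity) hT
  -- With this exponent the factor contributes `‖s‖ ^ (-2 * ε)`; together with `1 / ‖s‖` and the
  -- growth `ε` of `H` an integrable decay of order `1 + ε` is left, at the price of `h ^ (-2 * ε)`.
  have e1 := norm_exp_sub_one_le_rpow (η := 1 - 2 * ε) h0.le h1 hs2 (by linarith)
    (by linarith)
  have e2 : ‖s‖ ^ (-(1 + 2 * ε)) ≤ (a * (1 + |s.im|)) ^ (-(1 + 2 * ε)) :=
    Real.rpow_le_rpow_of_nonpos (by positivity) hT (by linarith)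
  rw [Real.mul_rpow ha0.le hT0.le] at e2
  have e3 := hCb s hs hs2
  rw [steklovFactor, norm_mul, norm_div, norm_div, norm_mul, Complex.norm_of_nonneg h0.le]
  calc ‖Complex.exp (h * s) - 1‖ / (h * ‖s‖) * (‖H s‖ / ‖s‖)
      ≤ 10 * (h * ‖s‖) ^ (1 - 2 * ε) / (h * ‖s‖) * (C * (1 + |s.im|) ^ ε / ‖s‖) := by gcongr
    _ = C * 10 * h ^ (-2 * ε) * (1 + |s.im|) ^ ε * ‖s‖ ^ (-(1 + 2 * ε)) := by
        rw [Real.mul_rpow h0.le hsn.le, Real.rpow_sub h0, Real.rpow_sub hsn, Real.rpow_neg hsn.le,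
          Real.rpow_add hsn, neg_mul, Real.rpow_neg h0.le, Real.rpow_one, Real.rpow_one]
        field_simp
    _ ≤ C * 10 * h ^ (-2 * ε) * (1 + |s.im|) ^ ε *
          (a ^ (-(1 + 2 * ε)) * (1 + |s.im|) ^ (-(1 + 2 * ε))) := by gcongr
    _ = C * 10 * a ^ (-(1 + 2 * ε)) * h ^ (-2 * ε) *
          ((1 + |s.im|) ^ ε * (1 + |s.im|) ^ (-(1 + 2 * ε))) := by ring
    _ = _ := by rw [← Real.rpow_add hT0]; ring_nf

theorem differentiableOn_steklovFactor {θ h : ℝ} (hθ : 0 ≤ θ) (hh : 0 < h) :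
    DifferentiableOn ℂ (steklovFactor h) {s | θ < s.re} := by
  intro s hs
  have hs0 : s ≠ 0 := fun h => by simp [h] at hs; linarith
  have hne : (h : ℂ) ≠ 0 := by exact_mod_cast hh.ne'
  unfold steklovFactor
  exact ((DifferentiableAt.sub_const (by fun_prop) _).div (by fun_prop)
    (mul_ne_zero hne hs0)).differentiableWithinAt

/-- Averaging makes the transform integrable, so inversion holds on `re s = 2`. The continuation `H
s / s` then allows the line to be moved to `θ + ε`, where the kernel has modulus `exp ((θ + ε) *
u)`. -/
theorem norm_steklov_le {G : ℝ → ℂ} {H : ℂ → ℂ} {θ₁ C₁ θ ε : ℝ} (hG : ExpBound G θ₁ C₁)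
    (hθ₁ : θ₁ < 2) (hθ : 0 < θ) (hθ1 : θ < 1) (hε : 0 < ε) (hε1 : ε ≤ 1 / 2)
    (hg : SubpolyGrowth H θ) (hH : DifferentiableOn ℂ H {s | θ < s.re})
    (hL : ∀ s : ℂ, s.re = 2 → laplace G s = H s / s) :
    ∃ C, 0 ≤ C ∧ ∀ h : ℝ, 0 < h → h ≤ 1 → ∀ u,
      ‖steklov h G u‖ ≤ C * h ^ (-2 * ε) * Real.exp ((θ + ε) * u) := by
  obtain ⟨C, hC, hCb⟩ := norm_steklovFactor_mul_le hθ hε hε1 hg hH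
  set J := ∫ t : ℝ, (1 + ‖t‖) ^ (-(1 + ε)) with hJ
  have hJi := integrable_one_add_norm (E := ℝ) (μ := volume) (r := 1 + ε) (by simpa using hε)
  have hJ0 : 0 ≤ J := integral_nonneg fun t => by positivity
  refine ⟨(2 * Real.pi)⁻¹ * (C * J), by positivity, fun h h0 h1 u => ?_⟩
  set Ψ : ℂ → ℂ := fun s => steklovFactor h s * (H s / s) with hΨ
  have hΨd : DifferentiableOn ℂ Ψ {s | θ < s.re} :=
    (differentiableOn_steklovFactor hθ.le h0).mul (hH.div differentiableOn_id fun s hs h => by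
      simp [h] at hs; linarith)
  set Φ : ℂ → ℂ := fun s => Complex.exp (u * s) * Ψ s with hΦ
  have hLs : ∀ t : ℝ, laplace (steklov h G) (((2 : ℝ) : ℂ) + t * Complex.I)
      = Ψ (((2 : ℝ) : ℂ) + t * Complex.I) := fun t => by
    rw [hG.laplace_steklov h0 (by simpa using hθ₁), hL _ (by simp)]
    intro h; have := congrArg Complex.re h; simp at this
  have hint : Integrable fun t : ℝ => laplace (steklov h G) (((2 : ℝ) : ℂ) + t * Complex.I) := by
    simp_rw [hLs]
    refine integrable_of_decay (B := C * h ^ (-2 * ε)) (p := 1 + ε) (by linarith)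
      (continuous_vertical hΨd (by linarith)) fun t => ?_
    have := hCb h h0 h1 (((2 : ℝ) : ℂ) + t * Complex.I) (by simp; linarith) (by simp)
    have e2 : (((2 : ℝ) : ℂ) + t * Complex.I).im = t := by simp
    rwa [e2] at this
  have hinv := laplace_inversion (hG.continuous_steklov h)
    (hG.integrable_steklov h0 (s := ((2 : ℝ) : ℂ)) (by simpa using hθ₁)) hint u
  simp_rw [hLs] at hinv
  have hexp : ∀ s : ℂ, ‖Complex.exp (u * s)‖ = Real.exp (s.re * u) := fun s => by
    rw [Complex.norm_exp]; simp [mul_comm]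
  -- The bound may depend on `u` here: it only justifies the shift. The shifted integral is
  -- estimated afterwards on the line `θ + ε` alone.
  have hshift := integral_vertical_eq (Φ := Φ) (a := θ + ε) (b := 2) (p := 1 + ε)
    (B := Real.exp (2 * |u|) * (C * h ^ (-2 * ε)))
    ((Complex.differentiable_exp.comp (differentiable_id.const_mul _)).differentiableOn.mul hΨd)
    (by linarith) (by linarith) (by linarith) fun s hs1 hs2 => by
      rw [norm_mul, hexp, mul_assoc]
      have h3 : s.re * u ≤ 2 * |u| := by
        have : 0 ≤ s.re := by linarith
        calc s.re * u ≤ s.re * |u| := by gcongr; exact le_abs_self u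
          _ ≤ 2 * |u| := by gcongr
      refine mul_le_mul (Real.exp_le_exp.mpr h3) ?_ (norm_nonneg _) (Real.exp_nonneg _)
      · exact hCb h h0 h1 s hs1 hs2
  rw [hinv, ← hshift, norm_mul]
  have hb : ‖∫ t : ℝ, Φ (((θ + ε : ℝ) : ℂ) + t * Complex.I)‖ ≤
      ∫ t : ℝ, (Real.exp ((θ + ε) * u) * (C * h ^ (-2 * ε))) * (1 + ‖t‖) ^ (-(1 + ε)) := by
    refine norm_integral_le_of_norm_le (hJi.const_mul _) (.of_forall fun t => ?_)
    have := hCb h h0 h1 (((θ + ε : ℝ) : ℂ) + t * Complex.I) (by simp) (by simp; linarith)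
    rw [norm_mul, hexp]
    have e1 : (((θ + ε : ℝ) : ℂ) + t * Complex.I).re = θ + ε := by simp
    have e2 : (((θ + ε : ℝ) : ℂ) + t * Complex.I).im = t := by simp
    rw [e2] at this
    rw [e1, mul_assoc]
    gcongr
    exact this
  rw [integral_const_mul] at hb
  have hpi : ‖(((2 * Real.pi)⁻¹ : ℝ) : ℂ)‖ = (2 * Real.pi)⁻¹ :=
    Complex.norm_of_nonneg (by positivity)
  rw [hpi]
  calc (2 * Real.pi)⁻¹ * ‖_‖ ≤ (2 * Real.pi)⁻¹ *
        (Real.exp ((θ + ε) * u) * (C * h ^ (-2 * ε)) * J) := by gcongr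
    _ = _ := by ring

/-! ### A Tauberian theorem with remainder for monotone functions -/

theorem Monotone.mul_le_integral {F : ℝ → ℝ} (hF : Monotone F) {a b : ℝ} (hab : a ≤ b) :
    (b - a) * F a ≤ ∫ v in a..b, F v := by
  have := intervalIntegral.integral_mono_on hab (f := fun _ => F a) (g := F) (μ := volume)
    (by simp) hF.intervalIntegrable fun x hx => hF hx.1
  simpa using this

theorem Monotone.integral_le_mul {F : ℝ → ℝ} (hF : Monotone F) {a b : ℝ} (hab : a ≤ b) :
    ∫ v in a..b, F v ≤ (b - a) * F b := by
  have := intervalIntegral.integral_mono_on hab (f := F) (g := fun _ => F b) (μ := volume)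
    hF.intervalIntegrable (by simp) fun x hx => hF hx.2
  simpa using this

/-- Both windows are cut at their midpoints; the contributions of `F (u + h)` cancel, and the
increment over the middle half of `[u, u + 2h]` survives. -/
theorem Monotone.integral_sub_integral_ge {F : ℝ → ℝ} (hF : Monotone F) {u h : ℝ} (hh : 0 ≤ h) :
    h / 2 * (F (u + 3 * h / 2) - F (u + h / 2)) ≤
      (∫ v in (u + h)..(u + h + h), F v) - ∫ v in u..(u + h), F v := by
  have i : ∀ a b, IntervalIntegrable F volume a b := fun _ _ => hF.intervalIntegrable
  rw [← intervalIntegral.integral_add_adjacent_intervals (i (u + h) (u + 3 * h / 2)) (i _ _),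
    ← intervalIntegral.integral_add_adjacent_intervals (i u (u + h / 2)) (i _ _)]
  have h1 := hF.mul_le_integral (a := u + h) (b := u + 3 * h / 2) (by linarith)
  have h2 := hF.mul_le_integral (a := u + 3 * h / 2) (b := u + h + h) (by linarith)
  have h3 := hF.integral_le_mul (a := u) (b := u + h / 2) (by linarith)
  have h4 := hF.integral_le_mul (a := u + h / 2) (b := u + h) (by linarith)
  nlinarith

theorem steklov_sub_truncExp {F : ℝ → ℝ} (hF : Monotone F) (c : ℝ) {h u : ℝ} (hh : 0 < h)
    (hu : 0 ≤ u) :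
    steklov h (fun u => (F u : ℂ) - c * truncExp u) u
      = ((h⁻¹ * (∫ v in u..(u + h), F v) - c * (Real.exp u * ((Real.exp h - 1) / h)) : ℝ) : ℂ) := by
  have h1 : ∫ v in (0 : ℝ)..h, ((F (u + v) : ℂ) - c * truncExp (u + v))
      = ∫ v in (0 : ℝ)..h, ((F (u + v) - c * Real.exp (u + v) : ℝ) : ℂ) := by
    refine intervalIntegral.integral_congr fun v hv => ?_
    rw [Set.uIcc_of_le hh.le] at hv
    have hv0 : 0 ≤ u + v := add_nonneg hu hv.1
    simp only [truncExp_of_nonneg hv0]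
    push_cast; ring
  have hFi : IntervalIntegrable (fun v => F (u + v)) volume 0 h :=
    Monotone.intervalIntegrable fun a b hab => hF (by linarith)
  have h2 : ∫ v in (0 : ℝ)..h, Real.exp (u + v) = Real.exp u * (Real.exp h - 1) := by
    simp_rw [Real.exp_add, intervalIntegral.integral_const_mul, integral_exp, Real.exp_zero]
  rw [steklov, h1, intervalIntegral.integral_ofReal, intervalIntegral.integral_sub hFi
    (Continuous.intervalIntegrable (by fun_prop) _ _), intervalIntegral.integral_const_mul, h2,
    intervalIntegral.integral_comp_add_left, add_zero]
  push_cast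
  have : (h : ℂ) ≠ 0 := by exact_mod_cast hh.ne'
  field_simp

theorem expBound_sub_truncExp {F : ℝ → ℝ} {C : ℝ} (c : ℝ)
    (hE : ExpBound (fun u => (F u : ℂ)) (3 / 2) C) :
    ExpBound (fun u => (F u : ℂ) - c * truncExp u) (3 / 2) (C + ‖(-c : ℂ)‖) := by
  have := hE.add ((expBound_truncExp (-c : ℂ)).mono (by norm_num : (1 : ℝ) ≤ 3 / 2))
  simpa [sub_eq_add_neg] using this

/-- A Tauberian theorem with remainder: a nondecreasing function whose Laplace transform is
`c / (s - 1)` up to a function of subpolynomial growth on `θ < re s` equals `c * exp u` up to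
`exp ((θ + ε) * u)`. -/
theorem abs_sub_exp_le_of_laplace {F : ℝ → ℝ} {H : ℂ → ℂ} {C₁ θ c : ℝ} (hF : Monotone F)
    (hE : ExpBound (fun u => (F u : ℂ)) (3 / 2) C₁) (hc : 0 ≤ c) (hθ : 0 < θ) (hθ1 : θ < 1)
    (hg : SubpolyGrowth H θ) (hH : DifferentiableOn ℂ H {s | θ < s.re})
    (hL : ∀ s : ℂ, s.re = 2 → laplace (fun u => (F u : ℂ)) s = c / (s - 1) + H s / s)
    {ε : ℝ} (hε : 0 < ε) :
    ∃ C, ∀ u, 1 ≤ u → |F u - c * Real.exp u| ≤ C * Real.exp ((θ + ε) * u) := by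
  have hG := expBound_sub_truncExp c hE
  have hLG : ∀ s : ℂ, s.re = 2 →
      laplace (fun u => (F u : ℂ) - c * truncExp u) s = H s / s := fun s hs => by
    have h1 := hE.laplace_add (expBound_truncExp (-c : ℂ)) (s := s) (by rw [hs]; norm_num)
      (by rw [hs]; norm_num)
    rw [laplace_const_mul, laplace_truncExp (by rw [hs]; norm_num), hL s hs] at h1
    simp only [neg_mul, ← sub_eq_add_neg] at h1
    rw [h1]; ring
  -- One `η` is lost in the line of integration and two more in `h ^ (-2 * η)` once `h = exp (-u)`.
  obtain ⟨η, hη, hη1, hη2⟩ : ∃ η > 0, η ≤ 1 / 2 ∧ 3 * η ≤ ε :=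
    ⟨min (1 / 2) (ε / 3), by positivity, min_le_left _ _, by
      have := min_le_right (1 / 2) (ε / 3); linarith⟩
  obtain ⟨C, hC, hCb⟩ := norm_steklov_le hG (by norm_num) hθ hθ1 hη hη1 hg hH hLG
  have key : ∀ h, 0 < h → h ≤ 1 → ∀ u, 0 ≤ u →
      |h⁻¹ * (∫ v in u..(u + h), F v) - c * (Real.exp u * ((Real.exp h - 1) / h))|
        ≤ C * h ^ (-2 * η) * Real.exp ((θ + η) * u) := fun h h0 h1 u hu => by
    have := hCb h h0 h1 u
    rwa [steklov_sub_truncExp hF c h0 hu, Complex.norm_real, Real.norm_eq_abs] at this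
  refine ⟨c + C, fun u hu => ?_⟩
  -- At this length averaging changes the main term by at most `c * exp u * h = c`, while negative
  -- powers `h ^ (-2 * η)` cost only `exp (2 * η * u)`.
  set h := Real.exp (-u) with hh
  have h0 : 0 < h := Real.exp_pos _
  have h1 : h ≤ 1 := Real.exp_le_one_iff.mpr (by linarith)
  have hpow : h ^ (-2 * η) = Real.exp (2 * η * u) := by
    rw [hh, ← Real.exp_mul]; ring_nf
  have hehu : Real.exp u * h = 1 := by rw [hh, ← Real.exp_add]; simp
  have hq1 : 1 ≤ (Real.exp h - 1) / h := by
    rw [le_div_iff₀ h0]; linarith [Real.add_one_le_exp h]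
  have hq2 : (Real.exp h - 1) / h ≤ 1 + h := by
    rw [div_le_iff₀ h0]
    have := (abs_le.mp (Real.abs_exp_sub_one_sub_id_le (x := h) (by rwa [abs_of_pos h0]))).2
    nlinarith
  have hfin : C * h ^ (-2 * η) * Real.exp ((θ + η) * u) ≤ C * Real.exp ((θ + ε) * u) := by
    rw [hpow, mul_assoc, ← Real.exp_add]
    gcongr
    nlinarith
  have hone : 1 ≤ Real.exp ((θ + ε) * u) := Real.one_le_exp (by positivity)
  have hmain : c + C * Real.exp ((θ + ε) * u) ≤ (c + C) * Real.exp ((θ + ε) * u) := by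
    nlinarith
  refine (abs_le.mpr ⟨?_, ?_⟩).trans hmain
  -- Monotonicity bounds `F u` below by its mean over `[u - h, u]` and, in the other case, above by
  -- its mean over `[u, u + h]`.
  · have k1 := (abs_le.mp (key h h0 h1 (u - h) (by linarith))).1
    have k2 := hF.integral_le_mul (a := u - h) (b := u - h + h) (by linarith)
    have k3 : h⁻¹ * (∫ v in (u - h)..(u - h + h), F v) ≤ F u := by
      rw [inv_mul_le_iff₀ h0]
      simpa using k2
    have k4 : Real.exp u * (1 - h) ≤ Real.exp (u - h) * ((Real.exp h - 1) / h) := by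
      have : Real.exp u * (1 - h) ≤ Real.exp (u - h) := by
        rw [sub_eq_add_neg u h, Real.exp_add]
        gcongr
        linarith [Real.add_one_le_exp (-h)]
      refine this.trans (le_mul_of_one_le_right (Real.exp_nonneg _) hq1)
    have k5 : Real.exp ((θ + η) * (u - h)) ≤ Real.exp ((θ + η) * u) := by
      gcongr; linarith
    have k6 : C * h ^ (-2 * η) * Real.exp ((θ + η) * (u - h)) ≤ C * Real.exp ((θ + ε) * u) :=
      le_trans (by gcongr) hfin
    nlinarith
  · have k1 := (abs_le.mp (key h h0 h1 u (by linarith))).2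
    have k2 := hF.mul_le_integral (a := u) (b := u + h) (by linarith)
    have k3 : F u ≤ h⁻¹ * (∫ v in u..(u + h), F v) := by
      rw [le_inv_mul_iff₀ h0]
      simpa using k2
    have k4 : Real.exp u * ((Real.exp h - 1) / h) ≤ Real.exp u + 1 := by
      calc _ ≤ Real.exp u * (1 + h) := by gcongr
        _ = _ := by rw [mul_add, hehu, mul_one]
    nlinarith

/-! ### Mean squares and the jumps of integer-valued functions -/

theorem laplace_comp_add (G : ℝ → ℂ) (h : ℝ) (s : ℂ) :
    laplace (fun u => G (u + h)) s = Complex.exp (h * s) * laplace G s := by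
  have := integral_add_right_eq_self (μ := volume)
    (fun u : ℝ => Complex.exp (-s * u) * G u) h
  rw [laplace, laplace, ← this, ← integral_const_mul]
  congr 1; ext u
  rw [← mul_assoc, ← Complex.exp_add]; congr 2; push_cast; ring

theorem ExpBound.integrable_steklov_diff {G : ℝ → ℂ} {θ C h : ℝ} {s : ℂ} (hG : ExpBound G θ C)
    (hh : 0 < h) (hs : θ < s.re) :
    Integrable fun u : ℝ => Complex.exp (-s * u) * (steklov h G (u + h) - steklov h G u) := by
  have h1 := ((hG.integrable_steklov hh hs).comp_add_right h).const_mul (Complex.exp (s * h))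
  refine (h1.sub (hG.integrable_steklov hh hs)).congr (.of_forall fun u => ?_)
  simp only [Pi.sub_apply, ← mul_assoc, ← Complex.exp_add, mul_sub]
  congr 3; push_cast; ring

theorem ExpBound.laplace_steklov_diff {G : ℝ → ℂ} {θ C h : ℝ} {s : ℂ} (hG : ExpBound G θ C)
    (hh : 0 < h) (hs : θ < s.re) (hs0 : s ≠ 0) :
    laplace (fun u => steklov h G (u + h) - steklov h G u) s
      = (Complex.exp (h * s) - 1) * (steklovFactor h s * laplace G s) := by
  have h1 := (hG.integrable_steklov hh hs).comp_add_right h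
  have h2 : Integrable fun u : ℝ => Complex.exp (-s * u) * steklov h G (u + h) := by
    refine (h1.const_mul (Complex.exp (s * h))).congr (.of_forall fun u => ?_)
    simp only [← mul_assoc, ← Complex.exp_add]
    congr 2; push_cast; ring
  have h3 : laplace (fun u => steklov h G (u + h) - steklov h G u) s
      = laplace (fun u => steklov h G (u + h)) s - laplace (steklov h G) s := by
    simp only [laplace, mul_sub]
    exact integral_sub h2 (hG.integrable_steklov hh hs)
  rw [h3, laplace_comp_add, hG.laplace_steklov hh hs hs0]
  ring

/-- The mean square of the differences of Steklov averages is small if the Laplace transform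
grows slower than any power. -/
theorem integral_steklov_diff_le {G : ℝ → ℂ} {θ C₁ ε : ℝ} (hG : ExpBound G θ C₁) (hθ : 0 < θ)
    (hε : 0 < ε) (hσ : θ + ε ≤ 1 / 2) (hg : SubpolyGrowth (fun s => s * laplace G s) θ) :
    ∃ C, 0 ≤ C ∧ ∀ h : ℝ, 0 < h → h ≤ 1 →
      (Integrable fun u : ℝ => ‖Complex.exp (-((θ + ε : ℝ) : ℂ) * u) *
        (steklov h G (u + h) - steklov h G u)‖ ^ 2) ∧
      ∫ u : ℝ, ‖Complex.exp (-((θ + ε : ℝ) : ℂ) * u) *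
        (steklov h G (u + h) - steklov h G u)‖ ^ 2 ≤ C * h ^ (1 - 4 * ε) := by
  have hH : DifferentiableOn ℂ (fun s => s * laplace G s) {s | θ < s.re} :=
    differentiableOn_id.mul hG.differentiableOn_laplace
  obtain ⟨C, hC, hCb⟩ := norm_steklovFactor_mul_le hθ hε (by linarith) hg hH
  obtain ⟨C₂, hC₂, hCb₂⟩ := norm_steklov_le (ε := ε) hG (by linarith) hθ (by linarith) hε
    (by linarith) hg hH fun s hs => by
      have : s ≠ 0 := fun h => by simp [h] at hs
      field_simp
  set σ := θ + ε with hσd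
  set J := ∫ t : ℝ, (1 + ‖t‖) ^ (-(1 + 2 * ε)) with hJ
  have hJi := integrable_one_add_norm (E := ℝ) (μ := volume) (r := 1 + 2 * ε) (by simpa using hε)
  have hJ0 : 0 ≤ J := integral_nonneg fun t => by positivity
  refine ⟨(2 * Real.pi)⁻¹ * (100 * C ^ 2 * J), by positivity, fun h h0 h1 => ?_⟩
  set w : ℝ → ℂ := fun u => steklov h G (u + h) - steklov h G u with hw
  have hsre : ∀ t : ℝ, ((σ : ℂ) + t * Complex.I).re = σ := fun t => by simp
  have hsim : ∀ t : ℝ, ((σ : ℂ) + t * Complex.I).im = t := fun t => by simp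
  have hs0 : ∀ t : ℝ, (σ : ℂ) + t * Complex.I ≠ 0 := fun t h => by
    have := congrArg Complex.re h
    rw [hsre] at this
    simp at this; linarith
  have hLw : ∀ t : ℝ, laplace w (σ + t * Complex.I) =
      (Complex.exp (h * (σ + t * Complex.I)) - 1) * (steklovFactor h (σ + t * Complex.I) *
        laplace G (σ + t * Complex.I)) := fun t =>
    hG.laplace_steklov_diff h0 (by rw [hsre]; linarith) (hs0 t)
  have hB : ∀ t : ℝ, ‖steklovFactor h (σ + t * Complex.I) * laplace G (σ + t * Complex.I)‖ ≤
      C * h ^ (-2 * ε) * (1 + |t|) ^ (-(1 + ε)) := fun t => by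
    have := hCb h h0 h1 (σ + t * Complex.I) (hsre t).ge (by rw [hsre]; linarith)
    rwa [hsim, mul_div_cancel_left₀ _ (hs0 t)] at this
  have hcw : Continuous w :=
    ((hG.continuous_steklov h).comp (by fun_prop)).sub (hG.continuous_steklov h)
  have hiw : Integrable fun u : ℝ => Complex.exp (-(σ : ℂ) * u) * w u :=
    hG.integrable_steklov_diff h0 (by simp; linarith)
  have hexp : ∀ η : ℝ, 0 ≤ η → η ≤ 1 → ∀ t : ℝ, ‖Complex.exp (h * (σ + t * Complex.I)) - 1‖ ≤
      10 * (h * ‖(σ : ℂ) + t * Complex.I‖) ^ η := fun η hη0 hη1 t =>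
    norm_exp_sub_one_le_rpow h0.le h1 (by rw [hsre]; linarith) hη0 hη1
  have hd : DifferentiableOn ℂ (fun s : ℂ => (Complex.exp (h * s) - 1) * (steklovFactor h s *
      laplace G s)) {s | θ < s.re} :=
    DifferentiableOn.mul (by fun_prop)
      ((differentiableOn_steklovFactor hθ.le h0).mul hG.differentiableOn_laplace)
  have hiL : Integrable fun t : ℝ => laplace w (σ + t * Complex.I) := by
    simp_rw [hLw]
    refine integrable_of_decay (B := 10 * (C * h ^ (-2 * ε))) (p := 1 + ε) (by linarith)
      (continuous_vertical hd (by linarith)) fun t => ?_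
    have e := hexp 0 le_rfl zero_le_one t
    rw [Real.rpow_zero, mul_one] at e
    rw [norm_mul, mul_assoc 10]
    exact mul_le_mul e (hB t) (norm_nonneg _) (by norm_num)
  constructor
  -- The weighted difference is bounded and integrable, hence square integrable.
  · obtain ⟨B, hBd⟩ : ∃ B, ∀ u : ℝ, ‖Complex.exp (-(σ : ℂ) * u) * w u‖ ≤ B := by
      refine ⟨C₂ * h ^ (-2 * ε) * Real.exp (σ * h) + C₂ * h ^ (-2 * ε), fun u => ?_⟩
      have e1 := hCb₂ h h0 h1 (u + h)
      have e2 := hCb₂ h h0 h1 u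
      rw [norm_mul, Complex.norm_exp]
      have e3 : (-(σ : ℂ) * u).re = -(σ * u) := by simp
      rw [e3]
      calc Real.exp (-(σ * u)) * ‖w u‖ ≤ Real.exp (-(σ * u)) *
            (C₂ * h ^ (-2 * ε) * Real.exp (σ * (u + h)) +
              C₂ * h ^ (-2 * ε) * Real.exp (σ * u)) := by
            gcongr
            exact (norm_sub_le _ _).trans (add_le_add e1 e2)
        _ = C₂ * h ^ (-2 * ε) * (Real.exp (-(σ * u)) * Real.exp (σ * (u + h))) +
              C₂ * h ^ (-2 * ε) * (Real.exp (-(σ * u)) * Real.exp (σ * u)) := by ring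
        _ = _ := by
            rw [← Real.exp_add, ← Real.exp_add, neg_add_cancel, Real.exp_zero, mul_one]
            ring_nf
    have hcφ : Continuous fun u : ℝ => ‖Complex.exp (-(σ : ℂ) * u) * w u‖ ^ 2 := by fun_prop
    refine (hiw.norm.const_mul B).mono' hcφ.aestronglyMeasurable (.of_forall fun u => ?_)
    rw [Real.norm_of_nonneg (by positivity), pow_two]
    exact mul_le_mul_of_nonneg_right (hBd u) (norm_nonneg _)
  · rw [laplace_plancherel hcw hiw hiL]
    have hb : ∫ t : ℝ, ‖laplace w (σ + t * Complex.I)‖ ^ 2 ≤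
        ∫ t : ℝ, (100 * C ^ 2 * h ^ (1 - 4 * ε)) * (1 + ‖t‖) ^ (-(1 + 2 * ε)) := by
      refine integral_mono_of_nonneg (.of_forall fun t => by positivity) (hJi.const_mul _)
        (.of_forall fun t => ?_)
      -- Squared, the exponent `1 / 2` gains a factor `h * (1 + |t|)`: the full power of `h`
      -- appears, and the integrand still decays like `(1 + |t|) ^ (-(1 + 2 * ε))`.
      have e := hexp (1 / 2) (by norm_num) (by norm_num) t
      have hT : 0 < 1 + |t| := by positivity
      have hn : ‖(σ : ℂ) + t * Complex.I‖ ≤ 1 + |t| := by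
        refine (norm_add_le _ _).trans ?_
        rw [norm_mul, Complex.norm_I, mul_one, Complex.norm_of_nonneg (by linarith),
          Complex.norm_real, Real.norm_eq_abs]
        linarith
      have hle : ‖laplace w (σ + t * Complex.I)‖ ≤
          (10 * (h * (1 + |t|)) ^ (1 / 2 : ℝ)) *
            (C * h ^ (-2 * ε) * (1 + |t|) ^ (-(1 + ε))) := by
        rw [hLw, norm_mul]
        refine mul_le_mul (e.trans ?_) (hB t) (norm_nonneg _) (by positivity)
        gcongr
      simp only [Real.norm_eq_abs]
      have hsq : ∀ x y : ℝ, 0 ≤ x → (x ^ y) ^ 2 = x ^ (2 * y) := fun x y hx => by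
        rw [← Real.rpow_natCast, ← Real.rpow_mul hx]; ring_nf
      refine (pow_le_pow_left₀ (norm_nonneg _) hle 2).trans_eq ?_
      calc _ = 100 * C ^ 2 * (((h * (1 + |t|)) ^ (1 / 2 : ℝ)) ^ 2 * (h ^ (-2 * ε)) ^ 2 *
              ((1 + |t|) ^ (-(1 + ε))) ^ 2) := by ring
        _ = 100 * C ^ 2 * ((h ^ (1 : ℝ) * h ^ (-4 * ε)) *
              ((1 + |t|) ^ (1 : ℝ) * (1 + |t|) ^ (-2 * (1 + ε)))) := by
            rw [hsq _ _ (by positivity), hsq _ _ h0.le, hsq _ _ hT.le]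
            rw [show 2 * (1 / 2 : ℝ) = 1 by norm_num, Real.rpow_one, Real.rpow_one, Real.rpow_one]
            ring_nf
        _ = _ := by
            rw [← Real.rpow_add h0, ← Real.rpow_add hT]
            ring_nf
    rw [integral_const_mul] at hb
    refine (mul_le_mul_of_nonneg_left hb (by positivity)).trans_eq ?_
    ring

/-- An integer increment `k ≥ 0` satisfies `k ≤ k ^ 2`, so a mean square detects jumps to first
order, whereas the smooth term enters only quadratically. The difference is `a - b` with `a ≥ k / 2`
from `F` and `b` from the exponential, and `(a - b) ^ 2 ≥ a ^ 2 / 2 - b ^ 2`. -/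
theorem steklov_diff_sq_ge {F : ℝ → ℝ} (hF : Monotone F) (hN : ∀ u, ∃ n : ℤ, F u = n) {c h u : ℝ}
    (hc : 0 ≤ c) (hh : 0 < h) (h1 : h ≤ 1) (hu : 0 ≤ u) :
    (F (u + 3 * h / 2) - F (u + h / 2)) / 8 - (4 * c * Real.exp u * h) ^ 2 ≤
      ‖steklov h (fun u => (F u : ℂ) - c * truncExp u) (u + h) -
        steklov h (fun u => (F u : ℂ) - c * truncExp u) u‖ ^ 2 := by
  rw [steklov_sub_truncExp hF c hh hu, steklov_sub_truncExp hF c hh (by linarith),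
    ← Complex.ofReal_sub, Complex.norm_real, Real.norm_eq_abs, sq_abs]
  set k := F (u + 3 * h / 2) - F (u + h / 2) with hk
  have hk0 : 0 ≤ k := sub_nonneg.mpr (hF (by linarith))
  have hk2 : k ≤ k ^ 2 := by
    obtain ⟨m, hm⟩ := hN (u + 3 * h / 2)
    obtain ⟨n, hn⟩ := hN (u + h / 2)
    have e : k = ((m - n : ℤ) : ℝ) := by rw [hk, hm, hn]; push_cast; ring
    rw [e] at hk0 ⊢
    have : 0 ≤ m - n := by exact_mod_cast hk0
    have : m - n ≤ (m - n) ^ 2 := by nlinarith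
    exact_mod_cast this
  set a := h⁻¹ * ((∫ v in (u + h)..(u + h + h), F v) - ∫ v in u..(u + h), F v) with ha
  have hak : k / 2 ≤ a := by
    rw [ha, le_inv_mul_iff₀ hh]
    have := hF.integral_sub_integral_ge (u := u) hh.le
    linarith
  set b := c * (Real.exp u * ((Real.exp h - 1) ^ 2 / h)) with hb
  have hb0 : 0 ≤ b := by positivity
  have hb1 : b ≤ 4 * c * Real.exp u * h := by
    have e1 : Real.exp h - 1 ≤ 2 * h := by
      have := (abs_le.mp (Real.abs_exp_sub_one_sub_id_le (x := h) (by rwa [abs_of_pos hh]))).2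
      nlinarith
    have e0 : 0 ≤ Real.exp h - 1 := by linarith [Real.add_one_le_exp h]
    have e2 : (Real.exp h - 1) ^ 2 / h ≤ 4 * h := by
      rw [div_le_iff₀ hh]; nlinarith
    calc b = c * (Real.exp u * ((Real.exp h - 1) ^ 2 / h)) := hb
      _ ≤ c * (Real.exp u * (4 * h)) := by gcongr
      _ = _ := by ring
  have heq : h⁻¹ * (∫ v in (u + h)..(u + h + h), F v) -
        c * (Real.exp (u + h) * ((Real.exp h - 1) / h)) -
      (h⁻¹ * (∫ v in u..(u + h), F v) - c * (Real.exp u * ((Real.exp h - 1) / h))) = a - b := by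
    rw [ha, hb, Real.exp_add]; ring
  rw [heq]
  have h3 : b ^ 2 ≤ (4 * c * Real.exp u * h) ^ 2 := by gcongr
  have h4 : (k / 2) ^ 2 ≤ a ^ 2 := by gcongr
  nlinarith [sq_nonneg (a - 2 * b)]

/-- The integrals of the two translates cancel on their overlap, leaving two end pieces of length
`h`. -/
theorem Monotone.integral_shift_sub_ge {F : ℝ → ℝ} (hF : Monotone F) {U h : ℝ} (hh : 0 ≤ h) :
    h * (F (U + 1) - F (U + 3 * h / 2)) ≤
      ∫ u in U..(U + 1), (F (u + 3 * h / 2) - F (u + h / 2)) := by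
  have i : ∀ a b, IntervalIntegrable F volume a b := fun _ _ => hF.intervalIntegrable
  have i' : ∀ d, IntervalIntegrable (fun u => F (u + d)) volume U (U + 1) := fun d =>
    Monotone.intervalIntegrable fun a b hab => hF (by linarith)
  rw [intervalIntegral.integral_sub (i' _) (i' _), intervalIntegral.integral_comp_add_right,
    intervalIntegral.integral_comp_add_right]
  have e1 := intervalIntegral.integral_add_adjacent_intervals (i (U + h / 2) (U + 3 * h / 2))
    (i (U + 3 * h / 2) (U + 1 + 3 * h / 2))
  have e2 := intervalIntegral.integral_add_adjacent_intervals (i (U + h / 2) (U + 1 + h / 2))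
    (i (U + 1 + h / 2) (U + 1 + 3 * h / 2))
  have h1 := hF.mul_le_integral (a := U + 1 + h / 2) (b := U + 1 + 3 * h / 2) (by linarith)
  have h2 := hF.integral_le_mul (a := U + h / 2) (b := U + 3 * h / 2) (by linarith)
  have h3 : F (U + 1) ≤ F (U + 1 + h / 2) := hF (by linarith)
  nlinarith

/-- Numerically `e - e ^ (1 / 2) ≥ 27 / 10 - 17 / 10 = 1`, so the main term grows by at least `c *
exp U`; the condition `hCU` keeps the two error terms together below half of that. -/
theorem exp_le_sub_of_abs_sub_exp_le {F : ℝ → ℝ} {c θ C U d : ℝ} (hc : 0 ≤ c) (hC : 0 ≤ C)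
    (hθ : 0 ≤ θ) (hF : ∀ u, 0 ≤ u → |F u - c * Real.exp u| ≤ C * Real.exp (θ * u)) (hU : 0 ≤ U)
    (hd0 : 0 ≤ 3 * d / 2) (hd : 3 * d / 2 ≤ 1 / 2)
    (hCU : 4 * C * Real.exp θ ≤ c * Real.exp ((1 - θ) * U)) :
    c * Real.exp U / 2 ≤ F (U + 1) - F (U + 3 * d / 2) := by
  have he1 := Real.exp_one_gt_d9
  have he2 := Real.exp_one_lt_d9
  have b1 := (abs_le.mp (hF (U + 1) (by linarith))).1
  have b2 := (abs_le.mp (hF (U + 3 * d / 2) (by linarith))).2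
  have b3 : Real.exp (U + 3 * d / 2) ≤ Real.exp U * (17 / 10) := by
    rw [Real.exp_add]
    gcongr
    have e1 : Real.exp (3 * d / 2) ≤ Real.exp (1 / 2) := Real.exp_le_exp.mpr hd
    have e2 : Real.exp (1 / 2) * Real.exp (1 / 2) = Real.exp 1 := by
      rw [← Real.exp_add]; norm_num
    have e3 : Real.exp (1 / 2) ≤ 17 / 10 := by
      refine le_of_not_gt fun h => ?_
      nlinarith
    linarith
  have b4 : Real.exp U * (27 / 10) ≤ Real.exp (U + 1) := by
    rw [Real.exp_add]
    gcongr
    linarith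
  have b5 : C * Real.exp (θ * (U + 3 * d / 2)) ≤ C * (Real.exp (θ * U) * Real.exp θ) := by
    rw [← Real.exp_add]
    gcongr
    have : θ * (3 * d / 2) ≤ θ * 1 := mul_le_mul_of_nonneg_left (by linarith) hθ
    linarith
  have b6 : C * Real.exp (θ * (U + 1)) = C * (Real.exp (θ * U) * Real.exp θ) := by
    rw [← Real.exp_add]; ring_nf
  have b7 : 4 * C * Real.exp θ * Real.exp (θ * U) ≤ c * Real.exp U := by
    have : Real.exp U = Real.exp ((1 - θ) * U) * Real.exp (θ * U) := by
      rw [← Real.exp_add]; ring_nf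
    rw [this, ← mul_assoc]
    gcongr
  have b8 := mul_le_mul_of_nonneg_left b3 hc
  have b9 := mul_le_mul_of_nonneg_left b4 hc
  have b10 : 0 ≤ c * Real.exp U := by positivity
  linarith

/-- An integer-valued nondecreasing function cannot be `c * exp u + O(exp (θ * u))` with
`θ < 1 / 2` if its Laplace transform grows slower than any power. -/
theorem false_of_subpolyGrowth {F : ℝ → ℝ} (hF : Monotone F) (hN : ∀ u, ∃ n : ℤ, F u = n)
    {c θ C₁ : ℝ} (hc : 0 < c) (hθ : 0 < θ) (hθ1 : θ < 1 / 2)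
    (hG : ExpBound (fun u => (F u : ℂ) - c * truncExp u) θ C₁)
    (hg : SubpolyGrowth (fun s => s * laplace (fun u => (F u : ℂ) - c * truncExp u) s) θ) :
    False := by
  set G : ℝ → ℂ := fun u => (F u : ℂ) - c * truncExp u with hGd
  -- With `σ = θ + ε` this gives `1 - 4 * ε - 2 * σ = 2 * ε > 0`, the exponent gap that produces the
  -- contradiction.
  set ε := (1 / 2 - θ) / 4 with hε
  have hε0 : 0 < ε := by rw [hε]; linarith
  obtain ⟨C, hC, hCb⟩ := integral_steklov_diff_le hG hθ hε0 (by linarith) hg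
  set σ := θ + ε with hσ
  -- `1 / 3` ensures `3 * h / 2 ≤ 1 / 2`. As `4608 = 144 * 32`, the other bound gives `144 * c ^ 2 *
  -- δ ^ 2 ≤ c * δ / 32`, half of the jump contribution `c * δ / 16`.
  set δ := min (1 / 3) (1 / (4608 * c)) with hδ
  have hδ0 : 0 < δ := by positivity
  have hδ1 : δ ≤ 1 / 3 := min_le_left _ _
  have hδ2 : 4608 * c * δ ≤ 1 := by
    have := min_le_right (1 / 3) (1 / (4608 * c))
    rw [← hδ, le_div_iff₀ (by positivity)] at this
    linarith
  have hFb : ∀ u, 0 ≤ u → |F u - c * Real.exp u| ≤ C₁ * Real.exp (θ * u) := fun u hu => by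
    have := hG.bound u hu
    rw [hGd] at this
    simp only [truncExp_of_nonneg hu] at this
    rwa [← Complex.ofReal_mul, ← Complex.ofReal_sub, Complex.norm_real, Real.norm_eq_abs] at this
  have hC₁ := hG.const_nonneg
  have hev : ∀ᶠ U : ℝ in atTop, 4 * C₁ * Real.exp θ ≤ c * Real.exp ((1 - θ) * U) := by
    have : Tendsto (fun U : ℝ => c * Real.exp ((1 - θ) * U)) atTop atTop :=
      (Real.tendsto_exp_atTop.comp (tendsto_id.const_mul_atTop (by linarith))).const_mul_atTop hc
    exact this.eventually_ge_atTop _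
  have hev2 : ∀ᶠ U : ℝ in atTop, C * δ ^ (1 - 4 * ε) <
      (Real.exp (-1) * (c * δ / 32)) * Real.exp ((1 - 4 * ε - 2 * σ) * U) := by
    have : Tendsto (fun U : ℝ => (Real.exp (-1) * (c * δ / 32)) *
        Real.exp ((1 - 4 * ε - 2 * σ) * U)) atTop atTop :=
      (Real.tendsto_exp_atTop.comp (tendsto_id.const_mul_atTop (by linarith))).const_mul_atTop
        (by positivity)
    exact this.eventually_gt_atTop _
  obtain ⟨U, hU0, hU1, hU2⟩ := ((eventually_ge_atTop (0 : ℝ)).and (hev.and hev2)).exists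
  -- A fraction `δ` of the scale `exp (-U)`: the jumps contribute to order `δ` to the mean square,
  -- the smooth part only to order `δ ^ 2`.
  set h := δ * Real.exp (-U) with hh
  have hEU : Real.exp U * Real.exp (-U) = 1 := by rw [← Real.exp_add]; simp
  have h0 : 0 < h := by positivity
  have hhδ : h ≤ δ := mul_le_of_le_one_right hδ0.le (Real.exp_le_one_iff.mpr (by linarith))
  have h1 : h ≤ 1 := by linarith
  obtain ⟨hint, hle⟩ := hCb h h0 h1
  have he2 := Real.exp_one_lt_d9
  have hjump : c * Real.exp U / 2 ≤ F (U + 1) - F (U + 3 * h / 2) :=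
    exp_le_sub_of_abs_sub_exp_le hc.le hC₁ hθ.le hFb hU0 (by linarith) (by linarith) hU1
  have hshift := hF.integral_shift_sub_ge (U := U) h0.le
  have hFi : ∀ d, IntervalIntegrable (fun u => F (u + d)) volume U (U + 1) := fun d =>
    Monotone.intervalIntegrable fun a b hab => hF (by linarith)
  have hlow : Real.exp (-1) * Real.exp (-2 * σ * U) * (c * δ / 32) ≤
      ∫ u in U..(U + 1), ‖Complex.exp (-(σ : ℂ) * u) *
        (steklov h G (u + h) - steklov h G u)‖ ^ 2 := by
    have hmono : ∫ u in U..(U + 1), Real.exp (-1) * Real.exp (-2 * σ * U) *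
        ((F (u + 3 * h / 2) - F (u + h / 2)) / 8 - 144 * c ^ 2 * δ ^ 2) ≤
        ∫ u in U..(U + 1), ‖Complex.exp (-(σ : ℂ) * u) *
        (steklov h G (u + h) - steklov h G u)‖ ^ 2 := by
      refine intervalIntegral.integral_mono_on (by linarith)
        (((((hFi _).sub (hFi _)).div_const _).sub (by simp)).const_mul _)
        hint.intervalIntegrable fun u hu => ?_
      have hu0 : 0 ≤ u := hU0.trans hu.1
      have k1 := steklov_diff_sq_ge hF hN hc.le h0 h1 hu0
      have k2 : (4 * c * Real.exp u * h) ^ 2 ≤ 144 * c ^ 2 * δ ^ 2 := by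
        have e1 : Real.exp u ≤ Real.exp U * 3 := by
          calc Real.exp u ≤ Real.exp (U + 1) := Real.exp_le_exp.mpr hu.2
            _ ≤ Real.exp U * 3 := by rw [Real.exp_add]; gcongr; linarith
        have e2 : Real.exp u * h ≤ 3 * δ := by
          calc Real.exp u * h ≤ (Real.exp U * 3) * h := by gcongr
            _ = 3 * δ * (Real.exp U * Real.exp (-U)) := by rw [hh]; ring
            _ = 3 * δ := by rw [hEU, mul_one]
        have e3 : 0 ≤ Real.exp u * h := by positivity
        calc (4 * c * Real.exp u * h) ^ 2 = 16 * c ^ 2 * (Real.exp u * h) ^ 2 := by ring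
          _ ≤ 16 * c ^ 2 * (3 * δ) ^ 2 := by gcongr
          _ = _ := by ring
      -- Since `σ ≤ 1 / 2`, the weight `exp (-2 * σ * u)` drops by at most a factor `e` across `[U,
      -- U + 1]`.
      have k3 : Real.exp (-1) * Real.exp (-2 * σ * U) ≤
          ‖Complex.exp (-(σ : ℂ) * u)‖ ^ 2 := by
        rw [Complex.norm_exp, ← Real.exp_add, ← Real.exp_nat_mul]
        refine Real.exp_le_exp.mpr ?_
        simp only [Complex.mul_re, Complex.neg_re, Complex.ofReal_re, Complex.neg_im,
          Complex.ofReal_im, neg_zero, zero_mul, sub_zero, Nat.cast_ofNat]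
        have : σ * (u - U) ≤ 1 / 2 * 1 :=
          mul_le_mul (by linarith) (by linarith [hu.2]) (by linarith [hu.1]) (by norm_num)
        linarith
      rw [norm_mul, mul_pow]
      calc _ ≤ Real.exp (-1) * Real.exp (-2 * σ * U) *
            ‖steklov h G (u + h) - steklov h G u‖ ^ 2 := by
            gcongr; linarith
        _ ≤ _ := by gcongr
    refine le_trans ?_ hmono
    rw [intervalIntegral.integral_const_mul, intervalIntegral.integral_sub
      (((hFi _).sub (hFi _)).div_const _) (by simp), intervalIntegral.integral_div]
    gcongr
    simp only [intervalIntegral.integral_const, add_sub_cancel_left, one_smul]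
    have e1 : h * (c * Real.exp U / 2) = c * δ / 2 := by
      rw [hh]
      linear_combination c * δ / 2 * hEU
    have e2 : c * δ / 2 ≤ ∫ u in U..(U + 1), (F (u + 3 * h / 2) - F (u + h / 2)) := by
      rw [← e1]
      exact (mul_le_mul_of_nonneg_left hjump h0.le).trans hshift
    have e3 : 144 * c ^ 2 * δ ^ 2 ≤ c * δ / 32 := by nlinarith [mul_pos hc hδ0]
    linarith
  have hfull : ∫ u in U..(U + 1), ‖Complex.exp (-(σ : ℂ) * u) *
        (steklov h G (u + h) - steklov h G u)‖ ^ 2 ≤ C * h ^ (1 - 4 * ε) := by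
    refine le_trans ?_ hle
    rw [intervalIntegral.integral_of_le (by linarith)]
    exact setIntegral_le_integral hint (.of_forall fun u => by positivity)
  have hhp : h ^ (1 - 4 * ε) = δ ^ (1 - 4 * ε) * Real.exp (-(1 - 4 * ε) * U) := by
    rw [hh, Real.mul_rpow hδ0.le (Real.exp_nonneg _), ← Real.exp_mul]; ring_nf
  have hcomb := hlow.trans hfull
  rw [hhp, ← mul_assoc] at hcomb
  have hmul := mul_lt_mul_of_pos_right hU2 (Real.exp_pos (-(1 - 4 * ε) * U))
  refine absurd (hmul.trans_le' hcomb) (not_lt.mpr (le_of_eq ?_))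
  have : Real.exp (-2 * σ * U) = Real.exp ((1 - 4 * ε - 2 * σ) * U) *
      Real.exp (-(1 - 4 * ε) * U) := by rw [← Real.exp_add]; ring_nf
  rw [this]; ring

/-! ### Borel–Carathéodory, logarithms and growth without zeros -/

theorem borelCaratheodory_of_center {g : ℂ → ℂ} {c z : ℂ} {A R : ℝ} (hA : 0 < A)
    (hg : DifferentiableOn ℂ g (Metric.ball c R)) (hre : ∀ w ∈ Metric.ball c R, (g w).re ≤ A)
    (h0 : g c = 0) (hz : z ∈ Metric.ball c R) :
    ‖g z‖ ≤ 2 * A * ‖z - c‖ / (R - ‖z - c‖) := by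
  have hR : 0 < R := Metric.pos_of_mem_ball hz
  have hmap : ∀ w ∈ Metric.ball (0 : ℂ) R, c + w ∈ Metric.ball c R := fun w hw => by
    simpa [dist_eq_norm] using hw
  have := Complex.borelCaratheodory_zero (f := fun w => g (c + w)) (z := z - c) (R := R) hA
    (hg.comp (by fun_prop) hmap) (fun w hw => hre _ (hmap w hw)) hR
    (by simpa [dist_eq_norm] using hz) (by simpa using h0)
  simpa using this

/-- If `g` vanishes at the centre of two concentric discs, and `re g ≤ A` on the larger disc and
`re g ≤ B` on the smaller one, then `g` is at most `ε * A + O(1)` inside the larger disc. -/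
theorem exists_norm_le_of_re_le {r R r₁ B ε : ℝ} (hr : 0 < r) (hrR : r < R) (hr₁ : 0 < r₁)
    (hr₁R : r₁ ≤ R) (hB : 0 < B) (hε : 0 < ε) :
    ∃ C, ∀ (c : ℂ) (g : ℂ → ℂ) (A : ℝ), 0 < A → DifferentiableOn ℂ g (Metric.ball c R) →
      g c = 0 → (∀ w ∈ Metric.ball c R, (g w).re ≤ A) → (∀ w ∈ Metric.ball c r₁, (g w).re ≤ B) →
      ∀ z ∈ Metric.closedBall c r, ‖g z‖ ≤ ε * A + C := by
  set ρ := (r + R) / 2 with hρ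
  have hrρ : r < ρ := by linarith
  have hρR : ρ < R := by linarith
  have hρ0 : 0 < ρ := by linarith
  set M := 2 * ρ / (R - ρ) with hM
  have hM0 : 0 < M := div_pos (by linarith) (by linarith)
  set q := r / ρ with hq
  have hq0 : 0 < q := by positivity
  have hq1 : q < 1 := (div_lt_one hρ0).mpr hrρ
  -- The Taylor tail from `n₀` on, estimated on radius `ρ`, is at most `M * A * q ^ n₀ / (1 - q) ≤ ε
  -- * A`. The first `n₀` terms are estimated on radius `r₁ / 2`, where the bound `2 * B` does not
  -- involve `A`; as `n₀` depends only on the radii and `ε`, their sum is a uniform constant.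
  obtain ⟨n₀, hn₀⟩ := exists_pow_lt_of_lt_one (show 0 < ε * (1 - q) / M from
    div_pos (mul_pos hε (by linarith)) hM0) hq1
  refine ⟨∑ n ∈ Finset.range n₀, 2 * B * (r / (r₁ / 2)) ^ n, fun c g A hA hg h0 hRe hre z hz => ?_⟩
  have hzr : ‖z - c‖ ≤ r := by simpa [dist_eq_norm] using hz
  have hT := Complex.hasSum_taylorSeries_on_ball hg
    (Metric.closedBall_subset_ball hrR hz)
  set t : ℕ → ℂ := fun n => (n.factorial : ℂ)⁻¹ • (z - c) ^ n • iteratedDeriv n g c with ht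
  have coeff : ∀ (n : ℕ) (ρ' D : ℝ), 0 < ρ' → ρ' < R → (∀ w ∈ Metric.sphere c ρ', ‖g w‖ ≤ D) →
      ‖t n‖ ≤ D * (r / ρ') ^ n := by
    intro n ρ' D h1 h2 h3
    have h4 := Complex.norm_iteratedDeriv_le_of_forall_mem_sphere_norm_le n h1
      (hg.diffContOnCl_ball (Metric.closedBall_subset_ball h2)) h3
    have hf : (0 : ℝ) < n.factorial := by exact_mod_cast n.factorial_pos
    calc ‖t n‖ = (n.factorial : ℝ)⁻¹ * (‖z - c‖ ^ n * ‖iteratedDeriv n g c‖) := by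
          simp [ht]
      _ ≤ (n.factorial : ℝ)⁻¹ * (r ^ n * (n.factorial * D / ρ' ^ n)) := by gcongr
      _ = D * (r / ρ') ^ n := by rw [div_pow]; field_simp
  have big : ∀ n, ‖t n‖ ≤ M * A * q ^ n := fun n => by
    refine coeff n ρ (M * A) hρ0 hρR fun w hw => ?_
    have hw' : ‖w - c‖ = ρ := by simpa [dist_eq_norm] using hw
    have := borelCaratheodory_of_center hA hg hRe h0
      (Metric.sphere_subset_closedBall.trans (Metric.closedBall_subset_ball hρR) hw)
    rw [hw'] at this
    refine this.trans_eq ?_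
    rw [hM]; ring
  have small : ∀ n, ‖t n‖ ≤ 2 * B * (r / (r₁ / 2)) ^ n := fun n => by
    refine coeff n (r₁ / 2) (2 * B) (by linarith) (by linarith) fun w hw => ?_
    have hw' : ‖w - c‖ = r₁ / 2 := by simpa [dist_eq_norm] using hw
    have := borelCaratheodory_of_center hB (hg.mono (Metric.ball_subset_ball hr₁R)) hre h0
      (Metric.sphere_subset_closedBall.trans (Metric.closedBall_subset_ball (by linarith)) hw)
    rw [hw'] at this
    refine this.trans_eq ?_
    field_simp
    ring
  have hgeo : HasSum (fun n : ℕ => M * A * q ^ (n + n₀)) (M * A * (q ^ n₀ * (1 - q)⁻¹)) := by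
    have := ((hasSum_geometric_of_lt_one hq0.le hq1).mul_left (q ^ n₀)).mul_left (M * A)
    simpa [pow_add, mul_comm] using this
  have htail : ‖∑' n, t (n + n₀)‖ ≤ M * A * (q ^ n₀ * (1 - q)⁻¹) :=
    tsum_of_norm_bounded hgeo fun n => big (n + n₀)
  have hsplit := hT.summable.sum_add_tsum_nat_add n₀
  rw [hT.tsum_eq] at hsplit
  rw [← hsplit]
  refine (norm_add_le _ _).trans ?_
  have h5 : M * A * (q ^ n₀ * (1 - q)⁻¹) ≤ ε * A := by
    have h6 : q ^ n₀ * M ≤ ε * (1 - q) := ((lt_div_iff₀ hM0).mp hn₀).le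
    have h7 : 0 < 1 - q := by linarith
    calc M * A * (q ^ n₀ * (1 - q)⁻¹) = (q ^ n₀ * M) * (A * (1 - q)⁻¹) := by ring
      _ ≤ (ε * (1 - q)) * (A * (1 - q)⁻¹) := by gcongr
      _ = ε * A := by field_simp
  have h8 : ‖∑ n ∈ Finset.range n₀, t n‖ ≤ ∑ n ∈ Finset.range n₀, 2 * B * (r / (r₁ / 2)) ^ n :=
    norm_sum_le_of_le _ fun n _ => small n
  linarith

/-- A nonvanishing holomorphic function on a disc has a holomorphic logarithm. -/
theorem exists_eq_mul_exp {Z : ℂ → ℂ} {c : ℂ} {R : ℝ} (hR : 0 < R)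
    (hZ : DifferentiableOn ℂ Z (Metric.ball c R)) (hne : ∀ z ∈ Metric.ball c R, Z z ≠ 0) :
    ∃ g : ℂ → ℂ, g c = 0 ∧ (∀ z ∈ Metric.ball c R, HasDerivAt g (deriv Z z / Z z) z) ∧
      ∀ z ∈ Metric.ball c R, Z z = Z c * Complex.exp (g z) := by
  have hd : DifferentiableOn ℂ (fun z => deriv Z z / Z z) (Metric.ball c R) :=
    (hZ.deriv Metric.isOpen_ball).div hZ hne
  obtain ⟨g, hg0, hg⟩ := hd.isExactOn_ball.with_val_at c 0
  have hc : c ∈ Metric.ball c R := Metric.mem_ball_self hR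
  refine ⟨g, hg0, hg, fun z hz => ?_⟩
  have hder : ∀ w ∈ Metric.ball c R, HasDerivAt (fun w => Z w * Complex.exp (-g w)) 0 w := by
    intro w hw
    have h1 := (hZ.differentiableAt (Metric.isOpen_ball.mem_nhds hw)).hasDerivAt
    have h2 := h1.mul ((hg w hw).neg.cexp)
    convert! h2 using 1
    have := hne w hw
    field_simp
    ring
  have hconst := (convex_ball c R).is_const_of_fderivWithin_eq_zero (𝕜 := ℂ)
    (f := fun w => Z w * Complex.exp (-g w))
    (fun w hw => (hder w hw).differentiableAt.differentiableWithinAt)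
    (fun w hw => by
      rw [fderivWithin_of_isOpen Metric.isOpen_ball hw]
      ext; simpa using (hder w hw).deriv) hz hc
  simp only [hg0, neg_zero, Complex.exp_zero, mul_one] at hconst
  rw [← hconst, mul_assoc, ← Complex.exp_add]; simp

/-- A solution of `L' = Q * L` on a half-plane which is nonzero at one point is nonzero
everywhere. -/
theorem ne_zero_of_deriv_eq_mul {L Q : ℂ → ℂ} {θ : ℝ} (hL : DifferentiableOn ℂ L {s | θ < s.re})
    (hQ : ContinuousOn Q {s | θ < s.re}) (hode : ∀ s, θ < s.re → deriv L s = Q s * L s) {s₁ : ℂ}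
    (hs₁ : θ < s₁.re) (h1 : L s₁ ≠ 0) {s : ℂ} (hs : θ < s.re) : L s ≠ 0 := by
  intro h0
  -- Along the segment from `s` to `s₁` the equation gives `‖(L ∘ γ)'‖ ≤ K * ‖L ∘ γ‖`, so by
  -- Grönwall a zero at `s` would propagate to `s₁`.
  set γ : ℝ → ℂ := fun t => s + t * (s₁ - s) with hγ
  have hγre : ∀ t ∈ Set.Icc (0 : ℝ) 1, θ < (γ t).re := fun t ht => by
    have : (γ t).re = (1 - t) * s.re + t * s₁.re := by simp [hγ]; ring
    rw [this]
    rcases eq_or_lt_of_le ht.1 with h | h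
    · rw [← h]; simpa using hs
    · nlinarith [ht.2]
  have hγd : ∀ t : ℝ, HasDerivAt γ (s₁ - s) t := fun t => by
    have h2 : HasDerivAt (fun t : ℝ => (t : ℂ)) 1 t := Complex.ofRealCLM.hasDerivAt
    have h3 := (h2.mul_const (s₁ - s)).const_add s
    rwa [one_mul] at h3
  have hγc : Continuous γ := by fun_prop
  have hopen : IsOpen {s : ℂ | θ < s.re} := isOpen_lt continuous_const Complex.continuous_re
  have hd : ∀ t ∈ Set.Icc (0 : ℝ) 1, HasDerivAt (fun t => L (γ t)) ((s₁ - s) * (Q (γ t) * L (γ t))) t := by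
    intro t ht
    have h2 := (hL.differentiableAt (hopen.mem_nhds (hγre t ht))).hasDerivAt
    rw [hode _ (hγre t ht)] at h2
    have := h2.scomp t (hγd t)
    simpa [Function.comp_def] using! this
  obtain ⟨K, hK⟩ := isCompact_Icc.exists_bound_of_continuousOn (f := fun t : ℝ => (s₁ - s) * Q (γ t))
    (continuousOn_const.mul (hQ.comp hγc.continuousOn hγre))
  have := eq_zero_of_abs_deriv_le_mul_abs_self_of_eq_zero_right (K := K)
    (fun t ht => (hd t ht).continuousAt.continuousWithinAt)
    (fun t ht => (hd t (Set.Ico_subset_Icc_self ht)).hasDerivWithinAt) (by simpa [hγ] using h0)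
    (fun t ht => by
      rw [← mul_assoc, norm_mul]
      exact mul_le_mul_of_nonneg_right (hK t (Set.Ico_subset_Icc_self ht)) (norm_nonneg _))
    1 (by simp)
  simp [hγ] at this
  exact h1 this

theorem isOpen_halfPlane (θ : ℝ) : IsOpen {s : ℂ | θ < s.re} :=
  isOpen_lt continuous_const Complex.continuous_re

/-- Local logarithms of a function that is holomorphic without zeros on `θ < re s`, `s ≠ 1`,
bounded above and below on `2 ≤ re s` and of polynomial growth, are `≤ ε * log |t| + O(1)`. -/
theorem exists_log_le {Z : ℂ → ℂ} {θ B : ℝ} (hθ : 0 < θ) (hθ1 : θ < 1)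
    (hZ : DifferentiableOn ℂ Z {s | θ < s.re ∧ s ≠ 1}) (hne : ∀ s, θ < s.re → s ≠ 1 → Z s ≠ 0)
    (hB : ∀ s, 2 ≤ s.re → ‖Z s‖ ≤ B ∧ B⁻¹ ≤ ‖Z s‖)
    (hg : ∀ ε > 0, ∃ C, ∀ s : ℂ, θ + ε ≤ s.re → s.re ≤ 6 → 1 ≤ |s.im| → ‖Z s‖ ≤ C * |s.im| ^ 2)
    {ε : ℝ} (hε : 0 < ε) (hε1 : ε ≤ 1) :
    ∃ D, ∀ t : ℝ, 4 ≤ |t| → ∃ g : ℂ → ℂ,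
      (∀ z ∈ Metric.ball (3 + t * Complex.I) (3 - θ - ε / 4), HasDerivAt g (deriv Z z / Z z) z) ∧
      (∀ z ∈ Metric.ball (3 + t * Complex.I) (3 - θ - ε / 4),
        Z z = Z (3 + t * Complex.I) * Complex.exp (g z)) ∧
      ∀ z ∈ Metric.closedBall (3 + t * Complex.I) (3 - θ - ε / 2),
        ‖g z‖ ≤ ε * Real.log |t| + D := by
  obtain ⟨C, hC⟩ := hg (ε / 4) (by positivity)
  have hB0 : 0 < B := by
    have h2 := hB 2 (by simp)
    by_contra hB
    have h3 : ‖Z 2‖ = 0 := le_antisymm (h2.1.trans (not_lt.mp hB)) (norm_nonneg _)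
    rw [norm_eq_zero] at h3
    refine hne 2 (by simp; linarith) ?_ h3
    norm_num
  set C' := max C 1 with hC'
  have hC'0 : 0 < C' := by positivity
  -- The disc of radius `1` about `3 + it` lies in `re s ≥ 2`, where the bound is independent of
  -- `t`. On the large disc quadratic growth gives a real part up to `2 * log |t| + O(1)`, hence `ε
  -- / 2`.
  obtain ⟨D, hD⟩ := exists_norm_le_of_re_le (r := 3 - θ - ε / 2) (R := 3 - θ - ε / 4) (r₁ := 1)
    (B := |Real.log (B * B)| + 1) (ε := ε / 2) (by linarith) (by linarith) one_pos (by linarith)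
    (by positivity) (by positivity)
  refine ⟨ε / 2 * (|Real.log (16 * C' * B)| + 1) + D, fun t ht => ?_⟩
  set c : ℂ := 3 + t * Complex.I with hc
  have hcre : c.re = 3 := by simp [hc]
  have hcim : c.im = t := by simp [hc]
  have ht0 : 0 < |t| := by linarith
  -- The radius is below `3` and `|t| ≥ 4`, so the disc stays at height at least `1`, away from the
  -- point `1`.
  have hpos : ∀ z ∈ Metric.ball c (3 - θ - ε / 4), θ + ε / 4 ≤ z.re ∧ z.re ≤ 6 ∧ 1 ≤ |z.im| ∧
      |z.im| ≤ 4 * |t| := by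
    intro z hz
    have h1 : ‖z - c‖ < 3 - θ - ε / 4 := mem_ball_iff_norm.mp hz
    have h2 := abs_le.mp ((Complex.abs_re_le_norm (z - c)).trans h1.le)
    have h3 := (Complex.abs_im_le_norm (z - c)).trans h1.le
    rw [Complex.sub_re, hcre] at h2
    rw [Complex.sub_im, hcim] at h3
    have h4 := abs_sub_abs_le_abs_sub t z.im
    have h5 := abs_sub_abs_le_abs_sub z.im t
    rw [abs_sub_comm] at h4
    refine ⟨by linarith, by linarith, by linarith, by linarith⟩
  have hz1 : ∀ z ∈ Metric.ball c (3 - θ - ε / 4), θ < z.re ∧ z ≠ 1 := fun z hz => by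
    obtain ⟨h1, -, h3, -⟩ := hpos z hz
    refine ⟨by linarith, fun h => ?_⟩
    simp [h] at h3
    linarith
  have hcB := hB c (by rw [hcre]; norm_num)
  have hZc : 0 < ‖Z c‖ := (inv_pos.mpr hB0).trans_le hcB.2
  obtain ⟨g, hgc, hgd, hge⟩ := exists_eq_mul_exp (c := c) (R := 3 - θ - ε / 4) (by linarith)
    (hZ.mono fun z hz => hz1 z hz) fun z hz => hne z (hz1 z hz).1 (hz1 z hz).2
  have hre : ∀ z ∈ Metric.ball c (3 - θ - ε / 4), ∀ K, ‖Z z‖ ≤ K → (g z).re ≤ Real.log (K * B) := by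
    intro z hz K hK
    have h1 : ‖Z z‖ = ‖Z c‖ * Real.exp (g z).re := by
      rw [hge z hz, norm_mul, Complex.norm_exp]
    have h2 : Real.exp (g z).re ≤ K * B := by
      rw [h1] at hK
      calc Real.exp (g z).re = B⁻¹ * Real.exp (g z).re * B := by field_simp
        _ ≤ ‖Z c‖ * Real.exp (g z).re * B := by gcongr; exact hcB.2
        _ ≤ K * B := by gcongr
    exact (Real.le_log_iff_exp_le ((Real.exp_pos _).trans_le h2)).mpr h2
  refine ⟨g, hgd, hge, fun z hz => ?_⟩
  have hlog : 0 ≤ Real.log |t| := Real.log_nonneg (by linarith)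
  have hA : ∀ w ∈ Metric.ball c (3 - θ - ε / 4), (g w).re ≤
      |Real.log (16 * C' * B)| + 1 + 2 * Real.log |t| := fun w hw => by
    obtain ⟨h1, h2, h3, h4⟩ := hpos w hw
    have h5 : ‖Z w‖ ≤ 16 * C' * |t| ^ 2 := by
      refine (hC w h1 h2 h3).trans ?_
      calc C * |w.im| ^ 2 ≤ C' * (4 * |t|) ^ 2 := by gcongr; exact le_max_left _ _
        _ = _ := by ring
    refine (hre w hw _ h5).trans ?_
    rw [show 16 * C' * |t| ^ 2 * B = (16 * C' * B) * |t| ^ 2 by ring,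
      Real.log_mul (by positivity) (by positivity), Real.log_pow]
    push_cast
    linarith [le_abs_self (Real.log (16 * C' * B))]
  have hsm : ∀ w ∈ Metric.ball c 1, (g w).re ≤ |Real.log (B * B)| + 1 := fun w hw => by
    have h1 := abs_le.mp ((Complex.abs_re_le_norm (w - c)).trans (mem_ball_iff_norm.mp hw).le)
    rw [Complex.sub_re, hcre] at h1
    have := hre w (Metric.ball_subset_ball (by linarith) hw) B (hB w (by linarith)).1
    linarith [le_abs_self (Real.log (B * B))]
  have := hD c g _ (by positivity) (fun w hw => (hgd w hw).differentiableAt.differentiableWithinAt)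
    hgc hA hsm z hz
  linarith

/-- Writing `Z = Z c * exp g` with `‖g‖ ≤ ε * log |t| + D` bounds both `Z` and its inverse by `|t| ^
ε`; Cauchy's estimate for `g' = Z' / Z` on a disc of radius `ε / 2` gives the third bound. -/
theorem subpolyGrowth_of_polynomial_growth {Z : ℂ → ℂ} {θ B : ℝ} (hθ : 0 < θ) (hθ1 : θ < 1)
    (hZ : DifferentiableOn ℂ Z {s | θ < s.re ∧ s ≠ 1}) (hne : ∀ s, θ < s.re → s ≠ 1 → Z s ≠ 0)
    (hB : ∀ s, 2 ≤ s.re → ‖Z s‖ ≤ B ∧ B⁻¹ ≤ ‖Z s‖)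
    (hg : ∀ ε > 0, ∃ C, ∀ s : ℂ, θ + ε ≤ s.re → s.re ≤ 6 → 1 ≤ |s.im| → ‖Z s‖ ≤ C * |s.im| ^ 2) :
    SubpolyGrowth Z θ ∧ SubpolyGrowth (fun s => (Z s)⁻¹) θ ∧
      SubpolyGrowth (fun s => deriv Z s / Z s) θ := by
  have main : ∀ ε > 0, ∃ K : ℝ, ∀ s : ℂ, θ + ε ≤ s.re → s.re ≤ 2 → 4 ≤ |s.im| →
      ‖Z s‖ ≤ K * |s.im| ^ ε ∧ ‖(Z s)⁻¹‖ ≤ K * |s.im| ^ ε ∧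
        ‖deriv Z s / Z s‖ ≤ K * |s.im| ^ ε := by
    intro ε' hε'
    obtain ⟨ε, hε, hε1, hεε'⟩ : ∃ ε > 0, ε ≤ 1 ∧ ε ≤ ε' :=
      ⟨min 1 ε', by positivity, min_le_left _ _, min_le_right _ _⟩
    obtain ⟨D, hD⟩ := exists_log_le hθ hθ1 hZ hne hB hg hε hε1
    have hB0 : 0 ≤ B := (norm_nonneg _).trans (hB 2 (by simp)).1
    set K := B * Real.exp D + (1 + |D|) / (ε / 2) with hK
    have hK0 : 0 ≤ K := by positivity
    refine ⟨K, fun s hs hs2 ht => ?_⟩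
    obtain ⟨g, hgd, hge, hgb⟩ := hD s.im ht
    set c : ℂ := 3 + s.im * Complex.I with hc
    have hcre : c.re = 3 := by simp [hc]
    have hcim : c.im = s.im := by simp [hc]
    have ht0 : 0 < |s.im| := by linarith
    have ht1 : 1 ≤ |s.im| := by linarith
    have hpow : |s.im| ^ ε ≤ |s.im| ^ ε' := Real.rpow_le_rpow_of_exponent_le ht1 hεε'
    have hpow1 : 1 ≤ |s.im| ^ ε := Real.one_le_rpow ht1 hε.le
    have hexp : Real.exp (ε * Real.log |s.im| + D) = Real.exp D * |s.im| ^ ε := by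
      rw [Real.exp_add, Real.rpow_def_of_pos ht0]; ring_nf
    have hsc : ‖s - c‖ = 3 - s.re := by
      have : s - c = ((s.re - 3 : ℝ) : ℂ) := by
        apply Complex.ext <;> simp [hc]
      rw [this, Complex.norm_real, Real.norm_eq_abs, abs_of_nonpos (by linarith)]
      ring
    have hsub : Metric.closedBall s (ε / 2) ⊆ Metric.closedBall c (3 - θ - ε / 2) :=
      Metric.closedBall_subset_closedBall' (by rw [dist_eq_norm, hsc]; linarith)
    have hss : s ∈ Metric.closedBall s (ε / 2) := Metric.mem_closedBall_self (by positivity)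
    have hsub' : Metric.closedBall c (3 - θ - ε / 2) ⊆ Metric.ball c (3 - θ - ε / 4) :=
      Metric.closedBall_subset_ball (by linarith)
    have hgs := hgb s (hsub hss)
    have hre := abs_le.mp ((Complex.abs_re_le_norm (g s)).trans hgs)
    have hcB := hB c (by rw [hcre]; norm_num)
    have hmain : B * (Real.exp D * |s.im| ^ ε) ≤ K * |s.im| ^ ε' := by
      calc B * (Real.exp D * |s.im| ^ ε) = (B * Real.exp D) * |s.im| ^ ε := by ring
        _ ≤ K * |s.im| ^ ε' := by
          gcongr
          rw [hK]
          have : 0 ≤ (1 + |D|) / (ε / 2) := by positivity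
          linarith
    have hZs := hge s (hsub' (hsub hss))
    refine ⟨?_, ?_, ?_⟩
    · refine le_trans ?_ hmain
      rw [hZs, norm_mul, Complex.norm_exp, ← hexp]
      gcongr
      · exact hcB.1
      · exact hre.2
    · refine le_trans ?_ hmain
      rw [hZs, mul_inv, norm_mul, ← Complex.exp_neg, Complex.norm_exp, ← hexp, norm_inv]
      have h1 : ‖Z c‖⁻¹ ≤ B := by
        rcases hB0.eq_or_lt with h | h
        · have := hcB.1
          rw [← h] at this ⊢
          simp [le_antisymm this (norm_nonneg _)]
        · exact (inv_le_comm₀ h ((inv_pos.mpr h).trans_le hcB.2)).mp hcB.2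
      gcongr
      rw [Complex.neg_re]
      linarith [hre.1]
    · rw [← (hgd s (hsub' (hsub hss))).deriv]
      have hd : DifferentiableOn ℂ g (Metric.ball c (3 - θ - ε / 4)) := fun w hw =>
        (hgd w hw).differentiableAt.differentiableWithinAt
      have h1 := Complex.norm_deriv_le_of_forall_mem_sphere_norm_le (c := s) (R := ε / 2)
        (C := ε * Real.log |s.im| + D) (f := g) (by positivity)
        (hd.diffContOnCl_ball (hsub.trans hsub'))
        fun z hz => hgb z (hsub (Metric.sphere_subset_closedBall hz))
      refine h1.trans ?_
      have h2 : ε * Real.log |s.im| ≤ |s.im| ^ ε := by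
        have := Real.log_le_rpow_div ht0.le hε
        rw [le_div_iff₀ hε] at this
        linarith
      have h3 : ε * Real.log |s.im| + D ≤ (1 + |D|) * |s.im| ^ ε := by
        nlinarith [le_abs_self D, abs_nonneg D]
      calc (ε * Real.log |s.im| + D) / (ε / 2) ≤ ((1 + |D|) * |s.im| ^ ε) / (ε / 2) := by gcongr
        _ = (1 + |D|) / (ε / 2) * |s.im| ^ ε := by ring
        _ ≤ K * |s.im| ^ ε' := by
          gcongr
          rw [hK]
          have : 0 ≤ B * Real.exp D := by positivity
          linarith
  refine ⟨fun ε hε => ?_, fun ε hε => ?_, fun ε hε => ?_⟩ <;> obtain ⟨K, hK⟩ := main ε hε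
  · exact ⟨K, 4, fun s h1 h2 h3 => (hK s h1 h2 h3).1⟩
  · exact ⟨K, 4, fun s h1 h2 h3 => (hK s h1 h2 h3).2.1⟩
  · exact ⟨K, 4, fun s h1 h2 h3 => (hK s h1 h2 h3).2.2⟩

/-- The growth estimates also follow from polynomial growth of the reciprocal. -/
theorem subpolyGrowth_of_polynomial_growth_inv {Z : ℂ → ℂ} {θ B : ℝ} (hθ : 0 < θ) (hθ1 : θ < 1)
    (hZ : DifferentiableOn ℂ Z {s | θ < s.re ∧ s ≠ 1}) (hne : ∀ s, θ < s.re → s ≠ 1 → Z s ≠ 0)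
    (hB : ∀ s, 2 ≤ s.re → ‖Z s‖ ≤ B ∧ B⁻¹ ≤ ‖Z s‖)
    (hg : ∀ ε > 0, ∃ C, ∀ s : ℂ, θ + ε ≤ s.re → s.re ≤ 6 → 1 ≤ |s.im| →
      ‖(Z s)⁻¹‖ ≤ C * |s.im| ^ 2) :
    SubpolyGrowth Z θ ∧ SubpolyGrowth (fun s => (Z s)⁻¹) θ := by
  have hne' : ∀ s, θ < s.re → s ≠ 1 → (Z s)⁻¹ ≠ 0 := fun s h1 h2 => inv_ne_zero (hne s h1 h2)
  have := subpolyGrowth_of_polynomial_growth (Z := fun s => (Z s)⁻¹) (B := B) hθ hθ1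
    (hZ.inv fun s hs => hne s hs.1 hs.2) hne' (fun s hs => by
      obtain ⟨h1, h2⟩ := hB s hs
      have h0 : 0 < ‖Z s‖ := norm_pos_iff.mpr (hne s (by linarith) fun h => by
        norm_num [h] at hs)
      have hB0 : 0 < B := h0.trans_le h1
      rw [norm_inv]
      exact ⟨(inv_le_comm₀ hB0 h0).mp h2, inv_anti₀ h0 h1⟩) hg
  exact ⟨by simpa using this.2.1, this.1⟩

/-! ### Dirichlet series identities for generalized integers -/

namespace BeurlingSystem

theorem one_le_val (P : BeurlingSystem) (e : ℕ →₀ ℕ) : 1 ≤ P.val e :=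
  (one_le_pow₀ (P.one_lt_p 0).le).trans (P.pow_le_val e 0)

theorem val_pos (P : BeurlingSystem) (e : ℕ →₀ ℕ) : 0 < P.val e :=
  one_pos.trans_le (P.one_le_val e)

theorem p_pos (P : BeurlingSystem) (i : ℕ) : 0 < P.p i := one_pos.trans (P.one_lt_p i)

/-- The logarithm of a generalized integer. -/
noncomputable def logVal (P : BeurlingSystem) (e : ℕ →₀ ℕ) : ℝ := Real.log (P.val e)

theorem logVal_nonneg (P : BeurlingSystem) (e : ℕ →₀ ℕ) : 0 ≤ P.logVal e :=
  Real.log_nonneg (P.one_le_val e)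

theorem logVal_le_iff (P : BeurlingSystem) (e : ℕ →₀ ℕ) (u : ℝ) :
    P.logVal e ≤ u ↔ P.val e ≤ Real.exp u :=
  Real.log_le_iff_le_exp (P.val_pos e)

theorem logVal_eq_sum (P : BeurlingSystem) (e : ℕ →₀ ℕ) :
    P.logVal e = ∑ i ∈ e.support, (e i : ℝ) * Real.log (P.p i) := by
  unfold logVal val Finsupp.prod
  rw [Real.log_prod fun i _ => (pow_pos (P.p_pos i) _).ne']
  simp [Real.log_pow]

theorem logVal_add (P : BeurlingSystem) (e f : ℕ →₀ ℕ) :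
    P.logVal (e + f) = P.logVal e + P.logVal f := by
  have : P.val (e + f) = P.val e * P.val f :=
    Finsupp.prod_add_index' (by simp) fun i a b => pow_add _ _ _
  rw [logVal, this, Real.log_mul (P.val_pos e).ne' (P.val_pos f).ne']
  rfl

theorem logVal_single (P : BeurlingSystem) (i k : ℕ) :
    P.logVal (Finsupp.single i k) = k * Real.log (P.p i) := by
  rw [logVal, val, Finsupp.prod_single_index (by simp), Real.log_pow]

theorem logVal_zero (P : BeurlingSystem) : P.logVal 0 = 0 := by simp [logVal, val]

theorem summable_exp (P : BeurlingSystem) (hP : P.abscissa = 1) {σ : ℝ} (hσ : 1 < σ) :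
    Summable fun e => Real.exp (-σ * P.logVal e) := by
  have h1 : sInf ((fun σ : ℝ => (σ : EReal)) '' {σ : ℝ | Summable fun e => P.val e ^ (-σ)})
      < (σ : EReal) := by
    have : P.abscissa < (σ : EReal) := by rw [hP]; exact_mod_cast hσ
    exact this
  obtain ⟨_, ⟨τ, hτ, rfl⟩, hlt⟩ := sInf_lt_iff.mp h1
  refine Summable.of_nonneg_of_le (fun e => (Real.exp_pos _).le) (fun e => ?_) hτ
  rw [Real.rpow_def_of_pos (P.val_pos e)]
  have h2 : τ ≤ σ := (EReal.coe_lt_coe_iff.mp hlt).le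
  have h3 := P.logVal_nonneg e
  refine Real.exp_le_exp.mpr ?_
  change -σ * P.logVal e ≤ P.logVal e * -τ
  nlinarith

theorem summable_logVal_mul_exp (P : BeurlingSystem) (hP : P.abscissa = 1) {σ : ℝ} (hσ : 1 < σ) :
    Summable fun e => P.logVal e * Real.exp (-σ * P.logVal e) := by
  have h1 := (P.summable_exp hP (σ := (1 + σ) / 2) (by linarith)).mul_left (((σ - 1) / 2)⁻¹)
  refine Summable.of_nonneg_of_le (fun e => by have := P.logVal_nonneg e; positivity)
    (fun e => ?_) h1
  have hη : 0 < (σ - 1) / 2 := by linarith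
  have h2 : P.logVal e ≤ ((σ - 1) / 2)⁻¹ * Real.exp ((σ - 1) / 2 * P.logVal e) := by
    rw [le_inv_mul_iff₀ hη]
    linarith [Real.add_one_le_exp ((σ - 1) / 2 * P.logVal e)]
  calc P.logVal e * Real.exp (-σ * P.logVal e) ≤
        ((σ - 1) / 2)⁻¹ * Real.exp ((σ - 1) / 2 * P.logVal e) * Real.exp (-σ * P.logVal e) := by
        gcongr
    _ = _ := by rw [mul_assoc, ← Real.exp_add]; ring_nf

/-- The exponent vector of the prime power with index `i` and exponent `k + 1`. -/
noncomputable def primePower (q : ℕ × ℕ) : ℕ →₀ ℕ := Finsupp.single q.1 (q.2 + 1)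

theorem primePower_injective : Function.Injective primePower := by
  rintro ⟨i, k⟩ ⟨j, l⟩ h
  simp only [primePower] at h
  rw [Finsupp.single_eq_single_iff] at h
  simp at h
  simp [h]

theorem log_p_le (P : BeurlingSystem) (q : ℕ × ℕ) :
    Real.log (P.p q.1) ≤ P.logVal (primePower q) := by
  rw [primePower, logVal_single]
  have := Real.log_nonneg (P.one_lt_p q.1).le
  push_cast
  nlinarith [(Nat.cast_nonneg q.2 : (0 : ℝ) ≤ q.2)]

theorem summable_primePower (P : BeurlingSystem) (hP : P.abscissa = 1) {σ : ℝ} (hσ : 1 < σ) :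
    Summable fun q => Real.log (P.p q.1) * Real.exp (-σ * P.logVal (primePower q)) := by
  refine Summable.of_nonneg_of_le (fun q => ?_) (fun q => ?_)
    ((P.summable_logVal_mul_exp hP hσ).comp_injective primePower_injective)
  · have := Real.log_nonneg (P.one_lt_p q.1).le
    positivity
  · exact mul_le_mul_of_nonneg_right (P.log_p_le q) (Real.exp_nonneg _)

/-- The term `n ^ (-s)` of the zeta function. -/
noncomputable def term (P : BeurlingSystem) (s : ℂ) (e : ℕ →₀ ℕ) : ℂ :=
  Complex.exp (-s * P.logVal e)

theorem norm_term (P : BeurlingSystem) (s : ℂ) (e : ℕ →₀ ℕ) :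
    ‖P.term s e‖ = Real.exp (-s.re * P.logVal e) := by
  simp [term, Complex.norm_exp]

theorem term_add (P : BeurlingSystem) (s : ℂ) (e f : ℕ →₀ ℕ) :
    P.term s (e + f) = P.term s e * P.term s f := by
  rw [term, logVal_add, term, term, ← Complex.exp_add]
  push_cast; ring_nf

theorem summable_norm_term (P : BeurlingSystem) (hP : P.abscissa = 1) {s : ℂ} (hs : 1 < s.re) :
    Summable fun e => ‖P.term s e‖ := by
  simp_rw [norm_term]; exact P.summable_exp hP hs

/-- The zeta function `∑ n ^ (-s)`. -/
noncomputable def zeta (P : BeurlingSystem) (s : ℂ) : ℂ := ∑' e, P.term s e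

/-- The Dirichlet series of the Möbius function. -/
noncomputable def moebiusSeries (P : BeurlingSystem) (s : ℂ) : ℂ :=
  ∑' e, (moebius e : ℂ) * P.term s e

/-- The Dirichlet series of the von Mangoldt function. -/
noncomputable def mangoldtSeries (P : BeurlingSystem) (s : ℂ) : ℂ :=
  ∑' q, (Real.log (P.p q.1) : ℂ) * P.term s (primePower q)

theorem abs_moebius_le (e : ℕ →₀ ℕ) : |moebius e| ≤ 1 := by
  unfold moebius
  split_ifs <;> simp

theorem norm_moebius_le (e : ℕ →₀ ℕ) : ‖(moebius e : ℂ)‖ ≤ 1 := by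
  rw [Complex.norm_intCast]
  exact_mod_cast abs_moebius_le e

theorem summable_norm_moebius_mul_term (P : BeurlingSystem) (hP : P.abscissa = 1) {s : ℂ}
    (hs : 1 < s.re) : Summable fun e => ‖(moebius e : ℂ) * P.term s e‖ := by
  refine Summable.of_nonneg_of_le (fun _ => norm_nonneg _) (fun e => ?_)
    (P.summable_norm_term hP hs)
  rw [norm_mul]
  exact mul_le_of_le_one_left (norm_nonneg _) (norm_moebius_le e)

theorem summable_norm_mangoldt (P : BeurlingSystem) (hP : P.abscissa = 1) {s : ℂ}
    (hs : 1 < s.re) :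
    Summable fun q => ‖(Real.log (P.p q.1) : ℂ) * P.term s (primePower q)‖ := by
  refine (P.summable_primePower hP hs).congr fun q => ?_
  rw [norm_mul, norm_term, Complex.norm_of_nonneg (Real.log_nonneg (P.one_lt_p q.1).le)]

/-- The squarefree divisors of `e` correspond to the subsets of its support, and the alternating sum
over subsets vanishes unless the support is empty. -/
theorem sum_antidiagonal_moebius (e : ℕ →₀ ℕ) :
    ∑ q ∈ Finset.HasAntidiagonal.antidiagonal e, moebius q.1 = if e = 0 then 1 else 0 := by
  classical
  have h1 : ∑ q ∈ Finset.HasAntidiagonal.antidiagonal e, moebius q.1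
      = ∑ S ∈ e.support.powerset, (-1 : ℤ) ^ S.card := by
    unfold moebius
    rw [← Finset.sum_filter]
    have hle : ∀ S ∈ e.support.powerset, Finsupp.indicator S (fun _ _ => 1) ≤ e := by
      intro S hS i
      by_cases hi : i ∈ S
      · have := Finset.mem_powerset.mp hS hi
        rw [Finsupp.mem_support_iff] at this
        simp [Finsupp.indicator_apply, hi]; omega
      · simp [Finsupp.indicator_apply, hi]
    refine Finset.sum_nbij' (fun q => q.1.support)
      (fun S => (Finsupp.indicator S (fun _ _ => 1), e - Finsupp.indicator S (fun _ _ => 1)))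
      ?_ ?_ ?_ ?_ ?_
    · rintro ⟨f, g⟩ h
      simp only [Finset.mem_filter, Finset.HasAntidiagonal.mem_antidiagonal] at h
      rw [Finset.mem_powerset, ← h.1]
      intro i hi
      rw [Finsupp.mem_support_iff] at hi ⊢
      simp only [Finsupp.add_apply] at hi ⊢; omega
    · intro S hS
      simp only [Finset.mem_filter, Finset.HasAntidiagonal.mem_antidiagonal]
      refine ⟨add_tsub_cancel_of_le (hle S hS), fun i hi => ?_⟩
      rw [Finsupp.mem_support_iff, Finsupp.indicator_apply] at hi
      rw [Finsupp.indicator_apply]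
      split_ifs at hi ⊢ <;> simp_all
    · rintro ⟨f, g⟩ h
      simp only [Finset.mem_filter, Finset.HasAntidiagonal.mem_antidiagonal] at h
      have hf : Finsupp.indicator f.support (fun _ _ => 1) = f := by
        ext i
        by_cases hi : i ∈ f.support
        · simp only [Finsupp.indicator_apply, dif_pos hi]; exact (h.2 i hi).symm
        · simp only [Finsupp.indicator_apply, dif_neg hi]
          exact (Finsupp.notMem_support_iff.mp hi).symm
      simp only [hf, ← h.1, add_tsub_cancel_left]
    · intro S hS
      ext i
      by_cases hi : i ∈ S <;> simp [Finsupp.indicator_apply, hi]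
    · intro q _; rfl
  rw [h1, Finset.sum_powerset_neg_one_pow_card]
  simp

theorem zeta_mul_moebiusSeries (P : BeurlingSystem) (hP : P.abscissa = 1) {s : ℂ}
    (hs : 1 < s.re) : P.zeta s * P.moebiusSeries s = 1 := by
  have h1 := P.summable_norm_moebius_mul_term hP hs
  have h2 := P.summable_norm_term hP hs
  have h1' := h1.of_norm
  have h2' := h2.of_norm
  have h5 := summable_mul_of_summable_norm h1 h2
  rw [mul_comm, zeta, moebiusSeries, h1'.tsum_mul_tsum_eq_tsum_sum_antidiagonal h2' h5]
  have h3 : ∀ e : ℕ →₀ ℕ, ∑ q ∈ Finset.HasAntidiagonal.antidiagonal e,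
      (moebius q.1 : ℂ) * P.term s q.1 * P.term s q.2 = if e = 0 then 1 else 0 := by
    intro e
    have h4 : ∀ q ∈ Finset.HasAntidiagonal.antidiagonal e,
        (moebius q.1 : ℂ) * P.term s q.1 * P.term s q.2 = (moebius q.1 : ℂ) * P.term s e := by
      intro q hq
      rw [mul_assoc, ← term_add, Finset.HasAntidiagonal.mem_antidiagonal.mp hq]
    rw [Finset.sum_congr rfl h4, ← Finset.sum_mul, ← Int.cast_sum, sum_antidiagonal_moebius]
    split_ifs with h
    · simp [h, term, logVal_zero]
    · simp
  simp_rw [h3]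
  simp

/-- The pairs `(i, k)` with `k < e i`. -/
noncomputable def primePowerDivisors (e : ℕ →₀ ℕ) : Finset (ℕ × ℕ) :=
  e.support.biUnion fun i => (Finset.range (e i)).map ⟨fun k => (i, k), fun _ _ h => by simpa using h⟩

theorem mem_primePowerDivisors {e : ℕ →₀ ℕ} {q : ℕ × ℕ} :
    q ∈ primePowerDivisors e ↔ q.2 < e q.1 := by
  simp only [primePowerDivisors, Finset.mem_biUnion, Finset.mem_map, Finset.mem_range,
    Finsupp.mem_support_iff]
  constructor
  · rintro ⟨i, _, k, hk, rfl⟩; exact hk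
  · exact fun h => ⟨q.1, by omega, q.2, h, rfl⟩

theorem sum_primePowerDivisors (P : BeurlingSystem) (e : ℕ →₀ ℕ) :
    ∑ q ∈ primePowerDivisors e, Real.log (P.p q.1) = P.logVal e := by
  rw [logVal_eq_sum, Finset.sum_finset_product _ e.support fun i => Finset.range (e i)]
  · simp
  · intro q
    rw [mem_primePowerDivisors, Finset.mem_range, Finsupp.mem_support_iff]
    omega

/-- A pair of a prime power and a cofactor with given product is a prime power divisor. -/
noncomputable def fiberEquiv (e : ℕ →₀ ℕ) :
    (fun b : (ℕ × ℕ) × (ℕ →₀ ℕ) => b.2 + primePower b.1) ⁻¹' {e} ≃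
      {q // q ∈ primePowerDivisors e} where
  toFun b := ⟨b.1.1, by
    have h : b.1.2 + primePower b.1.1 = e := b.2
    have h' := congrArg (fun f : ℕ →₀ ℕ => f b.1.1.1) h
    simp [primePower] at h'
    rw [mem_primePowerDivisors]
    omega⟩
  invFun q := ⟨(q.1, e - primePower q.1), by
    have h := mem_primePowerDivisors.mp q.2
    refine tsub_add_cancel_of_le (Finsupp.single_le_iff.mpr h)⟩
  left_inv b := by
    have h : b.1.2 + primePower b.1.1 = e := b.2
    apply Subtype.ext
    apply Prod.ext
    · rfl
    · simp [← h]
  right_inv q := rfl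

/-- The absolutely convergent product is regrouped by the value of prime power times cofactor, and
`log n` is the sum of `log p` over the prime powers dividing `n`. As the left side is the series of
`-ζ'`, this identifies the von Mangoldt series with `-ζ'/ζ`. -/
theorem hasSum_logVal_mul_term (P : BeurlingSystem) (hP : P.abscissa = 1) {s : ℂ}
    (hs : 1 < s.re) :
    HasSum (fun e => (P.logVal e : ℂ) * P.term s e) (P.mangoldtSeries s * P.zeta s) := by
  have h1 := P.summable_norm_mangoldt hP hs
  have h2 := P.summable_norm_term hP hs
  have h1' := h1.of_norm
  have h2' := h2.of_norm
  have h0 := summable_mul_of_summable_norm h1 h2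
  have h3 := h1'.hasSum.mul h2'.hasSum h0
  have h4 := h3.tsum_fiberwise (fun b : (ℕ × ℕ) × (ℕ →₀ ℕ) => b.2 + primePower b.1)
  rw [mangoldtSeries, zeta]
  refine h4.congr_fun fun e => ?_
  symm
  have h5 : ∀ b : (fun b : (ℕ × ℕ) × (ℕ →₀ ℕ) => b.2 + primePower b.1) ⁻¹' {e},
      (Real.log (P.p b.1.1.1) : ℂ) * P.term s (primePower b.1.1) * P.term s b.1.2
        = (fun q : {q // q ∈ primePowerDivisors e} => (Real.log (P.p q.1.1) : ℂ) * P.term s e)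
          (fiberEquiv e b) := by
    intro b
    have h : b.1.2 + primePower b.1.1 = e := b.2
    change _ = (Real.log (P.p b.1.1.1) : ℂ) * P.term s e
    rw [mul_assoc, ← term_add, add_comm, h]
  rw [tsum_congr h5, (fiberEquiv e).tsum_eq
    (fun q : {q // q ∈ primePowerDivisors e} => (Real.log (P.p q.1.1) : ℂ) * P.term s e),
    Finset.tsum_subtype (primePowerDivisors e) fun q => (Real.log (P.p q.1) : ℂ) * P.term s e,
    ← Finset.sum_mul, ← sum_primePowerDivisors]
  push_cast
  rfl

theorem deriv_zeta (P : BeurlingSystem) (hP : P.abscissa = 1) {s : ℂ} (hs : 1 < s.re) :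
    deriv P.zeta s = -(P.mangoldtSeries s * P.zeta s) := by
  obtain ⟨a, ha1, ha2⟩ := exists_between hs
  have h1 := Complex.hasSum_deriv_of_summable_norm (F := fun e s => P.term s e)
    (U := {s | a < s.re}) (P.summable_exp hP ha1)
    (fun e => by unfold term; fun_prop) (isOpen_halfPlane a)
    (fun e w hw => by
      rw [norm_term]
      refine Real.exp_le_exp.mpr ?_
      have := P.logVal_nonneg e
      have hw' : a < w.re := hw
      nlinarith) (z := s) ha2
  have h2 := (P.hasSum_logVal_mul_term hP hs).neg
  refine h1.unique (h2.congr_fun fun e => ?_)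
  have h3 : HasDerivAt (fun s => P.term s e) (Complex.exp (-s * P.logVal e) * (-1 * P.logVal e)) s :=
    ((hasDerivAt_neg s).mul_const (P.logVal e : ℂ)).cexp
  rw [h3.deriv, term]; ring

end BeurlingSystem

/-! ### Summatory functions and their Laplace transforms -/

/-- Rankin's trick: a term that counts at `u` has `l i ≤ u`, so `1 ≤ exp (σ * (u - l i))`. -/
theorem norm_tsum_stepAt_le {ι : Type*} {a : ι → ℂ} {l : ι → ℝ} {σ : ℝ} (hσ : 0 ≤ σ)
    (hsum : Summable fun i => ‖a i‖ * Real.exp (-σ * l i)) (u : ℝ) :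
    ‖∑' i, a i * stepAt (l i) u‖ ≤ (∑' i, ‖a i‖ * Real.exp (-σ * l i)) * Real.exp (σ * u) := by
  refine tsum_of_norm_bounded (hsum.hasSum.mul_right _) fun i => ?_
  rw [norm_mul, mul_assoc]
  gcongr
  by_cases h : u ∈ Set.Ici (l i)
  · simp only [stepAt, Set.indicator_of_mem h, norm_one]
    rw [← Real.exp_add]
    refine Real.one_le_exp ?_
    have : l i ≤ u := h
    nlinarith
  · simp only [stepAt, Set.indicator_of_notMem h, norm_zero]
    positivity

theorem expBound_tsum_stepAt {ι : Type*} {a : ι → ℂ} {l : ι → ℝ} {σ : ℝ} (hσ : 0 ≤ σ)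
    (hl : ∀ i, 0 ≤ l i) (hsum : Summable fun i => ‖a i‖ * Real.exp (-σ * l i)) {F : ℝ → ℂ}
    (hF : Measurable F) (h : ∀ u, F u = ∑' i, a i * stepAt (l i) u) :
    ExpBound F σ (∑' i, ‖a i‖ * Real.exp (-σ * l i)) where
  measurable := hF
  eq_zero u hu := by
    have : ∀ i, a i * stepAt (l i) u = 0 := fun i => by
      have : u ∉ Set.Ici (l i) := by
        have := hl i
        simp only [Set.mem_Ici, not_le]; linarith
      simp [stepAt, this]
    rw [h]
    simp [this]
  bound u _ := by rw [h]; exact norm_tsum_stepAt_le hσ hsum u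

/-- The asymptotic bound applies beyond some `U`; on `[0, U]` the crude exponential bound is a
constant, absorbed because `θ ≥ 0`. -/
theorem expBound_of_isBigO {f : ℝ → ℝ} {σ C θ ρ : ℝ}
    (hE : ExpBound (fun u => (f (Real.exp u) : ℂ)) σ C) (hσ : 0 ≤ σ) (hθ : 0 ≤ θ)
    (hO : (fun x => f x - ρ * x) =O[atTop] fun x : ℝ => x ^ θ) :
    ∃ C', ExpBound (fun u => (f (Real.exp u) : ℂ) - ρ * truncExp u) θ C' := by
  obtain ⟨c, hc0, hc⟩ := hO.exists_nonneg
  obtain ⟨X, hX⟩ := eventually_atTop.mp hc.bound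
  set U := max (Real.log (max X 1)) 0 with hU
  have hXU : X ≤ Real.exp U := by
    calc X ≤ max X 1 := le_max_left _ _
      _ = Real.exp (Real.log (max X 1)) := (Real.exp_log (by positivity)).symm
      _ ≤ Real.exp U := Real.exp_le_exp.mpr (le_max_left _ _)
  have hC := hE.const_nonneg
  refine ⟨c + (C * Real.exp (σ * U) + |ρ| * Real.exp U), ?_, fun u hu => ?_, fun u hu => ?_⟩
  · have h1 := hE.measurable
    have h2 : Measurable fun u => (ρ : ℂ) * truncExp u := (expBound_truncExp (ρ : ℂ)).measurable
    exact h1.sub h2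
  · have := hE.eq_zero u hu
    rw [this, truncExp_of_neg hu]; simp
  · have hone : 1 ≤ Real.exp (θ * u) := Real.one_le_exp (by positivity)
    have hB : 0 ≤ C * Real.exp (σ * U) + |ρ| * Real.exp U := by positivity
    rw [truncExp_of_nonneg hu]
    rcases le_total U u with h | h
    · have h1 := hX (Real.exp u) (hXU.trans (Real.exp_le_exp.mpr h))
      rw [← Real.exp_mul, Real.norm_of_nonneg (Real.exp_nonneg _)] at h1
      rw [← Complex.ofReal_mul, ← Complex.ofReal_sub, Complex.norm_real, mul_comm θ u]
      refine h1.trans ?_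
      gcongr
      linarith
    · have h1 := hE.bound u hu
      calc ‖(f (Real.exp u) : ℂ) - ρ * (Real.exp u : ℂ)‖
          ≤ ‖(f (Real.exp u) : ℂ)‖ + ‖(ρ : ℂ) * (Real.exp u : ℂ)‖ := norm_sub_le _ _
        _ ≤ C * Real.exp (σ * U) + |ρ| * Real.exp U := by
            rw [norm_mul, Complex.norm_real ρ, Complex.norm_of_nonneg (Real.exp_nonneg u),
              Real.norm_eq_abs]
            refine add_le_add (h1.trans ?_) ?_ <;> gcongr
        _ ≤ (C * Real.exp (σ * U) + |ρ| * Real.exp U) * Real.exp (θ * u) :=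
            le_mul_of_one_le_right hB hone
        _ ≤ _ := mul_le_mul_of_nonneg_right (by linarith) (Real.exp_nonneg _)

theorem isBigO_of_abs_sub_exp_le {f : ℝ → ℝ} {C θ ρ : ℝ}
    (h : ∀ u, 1 ≤ u → |f (Real.exp u) - ρ * Real.exp u| ≤ C * Real.exp (θ * u)) :
    (fun x => f x - ρ * x) =O[atTop] fun x : ℝ => x ^ θ := by
  refine IsBigO.of_bound C ?_
  filter_upwards [eventually_ge_atTop (Real.exp 1)] with x hx
  have hx0 : 0 < x := (Real.exp_pos 1).trans_le hx
  have := h (Real.log x) ((Real.le_log_iff_exp_le hx0).mpr hx)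
  rw [Real.exp_log hx0] at this
  rwa [Real.norm_eq_abs, Real.norm_of_nonneg (Real.rpow_nonneg hx0.le _),
    Real.rpow_def_of_pos hx0, mul_comm (Real.log x)]

namespace BeurlingSystem

theorem mem_integersLE (P : BeurlingSystem) {x : ℝ} {e : ℕ →₀ ℕ} :
    e ∈ P.integersLE x ↔ P.val e ≤ x := by
  simp [integersLE]

theorem mem_primePowersLE (P : BeurlingSystem) {x : ℝ} {q : ℕ × ℕ} :
    q ∈ P.primePowersLE x ↔ 1 ≤ q.2 ∧ P.p q.1 ^ q.2 ≤ x := by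
  simp [primePowersLE]

theorem stepAt_logVal (P : BeurlingSystem) (e : ℕ →₀ ℕ) (u : ℝ) :
    stepAt (P.logVal e) u = if P.val e ≤ Real.exp u then 1 else 0 := by
  simp only [stepAt, Set.indicator_apply, Set.mem_Ici, logVal_le_iff]

theorem sum_integersLE (P : BeurlingSystem) (a : (ℕ →₀ ℕ) → ℂ) (u : ℝ) :
    ∑ e ∈ P.integersLE (Real.exp u), a e = ∑' e, a e * stepAt (P.logVal e) u := by
  rw [tsum_eq_sum (s := P.integersLE (Real.exp u))]
  · refine Finset.sum_congr rfl fun e he => ?_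
    rw [stepAt_logVal, if_pos (P.mem_integersLE.mp he), mul_one]
  · intro e he
    rw [stepAt_logVal, if_neg (fun h => he (P.mem_integersLE.mpr h)), mul_zero]

theorem N_exp (P : BeurlingSystem) (u : ℝ) :
    (P.N (Real.exp u) : ℂ) = ∑' e, (1 : ℂ) * stepAt (P.logVal e) u := by
  rw [← sum_integersLE, N]
  push_cast; rfl

theorem M_exp (P : BeurlingSystem) (u : ℝ) :
    (P.M (Real.exp u) : ℂ) = ∑' e, (moebius e : ℂ) * stepAt (P.logVal e) u := by
  rw [← sum_integersLE, M]
  push_cast; rfl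

theorem val_primePower (P : BeurlingSystem) (q : ℕ × ℕ) :
    P.val (primePower q) = P.p q.1 ^ (q.2 + 1) := by
  rw [primePower, val, Finsupp.prod_single_index (by simp)]

theorem psi_exp (P : BeurlingSystem) (u : ℝ) :
    (P.psi (Real.exp u) : ℂ) =
      ∑' q, (Real.log (P.p q.1) : ℂ) * stepAt (P.logVal (primePower q)) u := by
  classical
  -- `primePowersLE` records exponents `k ≥ 1`, whereas `primePower (i, k)` has exponent `k + 1`;
  -- hence the shift by one.
  set S := (P.primePowersLE (Real.exp u)).image fun q => (q.1, q.2 - 1) with hS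
  have hmem : ∀ q : ℕ × ℕ, q ∈ S ↔ P.val (primePower q) ≤ Real.exp u := by
    intro q
    rw [val_primePower, hS, Finset.mem_image]
    constructor
    · rintro ⟨r, hr, rfl⟩
      obtain ⟨h1, h2⟩ := P.mem_primePowersLE.mp hr
      simpa [Nat.sub_add_cancel h1] using h2
    · exact fun h => ⟨(q.1, q.2 + 1), P.mem_primePowersLE.mpr ⟨by simp, h⟩, by simp⟩
  rw [tsum_eq_sum (s := S), psi, hS, Finset.sum_image]
  · push_cast
    refine Finset.sum_congr rfl fun q hq => ?_
    have : (q.1, q.2 - 1) ∈ S := by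
      rw [hS]
      exact Finset.mem_image_of_mem (fun q : ℕ × ℕ => (q.1, q.2 - 1)) hq
    rw [stepAt_logVal, if_pos ((hmem _).mp this), mul_one]
  · rintro ⟨i, k⟩ hq ⟨j, l⟩ hr h
    have h1 := (P.mem_primePowersLE.mp hq).1
    have h2 := (P.mem_primePowersLE.mp hr).1
    simp only [Prod.mk.injEq] at h ⊢ h1 h2
    omega
  · intro q hq
    rw [stepAt_logVal, if_neg (fun h => hq ((hmem q).mpr h)), mul_zero]

theorem integersLE_mono (P : BeurlingSystem) {x y : ℝ} (h : x ≤ y) :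
    P.integersLE x ⊆ P.integersLE y := fun _ he =>
  P.mem_integersLE.mpr ((P.mem_integersLE.mp he).trans h)

theorem monotone_N (P : BeurlingSystem) : Monotone P.N := fun _ _ h =>
  Finset.sum_le_sum_of_subset_of_nonneg (P.integersLE_mono h) fun _ _ _ => zero_le_one

/-- The coefficients `1 + μ` are nonnegative. This makes `M` accessible to a Tauberian theorem for
monotone functions, and also gives its measurability. -/
theorem monotone_N_add_M (P : BeurlingSystem) : Monotone fun x => P.N x + P.M x := by
  intro x y h
  simp only [N, M, ← Finset.sum_add_distrib]
  refine Finset.sum_le_sum_of_subset_of_nonneg (P.integersLE_mono h) fun e _ _ => ?_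
  have := (abs_le.mp (abs_moebius_le e)).1
  have h2 : (-1 : ℝ) ≤ (moebius e : ℝ) := by exact_mod_cast this
  linarith

theorem monotone_psi (P : BeurlingSystem) : Monotone P.psi := fun _ _ h =>
  Finset.sum_le_sum_of_subset_of_nonneg
    (fun q hq => by
      rw [mem_primePowersLE] at hq ⊢
      exact ⟨hq.1, hq.2.trans h⟩)
    fun q _ _ => Real.log_nonneg (P.one_lt_p q.1).le

theorem exists_N_eq_int (P : BeurlingSystem) (x : ℝ) : ∃ n : ℤ, P.N x = n :=
  ⟨(P.integersLE x).card, by simp [N]⟩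

theorem measurable_M (P : BeurlingSystem) : Measurable P.M := by
  have h : P.M = fun x => (P.N x + P.M x) - P.N x := by ext x; simp
  rw [h]
  exact P.monotone_N_add_M.measurable.sub P.monotone_N.measurable

theorem summable_one (P : BeurlingSystem) (hP : P.abscissa = 1) {σ : ℝ} (hσ : 1 < σ) :
    Summable fun e => ‖(1 : ℂ)‖ * Real.exp (-σ * P.logVal e) := by
  simpa using P.summable_exp hP hσ

theorem summable_moebius (P : BeurlingSystem) (hP : P.abscissa = 1) {σ : ℝ} (hσ : 1 < σ) :
    Summable fun e => ‖(moebius e : ℂ)‖ * Real.exp (-σ * P.logVal e) :=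
  Summable.of_nonneg_of_le (fun e => by positivity)
    (fun e => mul_le_of_le_one_left (Real.exp_nonneg _) (norm_moebius_le e)) (P.summable_exp hP hσ)

theorem summable_log (P : BeurlingSystem) (hP : P.abscissa = 1) {σ : ℝ} (hσ : 1 < σ) :
    Summable fun q =>
      ‖(Real.log (P.p q.1) : ℂ)‖ * Real.exp (-σ * P.logVal (primePower q)) := by
  refine (P.summable_primePower hP hσ).congr fun q => ?_
  rw [Complex.norm_of_nonneg (Real.log_nonneg (P.one_lt_p q.1).le)]

theorem expBound_N (P : BeurlingSystem) (hP : P.abscissa = 1) {σ : ℝ} (hσ : 1 < σ) :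
    ∃ C, ExpBound (fun u => (P.N (Real.exp u) : ℂ)) σ C :=
  ⟨_, expBound_tsum_stepAt (by linarith) P.logVal_nonneg (P.summable_one hP hσ)
    (Complex.measurable_ofReal.comp (P.monotone_N.measurable.comp Real.measurable_exp)) P.N_exp⟩

theorem expBound_M (P : BeurlingSystem) (hP : P.abscissa = 1) {σ : ℝ} (hσ : 1 < σ) :
    ∃ C, ExpBound (fun u => (P.M (Real.exp u) : ℂ)) σ C :=
  ⟨_, expBound_tsum_stepAt (by linarith) P.logVal_nonneg (P.summable_moebius hP hσ)
    (Complex.measurable_ofReal.comp (P.measurable_M.comp Real.measurable_exp)) P.M_exp⟩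

theorem expBound_psi (P : BeurlingSystem) (hP : P.abscissa = 1) {σ : ℝ} (hσ : 1 < σ) :
    ∃ C, ExpBound (fun u => (P.psi (Real.exp u) : ℂ)) σ C :=
  ⟨_, expBound_tsum_stepAt (by linarith) (fun q => P.logVal_nonneg _) (P.summable_log hP hσ)
    (Complex.measurable_ofReal.comp (P.monotone_psi.measurable.comp Real.measurable_exp))
    P.psi_exp⟩

theorem laplace_N (P : BeurlingSystem) (hP : P.abscissa = 1) {s : ℂ} (hs : 1 < s.re) :
    laplace (fun u => (P.N (Real.exp u) : ℂ)) s = P.zeta s / s := by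
  rw [funext P.N_exp, laplace_tsum_stepAt _ _ P.logVal_nonneg (by linarith)
    (P.summable_one hP hs)]
  simp only [one_mul]
  rfl

theorem laplace_M (P : BeurlingSystem) (hP : P.abscissa = 1) {s : ℂ} (hs : 1 < s.re) :
    laplace (fun u => (P.M (Real.exp u) : ℂ)) s = P.moebiusSeries s / s := by
  rw [funext P.M_exp, laplace_tsum_stepAt _ _ P.logVal_nonneg (by linarith)
    (P.summable_moebius hP hs)]
  rfl

theorem laplace_psi (P : BeurlingSystem) (hP : P.abscissa = 1) {s : ℂ} (hs : 1 < s.re) :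
    laplace (fun u => (P.psi (Real.exp u) : ℂ)) s = P.mangoldtSeries s / s := by
  rw [funext P.psi_exp, laplace_tsum_stepAt _ _ (fun q => P.logVal_nonneg _) (by linarith)
    (P.summable_log hP hs)]
  rfl

/-- `zeta` is bounded above and below on `2 ≤ re s`. -/
theorem exists_zeta_bounds (P : BeurlingSystem) (hP : P.abscissa = 1) :
    ∃ B, ∀ s : ℂ, 2 ≤ s.re → ‖P.zeta s‖ ≤ B ∧ B⁻¹ ≤ ‖P.zeta s‖ := by
  have h2 := P.summable_exp hP (σ := 2) (by norm_num)
  set B := ∑' e, Real.exp (-2 * P.logVal e) with hB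
  have hterm : ∀ s : ℂ, 2 ≤ s.re → ∀ e, ‖P.term s e‖ ≤ Real.exp (-2 * P.logVal e) := by
    intro s hs e
    rw [norm_term]
    refine Real.exp_le_exp.mpr ?_
    have := P.logVal_nonneg e
    nlinarith
  refine ⟨B, fun s hs => ?_⟩
  have hz : ‖P.zeta s‖ ≤ B := tsum_of_norm_bounded h2.hasSum (hterm s hs)
  -- The lower bound for `ζ` is an upper bound for `1 / ζ`, whose series has the same majorant.
  have hm : ‖P.moebiusSeries s‖ ≤ B := tsum_of_norm_bounded h2.hasSum fun e => by
    rw [norm_mul]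
    exact (mul_le_of_le_one_left (norm_nonneg _) (norm_moebius_le e)).trans (hterm s hs e)
  have hone : ‖P.zeta s‖ * ‖P.moebiusSeries s‖ = 1 := by
    rw [← norm_mul, P.zeta_mul_moebiusSeries hP (by linarith), norm_one]
  refine ⟨hz, ?_⟩
  have hB0 : 0 < B := by
    by_contra h
    have h1 : ‖P.zeta s‖ = 0 := le_antisymm (hz.trans (not_lt.mp h)) (norm_nonneg _)
    rw [h1, zero_mul] at hone
    exact zero_ne_one hone
  rw [inv_le_iff_one_le_mul₀ hB0, ← hone]
  gcongr

end BeurlingSystem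

/-! ### Analytic continuation from error terms -/

theorem eq_of_eq_of_one_lt_re {f g : ℂ → ℂ} {θ : ℝ} (hf : DifferentiableOn ℂ f {s | θ < s.re})
    (hg : DifferentiableOn ℂ g {s | θ < s.re}) (h : ∀ s : ℂ, 1 < s.re → f s = g s) {s : ℂ}
    (hs : θ < s.re) : f s = g s := by
  have hconv : IsPreconnected {s : ℂ | θ < s.re} := (convex_halfSpace_re_gt θ).isPreconnected
  have hz : (max θ 1 + 1 : ℂ) ∈ {s : ℂ | θ < s.re} := by
    have := le_max_left θ 1
    simp only [Set.mem_ofPred_eq, Complex.add_re, Complex.ofReal_re, Complex.one_re]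
    linarith
  refine (hf.analyticOnNhd (isOpen_halfPlane θ)).eqOn_of_preconnected_of_eventuallyEq
    (hg.analyticOnNhd (isOpen_halfPlane θ)) hconv hz ?_ hs
  refine Filter.eventually_of_mem ((isOpen_halfPlane 1).mem_nhds ?_) h
  have := le_max_right θ 1
  simp only [Set.mem_ofPred_eq, Complex.add_re, Complex.ofReal_re, Complex.one_re]
  linarith

theorem norm_le_mul_abs_im {s : ℂ} (h0 : 0 ≤ s.re) (h6 : s.re ≤ 6) (h1 : 1 ≤ |s.im|) :
    ‖s‖ ≤ 7 * |s.im| := by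
  have := Complex.norm_le_abs_re_add_abs_im s
  rw [abs_of_nonneg h0] at this
  linarith

theorem norm_div_sub_one_le {s : ℂ} (h0 : 0 ≤ s.re) (h6 : s.re ≤ 6) (h1 : 1 ≤ |s.im|) :
    ‖s / (s - 1)‖ ≤ 7 := by
  have h2 : |s.im| ≤ ‖s - 1‖ := by simpa using Complex.abs_im_le_norm (s - 1)
  rw [norm_div, div_le_iff₀ (by linarith)]
  linarith [norm_le_mul_abs_im h0 h6 h1]

theorem ne_one_of_one_le_abs_im {s : ℂ} (h1 : 1 ≤ |s.im|) : s ≠ 1 := by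
  rintro rfl
  norm_num at h1

theorem SubpolyGrowth.add {H₁ H₂ : ℂ → ℂ} {θ : ℝ} (h₁ : SubpolyGrowth H₁ θ)
    (h₂ : SubpolyGrowth H₂ θ) : SubpolyGrowth (fun s => H₁ s + H₂ s) θ := by
  intro ε hε
  obtain ⟨C₁, T₁, hC₁⟩ := h₁ ε hε
  obtain ⟨C₂, T₂, hC₂⟩ := h₂ ε hε
  refine ⟨C₁ + C₂, max T₁ T₂, fun s h1 h2 h3 => ?_⟩
  rw [add_mul]
  exact (norm_add_le _ _).trans (add_le_add (hC₁ s h1 h2 ((le_max_left _ _).trans h3))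
    (hC₂ s h1 h2 ((le_max_right _ _).trans h3)))

theorem SubpolyGrowth.neg {H : ℂ → ℂ} {θ : ℝ} (h : SubpolyGrowth H θ) :
    SubpolyGrowth (fun s => -H s) θ := by
  simpa [SubpolyGrowth] using h

/-- The polar term `s / (s - 1)` is bounded by `7` in the strip at height at least `1`, so removing
it does not affect growth. -/
theorem SubpolyGrowth.sub_pole {Z E : ℂ → ℂ} {θ : ℝ} {c : ℂ} (hZ : SubpolyGrowth Z θ) (hθ : 0 ≤ θ)
    (h : ∀ s, θ < s.re → s ≠ 1 → E s = Z s - c * (s / (s - 1))) : SubpolyGrowth E θ := by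
  intro ε hε
  obtain ⟨C, T, hC⟩ := hZ ε hε
  refine ⟨C + ‖c‖ * 7, max T 1, fun s h1 h2 h3 => ?_⟩
  have him : 1 ≤ |s.im| := (le_max_right _ _).trans h3
  rw [h s (by linarith) (ne_one_of_one_le_abs_im him), add_mul]
  refine (norm_sub_le _ _).trans (add_le_add (hC s h1 h2 ((le_max_left _ _).trans h3)) ?_)
  rw [norm_mul]
  refine (mul_le_mul_of_nonneg_left (norm_div_sub_one_le (by linarith) (by linarith) him)
    (norm_nonneg _)).trans (le_mul_of_one_le_right (by positivity) ?_)
  exact Real.one_le_rpow him hε.le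

/-- The continuation of the Mellin transform of `f x - ρ x`. -/
noncomputable def mellinRemainder (f : ℝ → ℝ) (ρ : ℝ) (s : ℂ) : ℂ :=
  s * laplace (fun u => (f (Real.exp u) : ℂ) - ρ * truncExp u) s

section Remainder

variable {f : ℝ → ℝ} {ρ θ C : ℝ}

theorem differentiableOn_mellinRemainder
    (h : ExpBound (fun u => (f (Real.exp u) : ℂ) - ρ * truncExp u) θ C) :
    DifferentiableOn ℂ (mellinRemainder f ρ) {s | θ < s.re} :=
  differentiableOn_id.mul h.differentiableOn_laplace

/-- The transform is bounded on `θ + ε ≤ re s` and the factor `s` is linear in `|s.im|`. The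
exponent `2` is slack: only polynomial growth matters for the logarithm. -/
theorem norm_mellinRemainder_le
    (h : ExpBound (fun u => (f (Real.exp u) : ℂ) - ρ * truncExp u) θ C) (hθ : 0 < θ) {ε : ℝ}
    (hε : 0 < ε) : ∃ c, ∀ s : ℂ, θ + ε ≤ s.re → s.re ≤ 6 → 1 ≤ |s.im| →
      ‖mellinRemainder f ρ s‖ ≤ c * |s.im| ^ 2 := by
  have hC := h.const_nonneg
  refine ⟨7 * (C / ε), fun s h1 h2 h3 => ?_⟩
  have h4 := h.norm_laplace_le (a := θ + ε) (s := s) (by linarith) h1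
  rw [add_sub_cancel_left] at h4
  have h5 : |s.im| ≤ |s.im| ^ 2 := by nlinarith
  rw [mellinRemainder, norm_mul]
  calc _ ≤ 7 * |s.im| * (C / ε) :=
        mul_le_mul (norm_le_mul_abs_im (by linarith) h2 h3) h4 (norm_nonneg _) (by positivity)
    _ = 7 * (C / ε) * |s.im| := by ring
    _ ≤ _ := by gcongr

theorem eq_mellinRemainder_add {A : ℂ} {s : ℂ}
    {σ C₁ : ℝ} (hE : ExpBound (fun u => (f (Real.exp u) : ℂ)) σ C₁) (hσ : σ < s.re)
    (hs : 1 < s.re) (hA : laplace (fun u => (f (Real.exp u) : ℂ)) s = A / s) :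
    A = mellinRemainder f ρ s + ρ * (s / (s - 1)) := by
  have h0 : s ≠ 0 := by rintro rfl; norm_num at hs
  have h1 := hE.laplace_add (expBound_truncExp (-ρ : ℂ)) hσ hs
  rw [hA, laplace_const_mul, laplace_truncExp hs] at h1
  have h2 : mellinRemainder f ρ s = s * (A / s + -ρ * (1 / (s - 1))) := by
    rw [mellinRemainder, ← h1]
    congr 2; ext u; ring
  have h3 : s - 1 ≠ 0 := sub_ne_zero.mpr (by rintro rfl; norm_num at hs)
  rw [h2]
  field_simp
  ring

end Remainder

namespace BeurlingSystem

theorem zeta_eq_mellinRemainder (P : BeurlingSystem) (hP : P.abscissa = 1) (ρ : ℝ) {s : ℂ}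
    (hs : 1 < s.re) : P.zeta s = mellinRemainder P.N ρ s + ρ * (s / (s - 1)) := by
  obtain ⟨σ, h1, h2⟩ := exists_between hs
  obtain ⟨C, hC⟩ := P.expBound_N hP h1
  exact eq_mellinRemainder_add hC h2 hs (P.laplace_N hP hs)

theorem mangoldtSeries_eq_mellinRemainder (P : BeurlingSystem) (hP : P.abscissa = 1) {s : ℂ}
    (hs : 1 < s.re) : P.mangoldtSeries s = mellinRemainder P.psi 1 s + s / (s - 1) := by
  obtain ⟨σ, h1, h2⟩ := exists_between hs
  obtain ⟨C, hC⟩ := P.expBound_psi hP h1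
  simpa using eq_mellinRemainder_add (ρ := 1) hC h2 hs (P.laplace_psi hP hs)

theorem moebiusSeries_eq_mellinRemainder (P : BeurlingSystem) (hP : P.abscissa = 1) {s : ℂ}
    (hs : 1 < s.re) : P.moebiusSeries s = mellinRemainder P.M 0 s := by
  obtain ⟨σ, h1, h2⟩ := exists_between hs
  obtain ⟨C, hC⟩ := P.expBound_M hP h1
  simpa using eq_mellinRemainder_add (ρ := 0) hC h2 hs (P.laplace_M hP hs)

theorem exists_expBound_N (P : BeurlingSystem) (hP : P.abscissa = 1) {θ ρ : ℝ} (hθ : 0 ≤ θ)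
    (h : (fun x => P.N x - ρ * x) =O[atTop] fun x : ℝ => x ^ θ) :
    ∃ C, ExpBound (fun u => (P.N (Real.exp u) : ℂ) - ρ * truncExp u) θ C := by
  obtain ⟨C, hC⟩ := P.expBound_N hP one_lt_two
  exact expBound_of_isBigO hC zero_le_two hθ h

theorem exists_expBound_M (P : BeurlingSystem) (hP : P.abscissa = 1) {θ : ℝ} (hθ : 0 ≤ θ)
    (h : θ ∈ P.MExponents) :
    ∃ C, ExpBound (fun u => (P.M (Real.exp u) : ℂ) - (0 : ℝ) * truncExp u) θ C := by
  obtain ⟨C, hC⟩ := P.expBound_M hP one_lt_two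
  exact expBound_of_isBigO hC zero_le_two hθ (by simpa [MExponents] using h)

theorem exists_expBound_psi (P : BeurlingSystem) (hP : P.abscissa = 1) {θ : ℝ} (hθ : 0 ≤ θ)
    (h : θ ∈ P.psiExponents) :
    ∃ C, ExpBound (fun u => (P.psi (Real.exp u) : ℂ) - (1 : ℝ) * truncExp u) θ C := by
  obtain ⟨C, hC⟩ := P.expBound_psi hP one_lt_two
  exact expBound_of_isBigO hC zero_le_two hθ (by simpa [psiExponents] using h)

/-! ### Error terms from a continuation without zeros -/

/-- `K` continues `(s - 1) ζ(s)` to `θ < re s` without zeros, with value `ρ` at `1`. -/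
structure ZetaContinuation (P : BeurlingSystem) (K : ℂ → ℂ) (θ ρ : ℝ) : Prop where
  differentiableOn : DifferentiableOn ℂ K {s | θ < s.re}
  ne_zero : ∀ s : ℂ, θ < s.re → K s ≠ 0
  eq : ∀ s : ℂ, 1 < s.re → K s = (s - 1) * P.zeta s
  apply_one : K 1 = ρ

theorem sub_one_ne_zero {s : ℂ} (hs : 1 < s.re) : s - 1 ≠ 0 :=
  sub_ne_zero.mpr (by rintro rfl; norm_num at hs)

theorem differentiableAt_zeta (P : BeurlingSystem) (hP : P.abscissa = 1) {s : ℂ} (hs : 1 < s.re) :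
    DifferentiableAt ℂ P.zeta s := by
  obtain ⟨σ, h1, h2⟩ := exists_between hs
  obtain ⟨C, hC⟩ := P.expBound_N hP h1
  have h := (differentiableAt_id (x := s)).mul (hC.differentiableAt_laplace h2)
  refine h.congr_of_eventuallyEq ?_
  filter_upwards [(isOpen_halfPlane 1).mem_nhds hs] with z hz
  have h0 : z ≠ 0 := by
    rintro rfl
    simp only [Complex.zero_re] at hz
    linarith
  simp only [Pi.mul_apply, id]
  rw [P.laplace_N hP hz, mul_div_cancel₀ _ h0]

theorem zeta_ne_zero (P : BeurlingSystem) (hP : P.abscissa = 1) {s : ℂ} (hs : 1 < s.re) :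
    P.zeta s ≠ 0 := left_ne_zero_of_mul_eq_one (P.zeta_mul_moebiusSeries hP hs)

namespace ZetaContinuation

variable {P : BeurlingSystem} {K : ℂ → ℂ} {θ ρ : ℝ}

theorem div_eq_zeta (hK : P.ZetaContinuation K θ ρ) {s : ℂ} (hs : 1 < s.re) :
    K s / (s - 1) = P.zeta s := by
  rw [hK.eq s hs, mul_div_cancel_left₀ _ (sub_one_ne_zero hs)]

theorem differentiableOn_div (hK : P.ZetaContinuation K θ ρ) :
    DifferentiableOn ℂ (fun s => K s / (s - 1)) {s | θ < s.re ∧ s ≠ 1} :=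
  (hK.differentiableOn.mono fun _ hs => hs.1).div (by fun_prop) fun _ hs => sub_ne_zero.mpr hs.2

theorem div_ne_zero (hK : P.ZetaContinuation K θ ρ) (s : ℂ) (hs : θ < s.re) (h1 : s ≠ 1) :
    K s / (s - 1) ≠ 0 := _root_.div_ne_zero (hK.ne_zero s hs) (sub_ne_zero.mpr h1)

theorem exists_bounds (hK : P.ZetaContinuation K θ ρ) (hP : P.abscissa = 1) :
    ∃ B, ∀ s : ℂ, 2 ≤ s.re → ‖K s / (s - 1)‖ ≤ B ∧ B⁻¹ ≤ ‖K s / (s - 1)‖ := by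
  obtain ⟨B, hB⟩ := P.exists_zeta_bounds hP
  refine ⟨B, fun s hs => ?_⟩
  rw [hK.div_eq_zeta (by linarith)]
  exact hB s hs

/-- `dslope` fills the removable singularity of `ζ(s) - ρ * s / (s - 1)` at `1`, where `K s - ρ * s`
vanishes. This is the remainder fed to the Tauberian theorem. -/
theorem differentiableOn_dslope (hK : P.ZetaContinuation K θ ρ) (hθ1 : θ < 1) :
    DifferentiableOn ℂ (dslope (fun s => K s - ρ * s) 1) {s | θ < s.re} :=
  (Complex.differentiableOn_dslope ((isOpen_halfPlane θ).mem_nhds (by simpa using hθ1))).mpr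
    (hK.differentiableOn.sub (by fun_prop))

theorem dslope_eq (hK : P.ZetaContinuation K θ ρ) {s : ℂ} (h1 : s ≠ 1) :
    dslope (fun s => K s - ρ * s) 1 s = K s / (s - 1) - ρ * (s / (s - 1)) := by
  rw [dslope_of_ne _ h1, slope_def_field, hK.apply_one]
  ring

theorem subpolyGrowth_dslope (hK : P.ZetaContinuation K θ ρ) (hθ : 0 < θ)
    (hg : SubpolyGrowth (fun s => K s / (s - 1)) θ) :
    SubpolyGrowth (dslope (fun s => K s - ρ * s) 1) θ :=
  hg.sub_pole hθ.le fun _ _ h1 => hK.dslope_eq h1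

theorem isBigO_N (hK : P.ZetaContinuation K θ ρ) (hP : P.abscissa = 1) (hθ : 0 < θ) (hθ1 : θ < 1)
    (hρ : 0 < ρ) (hg : SubpolyGrowth (fun s => K s / (s - 1)) θ) {ε : ℝ} (hε : 0 < ε) :
    (fun x => P.N x - ρ * x) =O[atTop] fun x : ℝ => x ^ (θ + ε) := by
  obtain ⟨C, hC⟩ := P.expBound_N hP (σ := 3 / 2) (by norm_num)
  have key := abs_sub_exp_le_of_laplace (F := fun u => P.N (Real.exp u))
    (P.monotone_N.comp Real.exp_monotone) hC hρ.le hθ hθ1 (hK.subpolyGrowth_dslope hθ hg)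
    (hK.differentiableOn_dslope hθ1)
  obtain ⟨C', hC'⟩ := key (fun s hs => by
    have hs1 : 1 < s.re := by linarith
    have h0 : s ≠ 0 := by rintro rfl; norm_num at hs
    rw [P.laplace_N hP hs1, hK.dslope_eq (sub_ne_zero.mp (sub_one_ne_zero hs1)),
      hK.div_eq_zeta hs1]
    have := sub_one_ne_zero hs1
    field_simp
    ring) hε
  exact isBigO_of_abs_sub_exp_le hC'

/-- The Tauberian theorem applies to the monotone `N + M`, with transform `(ζ + 1/ζ)/s`. Its main
term `ρ * x` is that of `N`, so subtracting the estimate for `N` leaves `M`. -/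
theorem mem_MExponents (hK : P.ZetaContinuation K θ ρ) (hP : P.abscissa = 1) (hθ : 0 < θ)
    (hθ1 : θ < 1) (hρ : 0 < ρ) (hg : SubpolyGrowth (fun s => K s / (s - 1)) θ)
    (hg' : SubpolyGrowth (fun s => (K s / (s - 1))⁻¹) θ) {ε : ℝ} (hε : 0 < ε) :
    θ + ε ∈ P.MExponents := by
  have hσ : (1 : ℝ) < 3 / 2 := by norm_num
  obtain ⟨C, hC⟩ := P.expBound_N hP hσ
  obtain ⟨D, hD⟩ := P.expBound_M hP hσ
  have hE := hC.add hD
  simp only [inv_div] at hg'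
  have key := abs_sub_exp_le_of_laplace
    (F := fun u => P.N (Real.exp u) + P.M (Real.exp u)) (C₁ := C + D)
    (P.monotone_N_add_M.comp Real.exp_monotone) (by simpa using hE) hρ.le hθ hθ1
    ((hK.subpolyGrowth_dslope hθ hg).add hg')
    ((hK.differentiableOn_dslope hθ1).add
      (DifferentiableOn.div (by fun_prop) hK.differentiableOn hK.ne_zero))
  obtain ⟨C', hC'⟩ := key (fun s hs => by
    have hs1 : 1 < s.re := by linarith
    have h0 : s ≠ 0 := by rintro rfl; norm_num at hs
    have h3 := hC.laplace_add hD (s := s) (by linarith) (by linarith)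
    push_cast
    rw [h3, P.laplace_N hP hs1, P.laplace_M hP hs1,
      hK.dslope_eq (sub_ne_zero.mp (sub_one_ne_zero hs1)), hK.div_eq_zeta hs1]
    have h4 : (s - 1) / K s = P.moebiusSeries s := by
      rw [← inv_div, hK.div_eq_zeta hs1]
      exact inv_eq_of_mul_eq_one_right (P.zeta_mul_moebiusSeries hP hs1)
    rw [h4]
    have := sub_one_ne_zero hs1
    field_simp
    ring) hε
  have h1 : (fun x => P.N x + P.M x - ρ * x) =O[atTop] fun x : ℝ => x ^ (θ + ε) :=
    isBigO_of_abs_sub_exp_le (f := fun x => P.N x + P.M x) hC'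
  have h2 := h1.sub (hK.isBigO_N hP hθ hθ1 hρ hg hε)
  refine h2.congr_left fun x => ?_
  ring

theorem deriv_div (hK : P.ZetaContinuation K θ ρ) {s : ℂ} (hs : θ < s.re) (h1 : s ≠ 1) :
    deriv (fun s => K s / (s - 1)) s / (K s / (s - 1)) = deriv K s / K s - 1 / (s - 1) := by
  have h2 : s - 1 ≠ 0 := sub_ne_zero.mpr h1
  have h3 := (hK.differentiableOn.differentiableAt ((isOpen_halfPlane θ).mem_nhds hs)).hasDerivAt
  have h4 := h3.div ((hasDerivAt_id s).sub_const 1) h2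
  have h5 := hK.ne_zero s hs
  have : deriv (fun s => K s / (s - 1)) s = _ := h4.deriv
  rw [this]
  simp only [id]
  field_simp

/-- Here `-ζ'/ζ - s/(s - 1) = -K'/K - 1`, which is holomorphic on the half-plane because `K` has no
zeros. -/
theorem mem_psiExponents (hK : P.ZetaContinuation K θ ρ) (hP : P.abscissa = 1) (hθ : 0 < θ)
    (hθ1 : θ < 1)
    (hg : SubpolyGrowth (fun s => deriv (fun s => K s / (s - 1)) s / (K s / (s - 1))) θ) {ε : ℝ}
    (hε : 0 < ε) : θ + ε ∈ P.psiExponents := by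
  obtain ⟨C, hC⟩ := P.expBound_psi hP (σ := 3 / 2) (by norm_num)
  have hH : SubpolyGrowth (fun s => -(deriv K s / K s) - 1) θ := by
    refine hg.neg.sub_pole (c := 1) hθ.le fun s hs h1 => ?_
    rw [hK.deriv_div hs h1]
    have : s - 1 ≠ 0 := sub_ne_zero.mpr h1
    field_simp
    ring
  have key := abs_sub_exp_le_of_laplace (F := fun u => P.psi (Real.exp u)) (c := 1)
    (P.monotone_psi.comp Real.exp_monotone) hC zero_le_one hθ hθ1 hH
    (((hK.differentiableOn.deriv (isOpen_halfPlane θ)).div hK.differentiableOn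
      hK.ne_zero).neg.sub_const 1)
  obtain ⟨C', hC'⟩ := key (fun s hs => by
    have hs1 : 1 < s.re := by linarith
    have h0 : s ≠ 0 := by rintro rfl; norm_num at hs
    have h2 := sub_one_ne_zero hs1
    have h3 : deriv (fun s => K s / (s - 1)) s = deriv P.zeta s := by
      refine Filter.EventuallyEq.deriv_eq ?_
      filter_upwards [(isOpen_halfPlane 1).mem_nhds hs1] with z hz using hK.div_eq_zeta hz
    have h4 := hK.deriv_div (s := s) (by linarith) (sub_ne_zero.mp h2)
    rw [h3, hK.div_eq_zeta hs1, P.deriv_zeta hP hs1, neg_div,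
      mul_div_cancel_right₀ _ (P.zeta_ne_zero hP hs1)] at h4
    have h5 : deriv K s / K s = 1 / (s - 1) - P.mangoldtSeries s := by
      rw [eq_sub_iff_add_eq, ← sub_eq_zero]; linear_combination -h4
    rw [P.laplace_psi hP hs1, h5]
    push_cast
    field_simp
    ring) hε
  have := isBigO_of_abs_sub_exp_le hC'
  simpa [psiExponents] using this

end ZetaContinuation

end BeurlingSystem

/-! ### Zero-free continuation from two of the three error terms -/

namespace BeurlingSystem

variable {P : BeurlingSystem} {θ ρ : ℝ}

theorem zetaContinuation_polynomial_growth {R : ℂ → ℂ} (hθ : 0 < θ)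
    (hR : ∀ ε > 0, ∃ c, ∀ s : ℂ, θ + ε ≤ s.re → s.re ≤ 6 → 1 ≤ |s.im| → ‖R s‖ ≤ c * |s.im| ^ 2) :
    ∀ ε > 0, ∃ C, ∀ s : ℂ, θ + ε ≤ s.re → s.re ≤ 6 → 1 ≤ |s.im| →
      ‖((s - 1) * R s + ρ * s) / (s - 1)‖ ≤ C * |s.im| ^ 2 := by
  intro ε hε
  obtain ⟨c, hc⟩ := hR ε hε
  refine ⟨c + |ρ| * 7, fun s h1 h2 h3 => ?_⟩
  have h4 : s - 1 ≠ 0 := sub_ne_zero.mpr (ne_one_of_one_le_abs_im h3)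
  have h5 : ((s - 1) * R s + ρ * s) / (s - 1) = R s + ρ * (s / (s - 1)) := by field_simp
  rw [h5, add_mul]
  refine (norm_add_le _ _).trans (add_le_add (hc s h1 h2 h3) ?_)
  rw [norm_mul, Complex.norm_real, Real.norm_eq_abs]
  refine (mul_le_mul_of_nonneg_left (norm_div_sub_one_le (by linarith) h2 h3)
    (abs_nonneg _)).trans (le_mul_of_one_le_right (by positivity) ?_)
  exact one_le_pow₀ h3

theorem subpolyGrowth_of_isBigO_N (hP : P.abscissa = 1) (hθ : 0 < θ) (hθ1 : θ < 1) {C : ℝ}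
    (hC : ExpBound (fun u => (P.N (Real.exp u) : ℂ) - ρ * truncExp u) θ C) {K : ℂ → ℂ}
    (hKeq : K = fun s => (s - 1) * mellinRemainder P.N ρ s + ρ * s)
    (hK : P.ZetaContinuation K θ ρ) :
    SubpolyGrowth (fun s => K s / (s - 1)) θ ∧ SubpolyGrowth (fun s => (K s / (s - 1))⁻¹) θ ∧
      SubpolyGrowth (fun s => deriv (fun s => K s / (s - 1)) s / (K s / (s - 1))) θ := by
  obtain ⟨B, hB⟩ := hK.exists_bounds hP
  refine subpolyGrowth_of_polynomial_growth hθ hθ1 hK.differentiableOn_div hK.div_ne_zero hB ?_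
  rw [hKeq]
  exact zetaContinuation_polynomial_growth hθ fun ε hε => norm_mellinRemainder_le hC hθ hε

theorem differentiableOn_zetaContinuation {C : ℝ}
    (hC : ExpBound (fun u => (P.N (Real.exp u) : ℂ) - ρ * truncExp u) θ C) :
    DifferentiableOn ℂ (fun s => (s - 1) * mellinRemainder P.N ρ s + ρ * s) {s | θ < s.re} := by
  have := differentiableOn_mellinRemainder hC
  fun_prop

theorem zetaContinuation_eq (hP : P.abscissa = 1) {s : ℂ} (hs : 1 < s.re) :
    (s - 1) * mellinRemainder P.N ρ s + ρ * s = (s - 1) * P.zeta s := by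
  rw [P.zeta_eq_mellinRemainder hP ρ hs]
  have := sub_one_ne_zero hs
  field_simp

theorem deriv_zetaContinuation_eq (hP : P.abscissa = 1) {K : ℂ → ℂ}
    (hK : ∀ s : ℂ, 1 < s.re → K s = (s - 1) * P.zeta s) {s : ℂ} (hs : 1 < s.re) :
    deriv K s = (-1 - mellinRemainder P.psi 1 s) * K s := by
  have h1 : K =ᶠ[𝓝 s] fun s => (s - 1) * P.zeta s := by
    filter_upwards [(isOpen_halfPlane 1).mem_nhds hs] with z hz using hK z hz
  have h2 := ((hasDerivAt_id s).sub_const 1).mul (P.differentiableAt_zeta hP hs).hasDerivAt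
  rw [h1.deriv_eq, hK s hs]
  refine h2.deriv.trans ?_
  rw [P.deriv_zeta hP hs, P.mangoldtSeries_eq_mellinRemainder hP hs]
  have := sub_one_ne_zero hs
  simp only [id]
  field_simp
  ring

theorem deriv_moebiusSeries_eq (hP : P.abscissa = 1) {D : ℂ → ℂ}
    (hD : ∀ s : ℂ, 1 < s.re → D s = P.moebiusSeries s) {s : ℂ} (hs : 1 < s.re)
    (hd : DifferentiableAt ℂ D s) : deriv D s = P.mangoldtSeries s * D s := by
  have h1 : (fun s => P.zeta s * D s) =ᶠ[𝓝 s] fun _ => 1 := by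
    filter_upwards [(isOpen_halfPlane 1).mem_nhds hs] with z hz
    rw [hD z hz, P.zeta_mul_moebiusSeries hP hz]
  have h2 := (P.differentiableAt_zeta hP hs).hasDerivAt.mul hd.hasDerivAt
  have h3 : deriv (fun s => P.zeta s * D s) s = 0 := by rw [h1.deriv_eq, deriv_const]
  have h4 := h2.deriv.symm.trans h3
  rw [P.deriv_zeta hP hs] at h4
  refine mul_left_cancel₀ (P.zeta_ne_zero hP hs) ?_
  linear_combination h4

/-- By the identity theorem `K` times the continuation of `1 / ζ` equals `s - 1`, so `K` can vanish
only at `1`, where its value is `ρ > 0`. -/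
theorem zetaContinuation_of_N_M (hP : P.abscissa = 1) (hθ : 0 < θ) (hρ : 0 < ρ)
    {C : ℝ} (hC : ExpBound (fun u => (P.N (Real.exp u) : ℂ) - ρ * truncExp u) θ C)
    (hM : θ ∈ P.MExponents) :
    P.ZetaContinuation (fun s => (s - 1) * mellinRemainder P.N ρ s + ρ * s) θ ρ := by
  obtain ⟨D, hD⟩ := P.exists_expBound_M hP hθ.le hM
  have hd := differentiableOn_zetaContinuation hC
  refine ⟨hd, fun s hs h0 => ?_, fun s hs => zetaContinuation_eq hP hs, by simp⟩
  have h1 := eq_of_eq_of_one_lt_re (hd.mul (differentiableOn_mellinRemainder hD))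
    (g := fun s => s - 1) (by fun_prop) (fun s hs => by
      rw [Pi.mul_apply, zetaContinuation_eq hP hs, ← P.moebiusSeries_eq_mellinRemainder hP hs,
        mul_assoc, P.zeta_mul_moebiusSeries hP hs, mul_one]) hs
  rw [Pi.mul_apply, h0, zero_mul] at h1
  have h2 : s = 1 := (sub_eq_zero.mp h1.symm)
  rw [h2] at h0
  simp [hρ.ne'] at h0

/-- The logarithmic derivative identity continues as `K' = (-1 - R) * K` with `R` the remainder of
`psi`, and `K 2 ≠ 0`. -/
theorem zetaContinuation_of_N_psi (hP : P.abscissa = 1) (hθ : 0 < θ)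
    {C : ℝ} (hC : ExpBound (fun u => (P.N (Real.exp u) : ℂ) - ρ * truncExp u) θ C)
    (hψ : θ ∈ P.psiExponents) (hθ1 : θ < 1) :
    P.ZetaContinuation (fun s => (s - 1) * mellinRemainder P.N ρ s + ρ * s) θ ρ := by
  obtain ⟨D, hD⟩ := P.exists_expBound_psi hP hθ.le hψ
  have hd := differentiableOn_zetaContinuation hC
  have hQ : DifferentiableOn ℂ (fun s => -1 - mellinRemainder P.psi 1 s) {s | θ < s.re} :=
    (differentiableOn_mellinRemainder hD).const_sub (-1)
  refine ⟨hd, fun s hs => ?_, fun s hs => zetaContinuation_eq hP hs, by simp⟩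
  have h2 : (1 : ℝ) < (2 : ℂ).re := by norm_num
  refine ne_zero_of_deriv_eq_mul hd hQ.continuousOn (fun z hz => ?_) (s₁ := 2)
    (hθ1.trans h2) ?_ hs
  · exact eq_of_eq_of_one_lt_re (hd.deriv (isOpen_halfPlane θ)) (hQ.mul hd) (fun w hw =>
      deriv_zetaContinuation_eq hP (fun s hs => zetaContinuation_eq hP hs) hw) hz
  · rw [zetaContinuation_eq hP h2]
    exact mul_ne_zero (sub_one_ne_zero h2) (P.zeta_ne_zero hP h2)

theorem exists_zeta_eq_ofReal (P : BeurlingSystem) (σ : ℝ) :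
    ∃ r : ℝ, 0 ≤ r ∧ P.zeta σ = r := by
  refine ⟨∑' e, Real.exp (-σ * P.logVal e), tsum_nonneg fun _ => (Real.exp_nonneg _), ?_⟩
  rw [zeta, Complex.ofReal_tsum]
  simp [term]

/-- `K 1` is the limit of `(s - 1) * ζ(s)` along reals `s ↓ 1`, where the values are real and
nonnegative. This supplies the density `ρ` when no law for `N` is assumed. -/
theorem exists_eq_ofReal_of_eq_zeta {K : ℂ → ℂ} (hK : ContinuousAt K 1)
    (hKeq : ∀ s : ℂ, 1 < s.re → K s = (s - 1) * P.zeta s) (h1 : K 1 ≠ 0) :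
    ∃ ρ : ℝ, 0 < ρ ∧ K 1 = ρ := by
  have hcl : IsClosed {z : ℂ | 0 ≤ z.re ∧ z.im = 0} :=
    (isClosed_le continuous_const Complex.continuous_re).inter
      (isClosed_eq Complex.continuous_im continuous_const)
  have hseq : Tendsto (fun n : ℕ => ((1 + 1 / ((n : ℝ) + 1) : ℝ) : ℂ)) atTop (𝓝 1) := by
    have := (tendsto_one_div_add_atTop_nhds_zero_nat (𝕜 := ℝ)).const_add 1
    rw [add_zero] at this
    exact_mod_cast (Complex.continuous_ofReal.tendsto 1).comp this
  have hmem : K 1 ∈ {z : ℂ | 0 ≤ z.re ∧ z.im = 0} := by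
    refine hcl.mem_of_tendsto (hK.tendsto.comp hseq) (.of_forall fun n => ?_)
    have hn : (0 : ℝ) < 1 / ((n : ℝ) + 1) := by positivity
    obtain ⟨r, hr, hz⟩ := P.exists_zeta_eq_ofReal (1 + 1 / ((n : ℝ) + 1))
    rw [Function.comp_apply, hKeq _ (by rw [Complex.ofReal_re]; linarith), hz]
    have : ((1 + 1 / ((n : ℝ) + 1) : ℝ) : ℂ) - 1 = ((1 / ((n : ℝ) + 1) : ℝ) : ℂ) := by
      push_cast; ring
    rw [this, ← Complex.ofReal_mul]
    exact ⟨by rw [Complex.ofReal_re]; positivity, Complex.ofReal_im _⟩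
  have hre : K 1 = ((K 1).re : ℂ) := Complex.ext rfl (by simpa using hmem.2)
  refine ⟨(K 1).re, lt_of_le_of_ne hmem.1 fun h => h1 ?_, hre⟩
  rw [hre, ← h, Complex.ofReal_zero]

/-- The continuation `D` of `1 / ζ` has a zero at `1`. Dividing it out gives `E` with `E' = (R + 1)
* E`, hence without zeros, and `K = 1 / E`. Growth of `ζ` is deduced from the polynomial bound on
`D`. -/
theorem exists_zetaContinuation_of_M_psi (hP : P.abscissa = 1) (hθ : 0 < θ) (hθ1 : θ < 1)
    (hM : θ ∈ P.MExponents) (hψ : θ ∈ P.psiExponents) :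
    ∃ K ρ, 0 < ρ ∧ P.ZetaContinuation K θ ρ ∧ SubpolyGrowth (fun s => K s / (s - 1)) θ := by
  obtain ⟨C, hC⟩ := P.exists_expBound_M hP hθ.le hM
  obtain ⟨C', hC'⟩ := P.exists_expBound_psi hP hθ.le hψ
  set D := mellinRemainder P.M 0 with hDdef
  set R := mellinRemainder P.psi 1 with hRdef
  have hD : DifferentiableOn ℂ D {s | θ < s.re} := differentiableOn_mellinRemainder hC
  have hR : DifferentiableOn ℂ R {s | θ < s.re} := differentiableOn_mellinRemainder hC'
  have hDeq : ∀ s : ℂ, 1 < s.re → D s = P.moebiusSeries s := fun s hs =>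
    (P.moebiusSeries_eq_mellinRemainder hP hs).symm
  have hD' : DifferentiableOn ℂ (deriv D) {s | θ < s.re} := hD.deriv (isOpen_halfPlane θ)
  have hnhds : ∀ s : ℂ, θ < s.re → {s : ℂ | θ < s.re} ∈ 𝓝 s := fun s hs =>
    (isOpen_halfPlane θ).mem_nhds hs
  have h1mem : θ < (1 : ℂ).re := by simpa using hθ1
  have hderiv : ∀ s : ℂ, 1 < s.re → (s - 1) * deriv D s = ((s - 1) * R s + s) * D s := by
    intro s hs
    rw [deriv_moebiusSeries_eq hP hDeq hs (hD.differentiableAt (hnhds s (hθ1.trans hs))),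
      P.mangoldtSeries_eq_mellinRemainder hP hs]
    have := sub_one_ne_zero hs
    change (s - 1) * ((R s + s / (s - 1)) * D s) = _
    field_simp
  -- The identity `hderiv` persists at `s = 1`, where its left side vanishes and its right side is
  -- `D 1`.
  have hD1 : D 1 = 0 := by
    have := eq_of_eq_of_one_lt_re (f := fun s => (s - 1) * deriv D s)
      (g := fun s => ((s - 1) * R s + s) * D s) (by fun_prop) (by fun_prop) hderiv h1mem
    simpa using this.symm
  set E := dslope D 1 with hEdef
  have hE : DifferentiableOn ℂ E {s | θ < s.re} :=
    (Complex.differentiableOn_dslope (hnhds 1 h1mem)).mpr hD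
  have hDE : ∀ s, D s = (s - 1) * E s := fun s => by
    have := sub_smul_dslope D 1 s
    rw [hD1, sub_zero, smul_eq_mul] at this
    exact this.symm
  have hE' : ∀ s : ℂ, 1 < s.re → deriv E s = (R s + 1) * E s := by
    intro s hs
    have h2 := ((hasDerivAt_id s).sub_const 1).mul
      (hE.differentiableAt (hnhds s (hθ1.trans hs))).hasDerivAt
    have h3 : D = (fun s => id s - 1) * E := funext hDE
    rw [← h3] at h2
    have h4 := hderiv s hs
    rw [h2.deriv, hDE s] at h4
    have h5 := sub_one_ne_zero hs
    refine mul_left_cancel₀ (mul_ne_zero h5 h5) ?_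
    simp only [id] at h4
    linear_combination h4
  have h2 : (1 : ℝ) < (2 : ℂ).re := by norm_num
  have hEne : ∀ s : ℂ, θ < s.re → E s ≠ 0 := fun s hs => by
    refine ne_zero_of_deriv_eq_mul hE (Q := fun s => R s + 1) (hR.add_const 1).continuousOn
      (fun z hz => ?_) (s₁ := 2) (hθ1.trans h2) (fun h0 => ?_) hs
    · exact eq_of_eq_of_one_lt_re (hE.deriv (isOpen_halfPlane θ)) ((hR.add_const 1).mul hE) hE' hz
    · have h3 := hDE 2
      rw [h0, mul_zero, hDeq 2 h2] at h3
      have h4 := P.zeta_mul_moebiusSeries hP h2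
      rw [h3, mul_zero] at h4
      exact zero_ne_one h4
  have hKeq : ∀ s : ℂ, 1 < s.re → (E s)⁻¹ = (s - 1) * P.zeta s := by
    intro s hs
    refine inv_eq_of_mul_eq_one_left ?_
    have h3 := P.zeta_mul_moebiusSeries hP hs
    rw [← hDeq s hs, hDE s] at h3
    linear_combination h3
  have hKd : DifferentiableOn ℂ (fun s => (E s)⁻¹) {s | θ < s.re} := hE.inv hEne
  obtain ⟨ρ, hρ, hρ1⟩ := exists_eq_ofReal_of_eq_zeta
    (hKd.differentiableAt (hnhds 1 h1mem)).continuousAt hKeq (inv_ne_zero (hEne 1 h1mem))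
  have hK : P.ZetaContinuation (fun s => (E s)⁻¹) θ ρ :=
    ⟨hKd, fun s hs => inv_ne_zero (hEne s hs), hKeq, hρ1⟩
  obtain ⟨B, hB⟩ := hK.exists_bounds hP
  refine ⟨_, ρ, hρ, hK, (subpolyGrowth_of_polynomial_growth_inv hθ hθ1 hK.differentiableOn_div
    hK.div_ne_zero hB fun ε hε => ?_).1⟩
  obtain ⟨c, hc⟩ := norm_mellinRemainder_le hC hθ hε
  refine ⟨c, fun s h1 h2 h3 => ?_⟩
  rw [inv_div, div_inv_eq_mul, ← hDE s]
  exact hc s h1 h2 h3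

theorem psiExponents_of_N_M (hP : P.abscissa = 1) (hθ : 0 < θ) (hθ1 : θ < 1)
    (hN : θ ∈ P.NExponents) (hM : θ ∈ P.MExponents) {ε : ℝ} (hε : 0 < ε) :
    θ + ε ∈ P.psiExponents := by
  obtain ⟨ρ, hρ, hO⟩ := hN
  obtain ⟨C, hC⟩ := P.exists_expBound_N hP hθ.le hO
  have hK := zetaContinuation_of_N_M hP hθ hρ hC hM
  exact hK.mem_psiExponents hP hθ hθ1 (subpolyGrowth_of_isBigO_N hP hθ hθ1 hC rfl hK).2.2 hε

theorem MExponents_of_N_psi (hP : P.abscissa = 1) (hθ : 0 < θ) (hθ1 : θ < 1)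
    (hN : θ ∈ P.NExponents) (hψ : θ ∈ P.psiExponents) {ε : ℝ} (hε : 0 < ε) :
    θ + ε ∈ P.MExponents := by
  obtain ⟨ρ, hρ, hO⟩ := hN
  obtain ⟨C, hC⟩ := P.exists_expBound_N hP hθ.le hO
  have hK := zetaContinuation_of_N_psi hP hθ hC hψ hθ1
  have hg := subpolyGrowth_of_isBigO_N hP hθ hθ1 hC rfl hK
  exact hK.mem_MExponents hP hθ hθ1 hρ hg.1 hg.2.1 hε

theorem NExponents_of_M_psi (hP : P.abscissa = 1) (hθ : 0 < θ) (hθ1 : θ < 1)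
    (hM : θ ∈ P.MExponents) (hψ : θ ∈ P.psiExponents) {ε : ℝ} (hε : 0 < ε) :
    θ + ε ∈ P.NExponents := by
  obtain ⟨K, ρ, hρ, hK, hg⟩ := exists_zetaContinuation_of_M_psi hP hθ hθ1 hM hψ
  exact ⟨ρ, hρ, hK.isBigO_N hP hθ hθ1 hρ hg hε⟩

/-- The two laws make `ζ` subpolynomial to the left of `1 / 2`, which the integrality of the jumps
of `N` forbids. -/
theorem not_N_and_M (hP : P.abscissa = 1) (hθ : 0 < θ) (hθ1 : θ < 1 / 2)
    (hN : θ ∈ P.NExponents) (hM : θ ∈ P.MExponents) : False := by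
  obtain ⟨ρ, hρ, hO⟩ := hN
  obtain ⟨C, hC⟩ := P.exists_expBound_N hP hθ.le hO
  have hK := zetaContinuation_of_N_M hP hθ hρ hC hM
  have hg := (subpolyGrowth_of_isBigO_N hP hθ (by linarith) hC rfl hK).1
  refine false_of_subpolyGrowth (F := fun u => P.N (Real.exp u))
    (P.monotone_N.comp Real.exp_monotone) (fun u => P.exists_N_eq_int _) hρ hθ hθ1 hC
    (hg.sub_pole (c := ρ) hθ.le fun s _ h1 => ?_)
  have : s - 1 ≠ 0 := sub_ne_zero.mpr h1
  rw [mellinRemainder]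
  field_simp
  ring

end BeurlingSystem

/-! ### Optimal exponents and conclusion -/

theorem isBigO_of_expBound {f : ℝ → ℝ} {θ C : ℝ} (hθ : 1 ≤ θ) (ρ : ℝ)
    (h : ExpBound (fun u => (f (Real.exp u) : ℂ)) θ C) :
    (fun x => f x - ρ * x) =O[atTop] fun x : ℝ => x ^ θ := by
  refine isBigO_of_abs_sub_exp_le (C := C + |ρ|) fun u hu => ?_
  have h1 := h.bound u (by linarith)
  rw [Complex.norm_real, Real.norm_eq_abs] at h1
  refine (abs_sub _ _).trans ?_
  rw [add_mul, abs_mul, Real.abs_exp]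
  refine add_le_add h1 (mul_le_mul_of_nonneg_left (Real.exp_le_exp.mpr ?_) (abs_nonneg _))
  nlinarith

namespace BeurlingSystem

theorem mem_of_optimal_lt {S : Set ℝ} (hS : IsUpperSet S) {θ : ℝ} (h : optimal S < θ) : θ ∈ S := by
  obtain ⟨_, ⟨η, hη, rfl⟩, hlt⟩ := sInf_lt_iff.mp h
  exact hS (EReal.coe_lt_coe_iff.mp hlt).le hη

theorem optimal_le_coe {S : Set ℝ} {θ : ℝ} (h : ∀ ε > 0, θ + ε ∈ S) : optimal S ≤ θ := by
  refine le_of_forall_gt fun c hc => ?_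
  obtain ⟨b, hb1, hb2⟩ := EReal.lt_iff_exists_real_btwn.mp hc
  have hb := h (b - θ) (sub_pos.mpr (EReal.coe_lt_coe_iff.mp hb1))
  rw [add_sub_cancel] at hb
  exact (sInf_le (Set.mem_image_of_mem _ hb)).trans_lt hb2

theorem alpha_le_one (P : BeurlingSystem) (hP : P.abscissa = 1) : P.alpha ≤ (1 : ℝ) :=
  optimal_le_coe fun ε hε => by
    obtain ⟨C, hC⟩ := P.expBound_psi hP (σ := 1 + ε) (by linarith)
    simpa [psiExponents] using isBigO_of_expBound (by linarith) 1 hC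

theorem beta_le_one (P : BeurlingSystem) (hP : P.abscissa = 1) : P.beta ≤ (1 : ℝ) :=
  optimal_le_coe fun ε hε => by
    obtain ⟨C, hC⟩ := P.expBound_N hP (σ := 1 + ε) (by linarith)
    exact ⟨1, one_pos, isBigO_of_expBound (by linarith) 1 hC⟩

theorem gamma_le_one (P : BeurlingSystem) (hP : P.abscissa = 1) : P.gamma ≤ (1 : ℝ) :=
  optimal_le_coe fun ε hε => by
    obtain ⟨C, hC⟩ := P.expBound_M hP (σ := 1 + ε) (by linarith)
    simpa [MExponents] using isBigO_of_expBound (by linarith) 0 hC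

end BeurlingSystem

/-- A counterexample would leave a real `θ` strictly between the maximum and `c`. The bound `c ≤ 1`
forces `θ < 1`, and the `0` in the maximum forces `θ > 0`, the range where the continuation
arguments work. -/
theorem EReal.le_max_of_forall_real {a b c : EReal} (hc : c ≤ (1 : ℝ))
    (h : ∀ θ : ℝ, 0 < θ → θ < 1 → a < θ → b < θ → c ≤ θ) : c ≤ max (max a b) 0 := by
  by_contra! hlt
  obtain ⟨θ, h1, h2⟩ := EReal.lt_iff_exists_real_btwn.mp hlt
  obtain ⟨h3, h0⟩ := max_lt_iff.mp h1
  obtain ⟨ha, hb⟩ := max_lt_iff.mp h3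
  exact absurd (h θ (by exact_mod_cast h0) (EReal.coe_lt_coe_iff.mp (h2.trans_le hc)) ha hb)
    (not_le.mpr h2)

/-- The larger of `b` and `c` is at least `m > 0`, so its own bound cannot come from the `0`, and it
dominates `a`. It must therefore be matched by one of the other two. -/
theorem TwoLargestEqualAndGe.of_le_max {a b c m : EReal} (hm : 0 < m) (ha : a ≤ max (max b c) 0)
    (hb : b ≤ max (max c a) 0) (hc : c ≤ max (max a b) 0) (h : m ≤ max b c) :
    TwoLargestEqualAndGe a b c m := by
  have pos : ∀ x, m ≤ x → ¬ x ≤ 0 := fun x hx h0 => absurd (hm.trans_le (hx.trans h0)) (lt_irrefl 0)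
  simp only [le_max_iff] at ha hb hc h
  unfold TwoLargestEqualAndGe
  rcases le_total b c with hbc | hbc
  · have hmc : m ≤ c := h.elim (fun h => h.trans hbc) id
    have hac : a ≤ c := ha.elim (fun h => h.elim (fun h => h.trans hbc) id)
      fun h => h.trans (hm.le.trans hmc)
    rcases hc with (hca | hcb) | h0
    · exact .inr (.inl ⟨le_antisymm hac hca, hbc.trans hca, hmc.trans hca⟩)
    · exact .inr (.inr ⟨le_antisymm hbc hcb, hac.trans hcb, hmc.trans hcb⟩)
    · exact absurd h0 (pos c hmc)
  · have hmb : m ≤ b := h.elim id fun h => h.trans hbc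
    have hab : a ≤ b := ha.elim (fun h => h.elim id fun h => h.trans hbc)
      fun h => h.trans (hm.le.trans hmb)
    rcases hb with (hb | hb) | h0
    · exact .inr (.inr ⟨le_antisymm hb hbc, hab, hmb⟩)
    · exact .inl ⟨le_antisymm hab hb, hbc.trans hb, hmb.trans hb⟩
    · exact absurd h0 (pos b hmb)

theorem theorem1 (P : BeurlingSystem) (hP : P.abscissa = 1) :
    TwoLargestEqualAndGe P.alpha P.beta P.gamma ((1 / 2 : ℝ) : EReal) := by
  have mψ {θ : ℝ} (h : P.alpha < θ) := BeurlingSystem.mem_of_optimal_lt P.isUpperSet_psiExponents h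
  have mN {θ : ℝ} (h : P.beta < θ) := BeurlingSystem.mem_of_optimal_lt P.isUpperSet_NExponents h
  have mM {θ : ℝ} (h : P.gamma < θ) := BeurlingSystem.mem_of_optimal_lt P.isUpperSet_MExponents h
  refine .of_le_max (by exact_mod_cast (by norm_num : (0 : ℝ) < 1 / 2))
    (EReal.le_max_of_forall_real (P.alpha_le_one hP) fun θ h0 h1 hb hc =>
      BeurlingSystem.optimal_le_coe fun ε hε => BeurlingSystem.psiExponents_of_N_M hP h0 h1 (mN hb) (mM hc) hε)
    (EReal.le_max_of_forall_real (P.beta_le_one hP) fun θ h0 h1 hc ha =>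
      BeurlingSystem.optimal_le_coe fun ε hε => BeurlingSystem.NExponents_of_M_psi hP h0 h1 (mM hc) (mψ ha) hε)
    (EReal.le_max_of_forall_real (P.gamma_le_one hP) fun θ h0 h1 ha hb =>
      BeurlingSystem.optimal_le_coe fun ε hε => BeurlingSystem.MExponents_of_N_psi hP h0 h1 (mN hb) (mψ ha) hε) ?_
  -- It remains to show `max β γ ≥ 1 / 2`; otherwise some `θ` in `(0, 1 / 2)` is admissible for both
  -- `N` and `M`.
  by_contra! hlt
  have hlt' : max (max P.beta P.gamma) 0 < ((1 / 2 : ℝ) : EReal) :=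
    max_lt hlt (by exact_mod_cast (by norm_num : (0 : ℝ) < 1 / 2))
  obtain ⟨θ, h1, h2⟩ := EReal.lt_iff_exists_real_btwn.mp hlt'
  obtain ⟨h3, h0⟩ := max_lt_iff.mp h1
  obtain ⟨hb, hc⟩ := max_lt_iff.mp h3
  exact BeurlingSystem.not_N_and_M hP (by exact_mod_cast h0) (EReal.coe_lt_coe_iff.mp h2) (mN hb) (mM hc)
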